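/- Let $\Sigma$ be a smooth oriented surface and let $r:\Sigma\to\mathbb R^4$ be a smooth immersion. By a conformal parameter $z\in W$ we mean an open set $W\subset\mathbb C$ together with a smooth orientation-preserving map $\sigma:W\to\Sigma$ such that the metric induced on $W$ by $x=r\circ\sigma$ has the form $e^{2\alpha}\,dz\,d\bar z$ (then $\sigma$ is a local diffeomorphism; it need not be injective). Write $\partial=\partial/\partial z$, $\bar\partial=\partial/\partial\bar z$. Then: (1) Every point of $\Sigma$ lies in the image of a conformal parameter $\sigma:W\to\Sigma$ with $W$ simply connected, $\sigma$ injective and $\sigma(W)$ open. (2) For every conformal parameter $\sigma:W\to\Sigma$ the surface $x=r\circ\sigma=(x^1,x^2,x^3,x^4)$ has a Weierstrass representation on $W$: there are smooth functions $\psi=(\psi_1,\psi_2):W\to\mathbb C^2$, $\varphi=(\varphi_1,\varphi_2):W\to\mathbb C^2$ and $U:W\to\mathbb C$ with $$\mathcal D\psi=0,\qquad \mathcal D^\vee\varphi=0,$$ $$\mathcal D=\begin{pmatrix}0&\partial\\-\bar\partial&0\end{pmatrix}+\begin{pmatrix}U&0\\0&\bar U\end{pmatrix},\qquad \mathcal D^\vee=\begin{pmatrix}0&\partial\\-\bar\partial&0\end{pmatrix}+\begin{pmatrix}\bar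 U&0\\0&U\end{pmatrix},$$ such that $$x^k(b)=x^k(a)+\int_\gamma\left(f_k\,dz+\bar f_k\,d\bar z\right),\qquad k=1,2,3,4,$$ for every $C^1$ path $\gamma$ in $W$ from $a$ to $b$, where $$f_1=\tfrac i2(\bar\varphi_2\bar\psi_2+\varphi_1\psi_1),\quad f_2=\tfrac12(\bar\varphi_2\bar\psi_2-\varphi_1\psi_1),\quad f_3=\tfrac12(\bar\varphi_2\psi_1+\varphi_1\bar\psi_2),\quad f_4=\tfrac i2(\bar\varphi_2\psi_1-\varphi_1\bar\psi_2).$$ Moreover $e^{2\alpha}=(|\psi_1|^2+|\psi_2|^2)(|\varphi_1|^2+|\varphi_2|^2)$ and $|U|=\tfrac12|\mathbf H|e^{\alpha}$, where $\mathbf H=2x_{z\bar z}/e^{2\alpha}$ is the mean curvature vector. -/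

import Mathlib

open Set
open scoped Manifold ContDiff ComplexConjugate Topology

noncomputable section

/-- The Wirtinger derivative `∂f/∂z = (f_x - i f_y) / 2`. -/
def wirtD (f : ℂ → ℂ) (z : ℂ) : ℂ :=
  (fderiv ℝ f z 1 - Complex.I * fderiv ℝ f z Complex.I) / 2

/-- The Wirtinger derivative `∂f/∂z̄ = (f_x + i f_y) / 2`. -/
def wirtDbar (f : ℂ → ℂ) (z : ℂ) : ℂ :=
  (fderiv ℝ f z 1 + Complex.I * fderiv ℝ f z Complex.I) / 2

/-- The Dirac operator `𝒟 = (0, ∂; -∂̄, 0) + diag(U, Ū)` with complex potential `U`, acting on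
`ψ = (ψ₁, ψ₂)` (the components `ψ₁, ψ₂` are `ψ · 0, ψ · 1`). -/
def diracOp (U : ℂ → ℂ) (ψ : ℂ → Fin 2 → ℂ) (z : ℂ) : Fin 2 → ℂ :=
  ![wirtD (fun w => ψ w 1) z + U z * ψ z 0,
    -wirtDbar (fun w => ψ w 0) z + conj (U z) * ψ z 1]

/-- The operator `𝒟^∨ = (0, ∂; -∂̄, 0) + diag(Ū, U)`. -/
def diracOpDual (U : ℂ → ℂ) (φ : ℂ → Fin 2 → ℂ) (z : ℂ) : Fin 2 → ℂ :=
  ![wirtD (fun w => φ w 1) z + conj (U z) * φ z 0,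
    -wirtDbar (fun w => φ w 0) z + U z * φ z 1]

/-- The functions `f₁, f₂, f₃, f₄` of the Weierstrass representation. -/
def weierstrassCoeff (ψ φ : ℂ → Fin 2 → ℂ) (z : ℂ) : Fin 4 → ℂ :=
  ![Complex.I / 2 * (conj (φ z 1) * conj (ψ z 1) + φ z 0 * ψ z 0),
    1 / 2 * (conj (φ z 1) * conj (ψ z 1) - φ z 0 * ψ z 0),
    1 / 2 * (conj (φ z 1) * ψ z 0 + φ z 0 * conj (ψ z 1)),
    Complex.I / 2 * (conj (φ z 1) * ψ z 0 - φ z 0 * conj (ψ z 1))]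

/-- The `1`-form `η_k = f_k dz + f̄_k dz̄`. -/
def weierstrassForm (ψ φ : ℂ → Fin 2 → ℂ) (k : Fin 4) (z : ℂ) : ℂ →L[ℝ] ℂ :=
  weierstrassCoeff ψ φ z k • ContinuousLinearMap.id ℝ ℂ
    + conj (weierstrassCoeff ψ φ z k) • Complex.conjCLE.toContinuousLinearMap

/-- `X : W → ℝ⁴` is given on the open set `W ⊆ ℂ` by the Weierstrass formulas with smooth spinors
`ψ, φ` and smooth complex potential `U`: the Dirac equations `𝒟ψ = 0`, `𝒟^∨φ = 0` hold on `W`, and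
`x^k(b) = x^k(a) + ∫_γ η_k` for every `C¹` path `γ` in `W` from `a` to `b`. -/
structure IsWeierstrassRepresentation (W : Set ℂ) (X : ℂ → EuclideanSpace ℝ (Fin 4))
    (ψ φ : ℂ → Fin 2 → ℂ) (U : ℂ → ℂ) : Prop where
  smooth_psi : ContDiffOn ℝ ∞ ψ W
  smooth_phi : ContDiffOn ℝ ∞ φ W
  smooth_potential : ContDiffOn ℝ ∞ U W
  dirac : ∀ z ∈ W, diracOp U ψ z = 0
  dirac_dual : ∀ z ∈ W, diracOpDual U φ z = 0
  integral : ∀ (a b : ℂ) (γ : Path a b), (∀ t, γ t ∈ W) →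
    ContDiffOn ℝ 1 γ.extend (Icc 0 1) → ∀ k : Fin 4,
      ((X b k : ℝ) : ℂ) = ((X a k : ℝ) : ℂ) + curveIntegral (weierstrassForm ψ φ k) γ

/-- The factor `e^{2α}` in the induced metric `e^{2α} dz dz̄` of a conformal immersion `X`,
that is `⟨X_x, X_x⟩ = |X_x|²`. -/
def conformalFactor (X : ℂ → EuclideanSpace ℝ (Fin 4)) (z : ℂ) : ℝ :=
  ‖fderiv ℝ X z 1‖ ^ 2

/-- The mean curvature vector `H = 2 X_{z z̄} / e^{2α}` of a conformal immersion `X`. Its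
coordinates are real; it is written as a vector of `ℂ⁴`. -/
def meanCurvatureVector (X : ℂ → EuclideanSpace ℝ (Fin 4)) (z : ℂ) : EuclideanSpace ℂ (Fin 4) :=
  WithLp.toLp 2 fun k =>
    2 * wirtD (wirtDbar fun w => ((X w k : ℝ) : ℂ)) z / (conformalFactor X z : ℂ)

/-- The given atlas of a surface `S` modelled on `ℝ² = ℂ` is oriented: all transition maps
have positive Jacobian. -/
def IsOrientedAtlas (S : Type*) [TopologicalSpace S] [ChartedSpace ℂ S] : Prop :=
  ∀ e ∈ atlas ℂ S, ∀ e' ∈ atlas ℂ S, ∀ x ∈ (e.symm.trans e').source,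
    0 < (fderiv ℝ (e.symm.trans e') x).det

/-- `σ : W → S` introduces a conformal parameter `z ∈ W` on the oriented surface `S` immersed by
`r : S → ℝ⁴`: `W ⊆ ℂ` is open, `σ` is smooth on `W` and preserves orientation, and the metric
induced by `r ∘ σ` on `W` is conformal to `dz dz̄`. (So `σ` is a local diffeomorphism; it need not
be injective, which covers parameters on a covering of a part of `S`.) -/
structure IsConformalParameter {S : Type*} [TopologicalSpace S] [ChartedSpace ℂ S]
    (r : S → EuclideanSpace ℝ (Fin 4)) (W : Set ℂ) (σ : ℂ → S) : Prop where
  isOpen : IsOpen W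
  smooth : ContMDiffOn 𝓘(ℝ, ℂ) 𝓘(ℝ, ℂ) ∞ σ W
  orientation : ∀ z ∈ W, ∀ e ∈ atlas ℂ S, σ z ∈ e.source → 0 < (fderiv ℝ (e ∘ σ) z).det
  conformal : ∀ z ∈ W, ConformalAt (r ∘ σ) z

end

/-!
For a conformal `X` the complex gradient `f = ∂X` is a nowhere zero null vector of `ℂ⁴`. In suitable
coordinates the quadratic form `∑ f_k²` is the determinant of a `2 × 2` matrix, so that `f` is a
matrix of rank one, that is a product of a column and a row: these are the two spinors. Choosing
the row globally means finding a nowhere vanishing smooth section of a line bundle over an arbitrary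
planar open set `W`. The ratio of the two rows of the matrix, shifted by a regular value, has
nondegenerate isolated zeros, and a smooth function on `W` with the same zeros and the same germs
there, built as a locally finite product, turns the local sections into a global one.

Such a section is unique up to a factor `ρ`. Since `∂̄∂X` is real, the Dirac equations reduce to the
single condition that `∂̄(ρw)` be orthogonal to `ρw`, which is an equation `∂̄ log ρ = g`; it is
solvable on every open set by the Cauchy transform and a Runge-type correction. The norm identities
then express the metric and the mean curvature through the spinors.

Isothermal coordinates come from the Beltrami equation `∂̄f = μ ∂f` for the complex dilatation `μ`
of the induced metric. After an affine change of variables `μ` vanishes at the origin, and after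
zooming in and cutting off it has Fourier coefficients of small `ℓ¹` norm. The Beurling transform
is a Fourier multiplier of modulus at most one, so the equation is solved by a Neumann series of
convolutions whose coefficients decay rapidly, and the solution is smooth.
-/

/-! ### Wirtinger calculus -/

section SmoothOnOpen

variable {E F : Type*} [NormedAddCommGroup E] [NormedSpace ℝ E] [NormedAddCommGroup F]
  [NormedSpace ℝ F] {f : E → F} {W : Set E}

theorem contDiffOn_fderiv_apply (hf : ContDiffOn ℝ ∞ f W) (hW : IsOpen W) (v : E) :
    ContDiffOn ℝ ∞ (fun z => fderiv ℝ f z v) W :=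
  (hf.fderiv_of_isOpen hW (m := ∞) (by simp)).clm_apply contDiffOn_const

theorem differentiableAt_of_contDiffOn_isOpen (hf : ContDiffOn ℝ ∞ f W) (hW : IsOpen W) {x : E}
    (hx : x ∈ W) : DifferentiableAt ℝ f x :=
  (hf.contDiffAt (hW.mem_nhds hx)).differentiableAt (by simp)

end SmoothOnOpen

section Wirtinger

variable {f g : ℂ → ℂ} {z : ℂ} {W : Set ℂ}

theorem fderiv_apply_eq_wirtD (f : ℂ → ℂ) (z v : ℂ) :
    fderiv ℝ f z v = wirtD f z * v + wirtDbar f z * conj v := by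
  have hv : v = v.re • (1 : ℂ) + v.im • Complex.I := by simp [Complex.re_add_im]
  have hconj : conj v = v.re - v.im * Complex.I := Complex.ext (by simp) (by simp)
  have happly : fderiv ℝ f z v = v.re * fderiv ℝ f z 1 + v.im * fderiv ℝ f z Complex.I := by
    conv_lhs => rw [hv, map_add, map_smul, map_smul, Complex.real_smul, Complex.real_smul]
  rw [happly, hconj, wirtD, wirtDbar]
  conv_rhs => enter [1, 2]; rw [← Complex.re_add_im v]
  linear_combination (v.im * fderiv ℝ f z Complex.I : ℂ) * Complex.I_sq

theorem wirtD_eq_of_fderiv {a b : ℂ} (h : ∀ v, fderiv ℝ f z v = a * v + b * conj v) :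
    wirtD f z = a := by
  simp only [wirtD, h, map_one, Complex.conj_I]
  linear_combination (-a / 2 + b / 2) * Complex.I_sq

theorem wirtDbar_eq_of_fderiv {a b : ℂ} (h : ∀ v, fderiv ℝ f z v = a * v + b * conj v) :
    wirtDbar f z = b := by
  simp only [wirtDbar, h, map_one, Complex.conj_I]
  linear_combination (a / 2 - b / 2) * Complex.I_sq

theorem wirtD_congr (h : f =ᶠ[𝓝 z] g) : wirtD f z = wirtD g z := by
  simp only [wirtD, h.fderiv_eq]

theorem wirtDbar_congr (h : f =ᶠ[𝓝 z] g) : wirtDbar f z = wirtDbar g z := by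
  simp only [wirtDbar, h.fderiv_eq]

theorem wirtD_const (c : ℂ) : wirtD (fun _ => c) z = 0 := by simp [wirtD]

theorem wirtDbar_const (c : ℂ) : wirtDbar (fun _ => c) z = 0 := by simp [wirtDbar]

theorem wirtD_add (hf : DifferentiableAt ℝ f z) (hg : DifferentiableAt ℝ g z) :
    wirtD (fun w => f w + g w) z = wirtD f z + wirtD g z := by
  simp only [wirtD, fderiv_fun_add hf hg, add_apply]
  ring

theorem wirtDbar_add (hf : DifferentiableAt ℝ f z) (hg : DifferentiableAt ℝ g z) :
    wirtDbar (fun w => f w + g w) z = wirtDbar f z + wirtDbar g z := by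
  simp only [wirtDbar, fderiv_fun_add hf hg, add_apply]
  ring

theorem wirtD_sub (hf : DifferentiableAt ℝ f z) (hg : DifferentiableAt ℝ g z) :
    wirtD (fun w => f w - g w) z = wirtD f z - wirtD g z := by
  simp only [wirtD, fderiv_fun_sub hf hg, sub_apply]
  ring

theorem wirtDbar_sub (hf : DifferentiableAt ℝ f z) (hg : DifferentiableAt ℝ g z) :
    wirtDbar (fun w => f w - g w) z = wirtDbar f z - wirtDbar g z := by
  simp only [wirtDbar, fderiv_fun_sub hf hg, sub_apply]
  ring

theorem wirtDbar_neg (f : ℂ → ℂ) (z : ℂ) : wirtDbar (fun w => -f w) z = -wirtDbar f z := by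
  simp only [wirtDbar, fderiv_fun_neg, neg_apply]
  ring

theorem wirtD_mul (hf : DifferentiableAt ℝ f z) (hg : DifferentiableAt ℝ g z) :
    wirtD (fun w => f w * g w) z = wirtD f z * g z + f z * wirtD g z := by
  simp only [wirtD, fderiv_fun_mul hf hg, add_apply, smul_apply, smul_eq_mul]
  ring

theorem wirtDbar_mul (hf : DifferentiableAt ℝ f z) (hg : DifferentiableAt ℝ g z) :
    wirtDbar (fun w => f w * g w) z = wirtDbar f z * g z + f z * wirtDbar g z := by
  simp only [wirtDbar, fderiv_fun_mul hf hg, add_apply, smul_apply, smul_eq_mul]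
  ring

theorem wirtD_const_mul (c : ℂ) (hf : DifferentiableAt ℝ f z) :
    wirtD (fun w => c * f w) z = c * wirtD f z := by
  rw [wirtD_mul (differentiableAt_const c) hf, wirtD_const, zero_mul, zero_add]

theorem wirtDbar_const_mul (c : ℂ) (hf : DifferentiableAt ℝ f z) :
    wirtDbar (fun w => c * f w) z = c * wirtDbar f z := by
  rw [wirtDbar_mul (differentiableAt_const c) hf, wirtDbar_const, zero_mul, zero_add]

theorem wirtDbar_sum {ι : Type*} {s : Finset ι} {F : ι → ℂ → ℂ}
    (hF : ∀ i ∈ s, DifferentiableAt ℝ (F i) z) :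
    wirtDbar (fun w => ∑ i ∈ s, F i w) z = ∑ i ∈ s, wirtDbar (F i) z := by
  simp only [wirtDbar, fderiv_fun_sum hF, FunLike.coe_sum, Finset.sum_apply,
    Finset.mul_sum, ← Finset.sum_add_distrib, Finset.sum_div]

theorem fderiv_conj_comp_apply (hf : DifferentiableAt ℝ f z) (v : ℂ) :
    fderiv ℝ (fun w => conj (f w)) z v = conj (fderiv ℝ f z v) :=
  congrArg (· v) (Complex.conjCLE.toContinuousLinearMap.hasFDerivAt.comp z hf.hasFDerivAt).fderiv

theorem wirtD_conj (hf : DifferentiableAt ℝ f z) :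
    wirtD (fun w => conj (f w)) z = conj (wirtDbar f z) := by
  simp only [wirtD, wirtDbar, fderiv_conj_comp_apply hf, map_div₀, map_add, map_mul,
    Complex.conj_I, Complex.conj_ofNat]
  ring

theorem wirtDbar_conj (hf : DifferentiableAt ℝ f z) :
    wirtDbar (fun w => conj (f w)) z = conj (wirtD f z) := by
  simp only [wirtD, wirtDbar, fderiv_conj_comp_apply hf, map_div₀, map_sub, map_mul,
    Complex.conj_I, Complex.conj_ofNat]
  ring

theorem fderiv_real_apply_of_differentiableAt (hf : DifferentiableAt ℂ f z) (v : ℂ) :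
    fderiv ℝ f z v = deriv f z * v := by
  rw [(hf.hasDerivAt.hasFDerivAt.restrictScalars ℝ).fderiv]
  simp [mul_comm]

theorem wirtD_of_differentiableAt (hf : DifferentiableAt ℂ f z) : wirtD f z = deriv f z :=
  wirtD_eq_of_fderiv (b := 0) fun v => by
    rw [fderiv_real_apply_of_differentiableAt hf, zero_mul, add_zero]

theorem wirtDbar_of_differentiableAt (hf : DifferentiableAt ℂ f z) : wirtDbar f z = 0 :=
  wirtDbar_eq_of_fderiv (a := deriv f z) fun v => by
    rw [fderiv_real_apply_of_differentiableAt hf, zero_mul, add_zero]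

theorem wirtD_fun_id (z : ℂ) : wirtD (fun w => w) z = 1 := by
  rw [wirtD_of_differentiableAt differentiableAt_fun_id, deriv_id'']

theorem wirtDbar_fun_id (z : ℂ) : wirtDbar (fun w => w) z = 0 :=
  wirtDbar_of_differentiableAt differentiableAt_fun_id

theorem differentiableAt_complex_of_wirtDbar_eq_zero (hf : DifferentiableAt ℝ f z)
    (h : wirtDbar f z = 0) : DifferentiableAt ℂ f z := by
  refine (hasDerivAt_iff_hasFDerivAt (f' := wirtD f z)).2 ?_ |>.differentiableAt
  have hreal := hf.hasFDerivAt
  rw [hasFDerivAt_iff_isLittleO_nhds_zero] at hreal ⊢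
  refine hreal.congr (fun v => ?_) fun _ => rfl
  rw [fderiv_apply_eq_wirtD, h]
  simp [mul_comm]

theorem wirtDbar_holomorphic_mul (hf : DifferentiableAt ℂ f z) (hg : DifferentiableAt ℝ g z) :
    wirtDbar (fun w => f w * g w) z = f z * wirtDbar g z := by
  rw [wirtDbar_mul (hf.restrictScalars ℝ) hg, wirtDbar_of_differentiableAt hf, zero_mul, zero_add]

theorem fderiv_comp_apply_eq_wirtD (hg : DifferentiableAt ℝ g (f z))
    (hf : DifferentiableAt ℝ f z) (v : ℂ) :
    fderiv ℝ (fun w => g (f w)) z v =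
      (wirtD g (f z) * wirtD f z + wirtDbar g (f z) * conj (wirtDbar f z)) * v +
        (wirtD g (f z) * wirtDbar f z + wirtDbar g (f z) * conj (wirtD f z)) * conj v := by
  rw [fderiv_fun_comp z hg hf, ContinuousLinearMap.comp_apply, fderiv_apply_eq_wirtD g,
    fderiv_apply_eq_wirtD f]
  simp only [map_add, map_mul, Complex.conj_conj]
  ring

theorem wirtD_comp (hg : DifferentiableAt ℝ g (f z)) (hf : DifferentiableAt ℝ f z) :
    wirtD (fun w => g (f w)) z =
      wirtD g (f z) * wirtD f z + wirtDbar g (f z) * conj (wirtDbar f z) :=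
  wirtD_eq_of_fderiv (fderiv_comp_apply_eq_wirtD hg hf)

theorem wirtDbar_comp (hg : DifferentiableAt ℝ g (f z)) (hf : DifferentiableAt ℝ f z) :
    wirtDbar (fun w => g (f w)) z =
      wirtD g (f z) * wirtDbar f z + wirtDbar g (f z) * conj (wirtD f z) :=
  wirtDbar_eq_of_fderiv (fderiv_comp_apply_eq_wirtD hg hf)

theorem wirtDbar_holomorphic_comp (hg : DifferentiableAt ℂ g (f z))
    (hf : DifferentiableAt ℝ f z) :
    wirtDbar (fun w => g (f w)) z = deriv g (f z) * wirtDbar f z := by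
  rw [wirtDbar_comp (hg.restrictScalars ℝ) hf, wirtD_of_differentiableAt hg,
    wirtDbar_of_differentiableAt hg, zero_mul, add_zero]

theorem wirtDbar_cexp (hf : DifferentiableAt ℝ f z) :
    wirtDbar (fun w => Complex.exp (f w)) z = Complex.exp (f z) * wirtDbar f z := by
  rw [wirtDbar_holomorphic_comp Complex.differentiableAt_exp hf, Complex.deriv_exp]

theorem contDiffOn_conj_comp {n : WithTop ℕ∞} (hf : ContDiffOn ℝ n f W) :
    ContDiffOn ℝ n (fun w => conj (f w)) W :=
  Complex.conjCLE.contDiff.comp_contDiffOn hf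

theorem contDiffOn_wirtD (hf : ContDiffOn ℝ ∞ f W) (hW : IsOpen W) :
    ContDiffOn ℝ ∞ (wirtD f) W :=
  ((contDiffOn_fderiv_apply hf hW 1).sub
    (contDiffOn_const.mul (contDiffOn_fderiv_apply hf hW Complex.I))).div_const 2

theorem contDiffOn_wirtDbar (hf : ContDiffOn ℝ ∞ f W) (hW : IsOpen W) :
    ContDiffOn ℝ ∞ (wirtDbar f) W :=
  ((contDiffOn_fderiv_apply hf hW 1).add
    (contDiffOn_const.mul (contDiffOn_fderiv_apply hf hW Complex.I))).div_const 2

theorem contDiff_wirtDbar (hf : ContDiff ℝ ∞ f) : ContDiff ℝ ∞ (wirtDbar f) :=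
  contDiffOn_univ.1 (contDiffOn_wirtDbar hf.contDiffOn isOpen_univ)

theorem contDiffOn_real_of_differentiableOn (hf : DifferentiableOn ℂ f W) (hW : IsOpen W) :
    ContDiffOn ℝ ∞ f W :=
  (hf.contDiffOn hW).restrict_scalars ℝ

end Wirtinger

/-! ### Univalent functions concentrated near a boundary point -/

/-- `q` is a univalent (injective holomorphic) function on `W` normalised by `q p = 1`; thus `q - 1`
has its only zero in `W` at `p`, and this zero is simple. -/
structure IsNormalizedUnivalent (W : Set ℂ) (p : ℂ) (q : ℂ → ℂ) : Prop where
  differentiableOn : DifferentiableOn ℂ q W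
  injOn : InjOn q W
  map_self : q p = 1
  deriv_ne_zero : deriv q p ≠ 0

/-- The points of norm at most `R` and of distance at least `R⁻¹` from the complement of `W`. For
`R → ∞` these sets exhaust the open set `W` by compact sets. -/
def compactCore (W : Set ℂ) (R : ℝ) : Set ℂ :=
  {z | ‖z‖ ≤ R ∧ ∀ b ∉ W, R⁻¹ ≤ ‖z - b‖}

section Univalent

variable {W : Set ℂ}

theorem compactCore_subset {R : ℝ} (hR : 0 < R) : compactCore W R ⊆ W := fun z hz => by
  by_contra hzW
  have := hz.2 z hzW
  rw [sub_self, norm_zero] at this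
  exact (inv_pos.2 hR).not_ge this

theorem isCompact_compactCore (W : Set ℂ) (R : ℝ) : IsCompact (compactCore W R) := by
  have hcore : compactCore W R = Metric.closedBall 0 R ∩ ⋂ b ∈ Wᶜ, {z | R⁻¹ ≤ ‖z - b‖} := by
    ext z
    simp [compactCore]
  rw [hcore]
  exact (isCompact_closedBall 0 R).inter_right
    (isClosed_biInter fun b _ => isClosed_le continuous_const (by fun_prop))

theorem compactCore_mono {R S : ℝ} (hR : 0 < R) (hRS : R ≤ S) :
    compactCore W R ⊆ compactCore W S := fun _ hz =>
  ⟨hz.1.trans hRS, fun b hb => (inv_anti₀ hR hRS).trans (hz.2 b hb)⟩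

theorem exists_compactCore_mem_nhds (hW : IsOpen W) {z : ℂ} (hz : z ∈ W) :
    ∃ n : ℕ, compactCore W (n + 1) ∈ 𝓝 z := by
  obtain ⟨δ, hδ, hball⟩ := Metric.isOpen_iff.1 hW z hz
  obtain ⟨n, hn⟩ := exists_nat_ge (max (‖z‖ + δ / 2) (δ / 2)⁻¹)
  refine ⟨n, Filter.mem_of_superset (Metric.ball_mem_nhds z (half_pos hδ)) fun w hw => ?_⟩
  rw [mem_ball_iff_norm] at hw
  refine ⟨?_, fun b hb => ?_⟩
  · linarith [norm_le_norm_add_norm_sub' w z, (le_max_left _ _).trans hn]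
  · have hδb : δ ≤ ‖b - z‖ := not_lt.1 fun hlt => hb (hball (mem_ball_iff_norm.2 hlt))
    calc ((n : ℝ) + 1)⁻¹ ≤ δ / 2 :=
          inv_le_of_inv_le₀ (half_pos hδ) (by linarith [(le_max_right _ _).trans hn])
      _ ≤ ‖w - b‖ := by
          linarith [norm_sub_le_norm_sub_add_norm_sub b w z, norm_sub_rev b w]

theorem isNormalizedUnivalent_div_sub {p b : ℂ} (hp : p ∈ W) (hb : b ∉ W) :
    IsNormalizedUnivalent W p fun z => (p - b) / (z - b) := by
  have hne : ∀ z ∈ W, z - b ≠ 0 := fun z hz h0 => hb (sub_eq_zero.1 h0 ▸ hz)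
  have hderiv : HasDerivAt (fun z => (p - b) / (z - b)) (-(p - b) / (p - b) ^ 2) p := by
    simpa using! (hasDerivAt_const p (p - b)).div ((hasDerivAt_id p).sub_const b) (hne p hp)
  refine ⟨(differentiableOn_const _).div (differentiableOn_id.sub_const b) hne,
    fun z hz w hw hzw => ?_, div_self (hne p hp), ?_⟩
  · rw [div_eq_div_iff (hne z hz) (hne w hw)] at hzw
    linear_combination -mul_left_cancel₀ (hne p hp) hzw
  · rw [hderiv.deriv]
    exact div_ne_zero (neg_ne_zero.2 (hne p hp)) (pow_ne_zero 2 (hne p hp))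

theorem isNormalizedUnivalent_div {p : ℂ} (hp : p ≠ 0) :
    IsNormalizedUnivalent W p fun z => z / p where
  differentiableOn := by fun_prop
  injOn := fun z _ w _ hzw => by simpa [div_left_inj' hp] using hzw
  map_self := div_self hp
  deriv_ne_zero := by simp [hp]

theorem isNormalizedUnivalent_sub_add_one (p : ℂ) :
    IsNormalizedUnivalent W p fun z => z - p + 1 where
  differentiableOn := by fun_prop
  injOn := fun z _ w _ hzw => by simpa using hzw
  map_self := by simp
  deriv_ne_zero := by simp

/- The pole of `q` is the boundary point nearest to `p` if `p` is close to the boundary, and `∞`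
otherwise. -/
theorem exists_isNormalizedUnivalent_norm_le (hW : IsOpen W) {p : ℂ} (hp : p ∈ W) :
    ∃ q, IsNormalizedUnivalent W p q ∧ ∀ R > 0, p ∉ compactCore W R → ∀ z,
      ‖q z‖ ≤ ‖z‖ / R ∨ ∃ b ∉ W, ‖q z‖ ≤ R⁻¹ / ‖z - b‖ := by
  have hfar : ∀ {R : ℝ}, p ∉ compactCore W R → R < ‖p‖ ∨ ∃ b ∉ W, ‖p - b‖ < R⁻¹ := fun hpR => by
    by_contra! hcon
    exact hpR hcon
  by_cases hnear : ∃ b ∉ W, ‖p - b‖ * ‖p‖ ≤ 1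
  · obtain ⟨b₀, hb₀, hle⟩ := hnear
    obtain ⟨b, hb, hdist⟩ := hW.isClosed_compl.exists_infDist_eq_dist ⟨b₀, hb₀⟩ p
    have hmin : ∀ b' ∉ W, ‖p - b‖ ≤ ‖p - b'‖ := fun b' hb' => by
      rw [← dist_eq_norm, ← dist_eq_norm, ← hdist]
      exact Metric.infDist_le_dist_of_mem hb'
    refine ⟨_, isNormalizedUnivalent_div_sub hp hb, fun R hR hpR z => Or.inr ⟨b, hb, ?_⟩⟩
    rw [norm_div]
    gcongr
    obtain hRp | ⟨b', hb', hlt⟩ := hfar hpR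
    · rw [← one_div, le_div_iff₀ hR]
      exact (by gcongr; exact hmin b₀ hb₀ : _ ≤ ‖p - b₀‖ * ‖p‖).trans hle
    · exact (hmin b' hb').trans hlt.le
  · push Not at hnear
    have hRp : ∀ R > 0, p ∉ compactCore W R → R < ‖p‖ := fun R hR hpR => by
      obtain hRp | ⟨b', hb', hlt⟩ := hfar hpR
      · exact hRp
      · by_contra! hle
        have : ‖p - b'‖ * ‖p‖ ≤ R⁻¹ * R := by gcongr
        exact (hnear b' hb').not_ge (this.trans_eq (inv_mul_cancel₀ hR.ne'))
    obtain rfl | hp0 := eq_or_ne p 0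
    · exact ⟨_, isNormalizedUnivalent_sub_add_one 0, fun R hR hpR =>
        absurd (hRp R hR hpR) (by simpa using hR.le)⟩
    · refine ⟨_, isNormalizedUnivalent_div hp0, fun R hR hpR z => Or.inl ?_⟩
      rw [norm_div]
      gcongr
      exact (hRp R hR hpR).le

theorem exists_norm_isNormalizedUnivalent_le_half (hW : IsOpen W) :
    ∃ q : ℂ → ℂ → ℂ, (∀ p ∈ W, IsNormalizedUnivalent W p (q p)) ∧
      ∀ K ⊆ W, IsCompact K → ∃ C ⊆ W, IsCompact C ∧ ∀ p ∈ W \ C, ∀ z ∈ K, ‖q p z‖ ≤ 1 / 2 := by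
  choose! q hq hq_le using fun p (hp : p ∈ W) => exists_isNormalizedUnivalent_norm_le hW hp
  refine ⟨q, hq, fun K hKW hK => ?_⟩
  obtain ⟨δ, hδ, hthick⟩ := hK.exists_thickening_subset_open hW hKW
  have hdist : ∀ z ∈ K, ∀ b ∉ W, δ ≤ ‖z - b‖ := fun z hz b hb => by
    by_contra! hlt
    refine hb (hthick (Metric.mem_thickening_iff.2 ⟨z, hz, ?_⟩))
    rwa [dist_comm, dist_eq_norm]
  obtain ⟨M, hM, hKM⟩ := hK.isBounded.exists_pos_norm_le
  obtain ⟨R, hR_eq⟩ : ∃ R : ℝ, R = 2 * M + 2 / δ := ⟨_, rfl⟩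
  have hR : 0 < R := hR_eq ▸ by positivity
  have hMR : M / R ≤ 1 / 2 := by
    rw [div_le_iff₀ hR]
    linarith [show 0 < 2 / δ by positivity]
  have hδR : R⁻¹ / δ ≤ 1 / 2 := by
    rw [div_le_iff₀ hδ, inv_le_comm₀ hR (by positivity)]
    calc (1 / 2 * δ)⁻¹ = 2 / δ := by field_simp
      _ ≤ R := by linarith
  refine ⟨compactCore W R, compactCore_subset hR, isCompact_compactCore W R, ?_⟩
  rintro p ⟨hp, hpR⟩ z hz
  obtain hle | ⟨b, hb, hle⟩ := hq_le p hp R hR hpR z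
  · exact (hle.trans (by gcongr; exact hKM z hz)).trans hMR
  · exact (hle.trans (by gcongr; exact hdist z hz b hb)).trans hδR

end Univalent

/-! ### The Cauchy transform -/

section CauchyPompeiu

open MeasureTheory

variable {V F : Type*} [NormedAddCommGroup V] [NormedSpace ℝ V] [NormedAddCommGroup F]
  [NormedSpace ℝ F]

theorem integral_Ioi_fderiv_ray [CompleteSpace F] {G : V → F} (hG : ContDiff ℝ 1 G)
    (hc : HasCompactSupport G) {u : V} (hu : u ≠ 0) :
    ∫ r in Ioi (0 : ℝ), fderiv ℝ G (r • u) u = -G 0 := by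
  have hderiv : deriv (fun r : ℝ => G (r • u)) = fun r => fderiv ℝ G (r • u) u := funext fun r => by
    have hline : HasDerivAt (fun r : ℝ => r • u) u r := by
      simpa using (hasDerivAt_id r).smul_const u
    exact ((hG.differentiable (by simp) _).hasFDerivAt.comp_hasDerivAt r hline).deriv
  have hsupp : HasCompactSupport fun r : ℝ => G (r • u) :=
    hc.comp_isClosedEmbedding (isClosedEmbedding_smul_left hu)
  have hG_line : ContDiff ℝ 1 fun r : ℝ => G (r • u) := hG.comp (contDiff_id.smul contDiff_const)
  simpa [hderiv] using hsupp.integral_Ioi_deriv_eq hG_line 0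

theorem intervalIntegral_fderiv_circleMap [CompleteSpace F] {G : ℂ → F} (hG : ContDiff ℝ 1 G)
    (r : ℝ) :
    ∫ θ in -Real.pi..Real.pi, fderiv ℝ G (circleMap 0 r θ) (circleMap 0 r θ * Complex.I) = 0 := by
  have hderiv (θ : ℝ) : HasDerivAt (fun θ => G (circleMap 0 r θ))
      (fderiv ℝ G (circleMap 0 r θ) (circleMap 0 r θ * Complex.I)) θ :=
    (hG.differentiable (by simp) _).hasFDerivAt.comp_hasDerivAt θ (hasDerivAt_circleMap 0 r θ)
  have hcont : Continuous fun θ =>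
      fderiv ℝ G (circleMap 0 r θ) (circleMap 0 r θ * Complex.I) :=
    ((hG.continuous_fderiv (by simp)).comp (continuous_circleMap 0 r)).clm_apply
      ((continuous_circleMap 0 r).mul continuous_const)
  rw [intervalIntegral.integral_eq_sub_of_hasDerivAt (fun θ _ => hderiv θ)
    (hcont.intervalIntegrable _ _), sub_eq_zero]
  congr 1
  simp [circleMap, Complex.exp_neg, Complex.exp_pi_mul_I]

theorem integrableOn_polarCoord_target_fderiv {G : ℂ → F} (hG : ContDiff ℝ 1 G)
    (hc : HasCompactSupport G) (v : ℂ) :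
    IntegrableOn (fun p : ℝ × ℝ => fderiv ℝ G (circleMap 0 p.1 p.2) (circleMap 0 1 p.2 * v))
      polarCoord.target := by
  obtain ⟨R, hR⟩ := (hc.fderiv ℝ).isCompact.isBounded.exists_norm_le
  have hcont : Continuous fun p : ℝ × ℝ =>
      fderiv ℝ G (circleMap 0 p.1 p.2) (circleMap 0 1 p.2 * v) := by
    simp only [circleMap]
    exact ((hG.continuous_fderiv (by simp)).comp (by fun_prop)).clm_apply (by fun_prop)
  refine IntegrableOn.of_forall_sdiff_eq_zero (s := Icc 0 R ×ˢ Icc (-Real.pi) Real.pi)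
    (hcont.continuousOn.integrableOn_compact (isCompact_Icc.prod isCompact_Icc))
    (measurableSet_Ioi.prod measurableSet_Ioo) ?_
  rintro ⟨r, θ⟩ ⟨⟨hr, hθ⟩, hnot⟩
  have hfar : circleMap 0 r θ ∉ tsupport (fderiv ℝ G) := fun hmem =>
    hnot ⟨⟨le_of_lt hr, by simpa [abs_of_pos (mem_Ioi.1 hr)] using hR _ hmem⟩,
      Ioo_subset_Icc_self hθ⟩
  simp [image_eq_zero_of_notMem_tsupport hfar]

theorem setIntegral_polarCoord_target_fderiv_radial [CompleteSpace F] {G : ℂ → F}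
    (hG : ContDiff ℝ 1 G) (hc : HasCompactSupport G) :
    ∫ p in polarCoord.target, fderiv ℝ G (circleMap 0 p.1 p.2) (circleMap 0 1 p.2) =
      -(2 * Real.pi) • G 0 := by
  have hint := integrableOn_polarCoord_target_fderiv hG hc 1
  simp only [mul_one] at hint
  have hray (θ : ℝ) :
      ∫ r in Ioi (0 : ℝ), fderiv ℝ G (circleMap 0 r θ) (circleMap 0 1 θ) = -G 0 := by
    simpa [circleMap] using
      integral_Ioi_fderiv_ray hG hc (u := circleMap 0 1 θ) (circleMap_ne_center one_ne_zero)
  rw [polarCoord_target, Measure.volume_eq_prod, ← Measure.prod_restrict, integral_prod_symm]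
  · simp only [hray, setIntegral_const, Real.volume_real_Ioo_of_le
      (by linarith [Real.pi_pos] : -Real.pi ≤ Real.pi)]
    rw [smul_neg, neg_smul]
    ring_nf
  · rwa [Measure.prod_restrict]

theorem setIntegral_polarCoord_target_fderiv_angular [CompleteSpace F] {G : ℂ → F}
    (hG : ContDiff ℝ 1 G) (hc : HasCompactSupport G) :
    ∫ p in polarCoord.target, fderiv ℝ G (circleMap 0 p.1 p.2) (circleMap 0 1 p.2 * Complex.I) =
      0 := by
  rw [polarCoord_target, Measure.volume_eq_prod,
    setIntegral_prod _ (integrableOn_polarCoord_target_fderiv hG hc Complex.I)]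
  refine setIntegral_eq_zero_of_forall_eq_zero fun r hr => ?_
  have hsmul (θ : ℝ) : fderiv ℝ G (circleMap 0 r θ) (circleMap 0 1 θ * Complex.I) =
      r⁻¹ • fderiv ℝ G (circleMap 0 r θ) (circleMap 0 r θ * Complex.I) := by
    rw [← map_smul]
    congr 1
    have hr0 : (r : ℂ) ≠ 0 := by exact_mod_cast (mem_Ioi.1 hr).ne'
    simp [circleMap]
    field_simp
  have hcircle := intervalIntegral_fderiv_circleMap hG r
  rw [intervalIntegral.integral_of_le (by linarith [Real.pi_pos]),
    integral_Ioc_eq_integral_Ioo] at hcircle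
  simp only [hsmul, integral_smul, hcircle, smul_zero]

theorem smul_inv_mul_wirtDbar_polar (G : ℂ → ℂ) {r : ℝ} (hr : r ≠ 0) (θ : ℝ) :
    r • ((circleMap 0 r θ)⁻¹ * wirtDbar G (circleMap 0 r θ)) =
      1 / 2 * fderiv ℝ G (circleMap 0 r θ) (circleMap 0 1 θ) +
        Complex.I / 2 * fderiv ℝ G (circleMap 0 r θ) (circleMap 0 1 θ * Complex.I) := by
  have hr0 : (r : ℂ) ≠ 0 := by exact_mod_cast hr
  have hinv : conj (circleMap 0 1 θ) = (circleMap 0 1 θ)⁻¹ := by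
    rw [Complex.inv_def, Complex.normSq_eq_norm_sq]
    simp
  have hcircle : circleMap 0 r θ = r * circleMap 0 1 θ := by simp [circleMap]
  simp only [fderiv_apply_eq_wirtD, map_mul, Complex.conj_I, hinv, Complex.real_smul]
  have hone : circleMap 0 1 θ ≠ 0 := circleMap_ne_center one_ne_zero
  rw [hcircle]
  field_simp
  linear_combination (wirtDbar G (r * circleMap 0 1 θ) -
    wirtD G (r * circleMap 0 1 θ) * circleMap 0 1 θ ^ 2) * Complex.I_sq

theorem integral_inv_mul_wirtDbar {G : ℂ → ℂ} (hG : ContDiff ℝ 1 G) (hc : HasCompactSupport G) :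
    ∫ w, w⁻¹ * wirtDbar G w = -Real.pi * G 0 := by
  have hcongr : ∫ p in polarCoord.target, p.1 • ((Complex.polarCoord.symm p)⁻¹ *
      wirtDbar G (Complex.polarCoord.symm p)) =
      ∫ p in polarCoord.target, (1 / 2 * fderiv ℝ G (circleMap 0 p.1 p.2) (circleMap 0 1 p.2) +
        Complex.I / 2 * fderiv ℝ G (circleMap 0 p.1 p.2) (circleMap 0 1 p.2 * Complex.I)) := by
    refine setIntegral_congr_fun (measurableSet_Ioi.prod measurableSet_Ioo) fun p hp => ?_
    have hpolar : Complex.polarCoord.symm p = circleMap 0 p.1 p.2 := by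
      simp [Complex.polarCoord_symm_apply, circleMap, Complex.exp_mul_I]
    simp only [hpolar]
    exact smul_inv_mul_wirtDbar_polar G (mem_Ioi.1 hp.1).ne' p.2
  have hradial := integrableOn_polarCoord_target_fderiv hG hc 1
  have hangular := integrableOn_polarCoord_target_fderiv hG hc Complex.I
  simp only [mul_one] at hradial
  rw [← Complex.integral_comp_polarCoord_symm, hcongr,
    integral_add (hradial.const_mul _) (hangular.const_mul _), integral_const_mul,
    integral_const_mul, setIntegral_polarCoord_target_fderiv_radial hG hc,
    setIntegral_polarCoord_target_fderiv_angular hG hc, Complex.real_smul]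
  push_cast
  ring

end CauchyPompeiu

section CauchyTransform

open MeasureTheory

variable {g : ℂ → ℂ}

/-- The Cauchy transform `z ↦ (1/π) ∫ g(w) / (z - w) dw`, written as a convolution with `w⁻¹` so
that derivatives fall on `g`. It inverts `∂̄` on compactly supported functions. -/
noncomputable def cauchyTransform (g : ℂ → ℂ) (z : ℂ) : ℂ :=
  (Real.pi : ℂ)⁻¹ * ∫ w, w⁻¹ * g (z - w)

theorem locallyIntegrable_inv_complex : LocallyIntegrable fun w : ℂ => w⁻¹ := by
  refine locallyIntegrable_of_norm_le_rpow (C := 1) (α := 1) ?_ ?_ ?_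
    measurable_inv.aestronglyMeasurable
  · norm_num [Complex.finrank_real_complex]
  · norm_num [Complex.finrank_real_complex]
  · exact Filter.Eventually.of_forall fun w => by rw [Real.rpow_neg_one, one_mul, norm_inv]

theorem cauchyTransform_eq_convolution (g : ℂ → ℂ) (z : ℂ) :
    cauchyTransform g z = (Real.pi : ℂ)⁻¹ *
      convolution (fun w : ℂ => w⁻¹) g (ContinuousLinearMap.mul ℝ ℂ) volume z := by
  simp [cauchyTransform, convolution_def]

theorem contDiff_cauchyTransform {n : ℕ∞} (hg : ContDiff ℝ n g) (hc : HasCompactSupport g) :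
    ContDiff ℝ n (cauchyTransform g) := by
  have := hc.contDiff_convolution_right (ContinuousLinearMap.mul ℝ ℂ)
    locallyIntegrable_inv_complex hg
  simpa only [← cauchyTransform_eq_convolution] using
    (contDiff_const (c := (Real.pi : ℂ)⁻¹)).mul this

theorem fderiv_cauchyTransform_apply (hg : ContDiff ℝ 1 g) (hc : HasCompactSupport g) (z v : ℂ) :
    fderiv ℝ (cauchyTransform g) z v = cauchyTransform (fun w => fderiv ℝ g w v) z := by
  have hconv := (hc.hasFDerivAt_convolution_right (ContinuousLinearMap.mul ℝ ℂ)
    locallyIntegrable_inv_complex hg z).const_mul (Real.pi : ℂ)⁻¹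
  have htransform : HasFDerivAt (cauchyTransform g) _ z :=
    hconv.congr_of_eventuallyEq
      (Filter.Eventually.of_forall fun w => cauchyTransform_eq_convolution g w)
  rw [htransform.fderiv, cauchyTransform_eq_convolution, smul_apply, smul_eq_mul,
    convolution_precompR_apply _ locallyIntegrable_inv_complex (hc.fderiv ℝ)
      (hg.continuous_fderiv (by simp))]

theorem integrable_inv_mul_comp_sub (hg : Continuous g) (hc : HasCompactSupport g) (z : ℂ) :
    Integrable fun w => w⁻¹ * g (z - w) := by
  simpa [ConvolutionExistsAt] using hc.convolutionExists_right (ContinuousLinearMap.mul ℝ ℂ)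
    locallyIntegrable_inv_complex hg z

theorem wirtDbar_cauchyTransform_comm (hg : ContDiff ℝ 1 g) (hc : HasCompactSupport g) (z : ℂ) :
    wirtDbar (cauchyTransform g) z = cauchyTransform (wirtDbar g) z := by
  have hint (v : ℂ) : Integrable fun w => w⁻¹ * fderiv ℝ g (z - w) v :=
    integrable_inv_mul_comp_sub (g := fun w => fderiv ℝ g w v)
      ((hg.continuous_fderiv (by simp)).clm_apply continuous_const) (hc.fderiv_apply ℝ v) z
  have hsplit : ∫ w, w⁻¹ * wirtDbar g (z - w) = (∫ w, w⁻¹ * fderiv ℝ g (z - w) 1) / 2 +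
      Complex.I / 2 * ∫ w, w⁻¹ * fderiv ℝ g (z - w) Complex.I := by
    rw [← integral_div, ← integral_const_mul, ← integral_add ((hint 1).div_const 2)
      ((hint Complex.I).const_mul _)]
    refine integral_congr_ae (Filter.Eventually.of_forall fun w => ?_)
    simp only [wirtDbar]
    ring
  rw [wirtDbar, fderiv_cauchyTransform_apply hg hc, fderiv_cauchyTransform_apply hg hc]
  simp only [cauchyTransform, hsplit]
  ring

theorem wirtDbar_comp_const_sub (g : ℂ → ℂ) (z w : ℂ) :
    wirtDbar (fun w => g (z - w)) w = -wirtDbar g (z - w) := by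
  have hfderiv : fderiv ℝ (fun w => g (z - w)) w = -fderiv ℝ g (z - w) := by
    have hneg : (fun w => g (z - w)) = (fun v => g (z + v)) ∘ ContinuousLinearEquiv.neg ℝ := by
      ext w
      simp only [Function.comp_apply, ContinuousLinearEquiv.neg_apply, sub_eq_add_neg]
    rw [hneg, ContinuousLinearEquiv.comp_right_fderiv, fderiv_comp_add_left]
    ext v
    simp [sub_eq_add_neg]
  simp only [wirtDbar, hfderiv, neg_apply]
  ring

theorem wirtDbar_cauchyTransform (hg : ContDiff ℝ 1 g) (hc : HasCompactSupport g) (z : ℂ) :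
    wirtDbar (cauchyTransform g) z = g z := by
  have hpompeiu := integral_inv_mul_wirtDbar (G := fun w => g (z - w))
    (hg.comp (contDiff_const.sub contDiff_id)) (hc.comp_homeomorph (Homeomorph.subLeft z))
  simp only [wirtDbar_comp_const_sub, mul_neg, integral_neg, sub_zero, neg_mul, neg_inj]
    at hpompeiu
  rw [wirtDbar_cauchyTransform_comm hg hc, cauchyTransform, hpompeiu,
    inv_mul_cancel_left₀ (by exact_mod_cast Real.pi_ne_zero)]

theorem norm_cauchyTransform_le {M R : ℝ} (hgM : ∀ w, ‖g w‖ ≤ M) (hgR : ∀ w, R < ‖w‖ → g w = 0)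
    {z : ℂ} (hz : ‖z‖ ≤ R) :
    ‖cauchyTransform g z‖ ≤
      (Real.pi⁻¹ * ∫ w in Metric.closedBall (0 : ℂ) (R + R), ‖w⁻¹‖) * M := by
  set D := Metric.closedBall (0 : ℂ) (R + R)
  have hD : MeasurableSet D := Metric.isClosed_closedBall.measurableSet
  have hint : IntegrableOn (fun w : ℂ => ‖w⁻¹‖) D :=
    (locallyIntegrable_inv_complex.integrableOn_isCompact (isCompact_closedBall _ _)).norm
  have hle : ‖∫ w, w⁻¹ * g (z - w)‖ ≤ ∫ w, D.indicator (fun w => ‖w⁻¹‖ * M) w := by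
    refine norm_integral_le_of_norm_le ((integrable_indicator_iff hD).2 (hint.mul_const M))
      (Filter.Eventually.of_forall fun w => ?_)
    by_cases hw : w ∈ D
    · rw [indicator_of_mem hw, norm_mul]
      gcongr
      exact hgM _
    · have hfar : R + R < ‖w‖ := by simpa [D] using hw
      have hsub := norm_sub_norm_le w z
      rw [norm_sub_rev] at hsub
      rw [indicator_of_notMem hw, hgR (z - w) (by linarith), mul_zero, norm_zero]
  rw [integral_indicator hD, integral_mul_const] at hle
  calc ‖cauchyTransform g z‖ = Real.pi⁻¹ * ‖∫ w, w⁻¹ * g (z - w)‖ := by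
        rw [cauchyTransform, norm_mul, norm_inv, Complex.norm_real,
          Real.norm_of_nonneg Real.pi_pos.le]
    _ ≤ Real.pi⁻¹ * ((∫ w in D, ‖w⁻¹‖) * M) := by gcongr
    _ = (Real.pi⁻¹ * ∫ w in D, ‖w⁻¹‖) * M := (mul_assoc _ _ _).symm

end CauchyTransform

/-- The solution `q ^ N * C[g / q ^ N]` of `∂h/∂z̄ = g`, with `C` the Cauchy transform and `q`
holomorphic without zeros on the support of `g`. As `N` grows it decays geometrically wherever `|q|`
is smaller than it is on the support of `g`. -/
noncomputable def weightedCauchyTransform (q : ℂ → ℂ) (N : ℕ) (g : ℂ → ℂ) (z : ℂ) : ℂ :=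
  q z ^ N * cauchyTransform (fun w => g w * (q w ^ N)⁻¹) z

section WeightedCauchyTransform

variable {W : Set ℂ} {g q : ℂ → ℂ}

theorem contDiff_mul_of_tsupport_subset {θ : ℂ → ℂ} (hW : IsOpen W) (hθ : ContDiff ℝ ∞ θ)
    (hsupp : tsupport θ ⊆ W) (hg : ContDiffOn ℝ ∞ g W) : ContDiff ℝ ∞ fun w => θ w * g w := by
  refine contDiff_iff_contDiffAt.2 fun w => ?_
  by_cases hw : w ∈ tsupport θ
  · exact hθ.contDiffAt.mul (hg.contDiffAt (hW.mem_nhds (hsupp hw)))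
  · refine (contDiffAt_const (c := (0 : ℂ))).congr_of_eventuallyEq ?_
    filter_upwards [(isClosed_tsupport θ).isOpen_compl.mem_nhds hw] with y hy
    rw [image_eq_zero_of_notMem_tsupport hy, zero_mul]

theorem contDiff_mul_inv_pow (hW : IsOpen W) (hq : DifferentiableOn ℂ q W) (hg : ContDiff ℝ ∞ g)
    (hsupp : tsupport g ⊆ {z ∈ W | q z ≠ 0}) (N : ℕ) :
    ContDiff ℝ ∞ fun w => g w * (q w ^ N)⁻¹ := by
  have hopen : IsOpen {z ∈ W | q z ≠ 0} :=
    hq.continuousOn.isOpen_inter_preimage hW isOpen_ne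
  have hinv : DifferentiableOn ℂ (fun w => (q w ^ N)⁻¹) {z ∈ W | q z ≠ 0} :=
    ((hq.mono fun w hw => hw.1).pow N).inv fun w hw => pow_ne_zero N hw.2
  exact contDiff_mul_of_tsupport_subset hopen hg hsupp
    (contDiffOn_real_of_differentiableOn hinv hopen)

theorem contDiffOn_weightedCauchyTransform (hW : IsOpen W) (hq : DifferentiableOn ℂ q W)
    (hg : ContDiff ℝ ∞ g) (hc : HasCompactSupport g) (hsupp : tsupport g ⊆ {z ∈ W | q z ≠ 0})
    (N : ℕ) : ContDiffOn ℝ ∞ (weightedCauchyTransform q N g) W :=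
  (contDiffOn_real_of_differentiableOn (hq.pow N) hW).mul
    (contDiff_cauchyTransform (contDiff_mul_inv_pow hW hq hg hsupp N) hc.mul_right).contDiffOn

theorem wirtDbar_weightedCauchyTransform (hW : IsOpen W) (hq : DifferentiableOn ℂ q W)
    (hg : ContDiff ℝ ∞ g) (hc : HasCompactSupport g) (hsupp : tsupport g ⊆ {z ∈ W | q z ≠ 0})
    (N : ℕ) {z : ℂ} (hz : z ∈ W) : wirtDbar (weightedCauchyTransform q N g) z = g z := by
  have hquot : ContDiff ℝ 1 fun w => g w * (q w ^ N)⁻¹ :=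
    (contDiff_mul_inv_pow hW hq hg hsupp N).of_le (mod_cast le_top)
  have hdiff : DifferentiableAt ℝ (cauchyTransform fun w => g w * (q w ^ N)⁻¹) z :=
    (contDiff_cauchyTransform (n := 1) hquot hc.mul_right).differentiable (by simp) z
  have hpow : DifferentiableAt ℂ (fun w => q w ^ N) z :=
    (hq.pow N).differentiableAt (hW.mem_nhds hz)
  unfold weightedCauchyTransform
  rw [wirtDbar_holomorphic_mul hpow hdiff,
    wirtDbar_cauchyTransform hquot hc.mul_right]
  by_cases hw : z ∈ tsupport g
  · have := pow_ne_zero N (hsupp hw).2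
    field_simp
  · simp only [image_eq_zero_of_notMem_tsupport hw, zero_mul, mul_zero]

theorem exists_norm_weightedCauchyTransform_le (hg : Continuous g) (hc : HasCompactSupport g)
    {a b : ℝ} (hb : 0 < b) (hgq : ∀ z ∈ tsupport g, b ≤ ‖q z‖) {K : Set ℂ}
    (hK : Bornology.IsBounded K) (hKq : ∀ z ∈ K, ‖q z‖ ≤ a) :
    ∃ C, ∀ N, ∀ z ∈ K, ‖weightedCauchyTransform q N g z‖ ≤ C * (a / b) ^ N := by
  obtain ⟨M, hM⟩ := hc.exists_bound_of_continuous hg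
  obtain ⟨R, hR⟩ := (hK.union hc.isCompact.isBounded).exists_norm_le
  have hquot_le : ∀ N w, ‖g w * (q w ^ N)⁻¹‖ ≤ M * b⁻¹ ^ N := fun N w => by
    have hM0 : 0 ≤ M := (norm_nonneg _).trans (hM w)
    by_cases hw : w ∈ tsupport g
    · rw [norm_mul, norm_inv, norm_pow, ← inv_pow]
      gcongr
      exacts [hM w, hgq w hw]
    · rw [image_eq_zero_of_notMem_tsupport hw, zero_mul, norm_zero]
      positivity
  have hquot_zero : ∀ N w, R < ‖w‖ → g w * (q w ^ N)⁻¹ = 0 := fun N w hw => by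
    have hmem : w ∉ tsupport g := fun hmem => (hR w (Or.inr hmem)).not_gt hw
    rw [image_eq_zero_of_notMem_tsupport hmem, zero_mul]
  refine ⟨(Real.pi⁻¹ * ∫ w in Metric.closedBall (0 : ℂ) (R + R), ‖w⁻¹‖) * M, fun N z hz => ?_⟩
  have hle := norm_cauchyTransform_le (hquot_le N) (hquot_zero N) (hR z (Or.inl hz))
  have ha : 0 ≤ a := (norm_nonneg _).trans (hKq z hz)
  rw [weightedCauchyTransform, norm_mul, norm_pow]
  calc ‖q z‖ ^ N * ‖cauchyTransform (fun w => g w * (q w ^ N)⁻¹) z‖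
      ≤ a ^ N * (_ * (M * b⁻¹ ^ N)) := by
        gcongr
        exact hKq z hz
    _ = _ := by
        rw [div_eq_mul_inv, mul_pow]
        ring

end WeightedCauchyTransform

section DbarEquation

variable {W : Set ℂ}

theorem exists_wirtDbar_eq_norm_le_of_lt {q : ℂ → ℂ} (hW : IsOpen W) (hq : DifferentiableOn ℂ q W)
    {g : ℂ → ℂ} (hg : ContDiff ℝ ∞ g) (hc : HasCompactSupport g) {a b : ℝ} (ha : 0 ≤ a)
    (hab : a < b) (hsupp : tsupport g ⊆ {z ∈ W | b < ‖q z‖}) {K : Set ℂ}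
    (hK : Bornology.IsBounded K) (hqK : ∀ z ∈ K, ‖q z‖ ≤ a) {ε : ℝ} (hε : 0 < ε) :
    ∃ h : ℂ → ℂ, ContDiffOn ℝ ∞ h W ∧ (∀ z ∈ W, wirtDbar h z = g z) ∧ ∀ z ∈ K, ‖h z‖ ≤ ε := by
  have hb : 0 < b := ha.trans_lt hab
  have hsupp' : tsupport g ⊆ {z ∈ W | q z ≠ 0} := fun z hz =>
    ⟨(hsupp hz).1, norm_pos_iff.1 (hb.trans (hsupp hz).2)⟩
  obtain ⟨C, hC⟩ := exists_norm_weightedCauchyTransform_le hg.continuous hc hb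
    (fun z hz => (hsupp hz).2.le) hK hqK
  obtain ⟨N, hN⟩ : ∃ N : ℕ, C * (a / b) ^ N < ε := by
    have htendsto := (tendsto_pow_atTop_nhds_zero_of_lt_one (div_nonneg ha hb.le)
      ((div_lt_one hb).2 hab)).const_mul C
    rw [mul_zero] at htendsto
    exact (htendsto.eventually (eventually_lt_nhds hε)).exists
  exact ⟨weightedCauchyTransform q N g, contDiffOn_weightedCauchyTransform hW hq hg hc hsupp' N,
    fun z hz => wirtDbar_weightedCauchyTransform hW hq hg hc hsupp' N hz,
    fun z hz => (hC N z hz).trans hN.le⟩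

theorem exists_smooth_finite_partition {s : Set ℂ} (hs : IsCompact s) {u : s → Set ℂ}
    (hu : ∀ p, IsOpen (u p)) (hmem : ∀ p, (p : ℂ) ∈ u p) :
    ∃ (t : Finset s) (ρ : s → ℂ → ℂ), (∀ p ∈ t, ContDiff ℝ ∞ (ρ p)) ∧
      (∀ p ∈ t, tsupport (ρ p) ⊆ u p) ∧ ∀ z ∈ s, ∑ p ∈ t, ρ p z = 1 := by
  classical
  obtain ⟨t, ht⟩ := hs.elim_finite_subcover u hu fun z hz => mem_iUnion.2 ⟨⟨z, hz⟩, hmem _⟩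
  obtain ⟨f, hf⟩ := SmoothPartitionOfUnity.exists_isSubordinate (ι := t) 𝓘(ℝ, ℂ)
    hs.isClosed (fun p => u p) (fun p => hu p) (fun z hz => by
      obtain ⟨p, hp, hz⟩ := mem_iUnion₂.1 (ht hz)
      exact mem_iUnion.2 ⟨⟨p, hp⟩, hz⟩)
  refine ⟨t, fun p z => if hp : p ∈ t then (f ⟨p, hp⟩ z : ℂ) else 0, fun p hp => ?_,
    fun p hp => ?_, fun z hz => ?_⟩
  · simp only [dif_pos hp]
    exact Complex.ofRealCLM.contDiff.comp (contMDiff_iff_contDiff.1 (f ⟨p, hp⟩).contMDiff)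
  · simp only [dif_pos hp]
    exact (tsupport_comp_subset Complex.ofReal_zero _).trans (hf ⟨p, hp⟩)
  · have hsum := f.sum_eq_one hz
    rw [finsum_eq_sum_of_fintype] at hsum
    rw [← Finset.sum_coe_sort, Finset.sum_congr rfl fun p _ => dif_pos p.2]
    exact_mod_cast hsum

theorem exists_wirtDbar_eq_norm_le {q : ℂ → ℂ → ℂ} (hW : IsOpen W)
    (hq : ∀ p ∈ W, DifferentiableOn ℂ (q p) W) (hqp : ∀ p ∈ W, q p p = 1) {g : ℂ → ℂ}
    (hg : ContDiff ℝ ∞ g) (hc : HasCompactSupport g) (hsupp : tsupport g ⊆ W) {K : Set ℂ}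
    (hK : Bornology.IsBounded K) (hqK : ∀ p ∈ tsupport g, ∀ z ∈ K, ‖q p z‖ ≤ 1 / 2)
    {ε : ℝ} (hε : 0 < ε) :
    ∃ h : ℂ → ℂ, ContDiffOn ℝ ∞ h W ∧ (∀ z ∈ W, wirtDbar h z = g z) ∧ ∀ z ∈ K, ‖h z‖ ≤ ε := by
  obtain ⟨t, ρ, hρ, hρu, hρ_sum⟩ := exists_smooth_finite_partition hc.isCompact
    (u := fun p => {z ∈ W | 3 / 4 < ‖q p z‖})
    (fun p => (hq p (hsupp p.2)).continuousOn.norm.isOpen_inter_preimage hW isOpen_Ioi)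
    (fun p => ⟨hsupp p.2, by rw [hqp p (hsupp p.2), norm_one]; norm_num⟩)
  have hpiece : ∀ p ∈ t, ∃ h : ℂ → ℂ, ContDiffOn ℝ ∞ h W ∧
      (∀ z ∈ W, wirtDbar h z = ρ p z * g z) ∧ ∀ z ∈ K, ‖h z‖ ≤ ε / (t.card + 1) := fun p hp =>
    exists_wirtDbar_eq_norm_le_of_lt hW (hq p (hsupp p.2)) ((hρ p hp).mul hg) hc.mul_left
      (by norm_num) (by norm_num) ((tsupport_mul_subset_left).trans (hρu p hp)) hK
      (hqK p p.2) (by positivity)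
  choose! h hh hh_eq hh_le using hpiece
  refine ⟨fun z => ∑ p ∈ t, h p z, ContDiffOn.sum hh, fun z hz => ?_, fun z hz => ?_⟩
  · rw [wirtDbar_sum fun p hp => differentiableAt_of_contDiffOn_isOpen (hh p hp) hW hz,
      Finset.sum_congr rfl fun p hp => hh_eq p hp z hz, ← Finset.sum_mul]
    by_cases hz' : z ∈ tsupport g
    · rw [hρ_sum z hz', one_mul]
    · rw [image_eq_zero_of_notMem_tsupport hz', mul_zero]
  · refine (norm_sum_le_of_le _ fun p hp => hh_le p hp z hz).trans ?_
    rw [Finset.sum_const, nsmul_eq_mul, mul_div_assoc', div_le_iff₀ (by positivity)]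
    nlinarith

theorem exists_smooth_cutoff {C : Set ℂ} (hW : IsOpen W) (hC : IsCompact C) (hCW : C ⊆ W) :
    ∃ θ : ℂ → ℂ, ContDiff ℝ ∞ θ ∧ HasCompactSupport θ ∧ tsupport θ ⊆ W ∧
      ∀ z ∈ C, θ =ᶠ[𝓝 z] 1 := by
  obtain ⟨D, hD, hCD, hDW⟩ := exists_compact_between hC hW hCW
  obtain ⟨f, hf_one, hf_zero, -⟩ := exists_contMDiffMap_one_nhds_of_subset_interior (n := ⊤)
    𝓘(ℝ, ℂ) hC.isClosed hCD
  have hsub : tsupport (fun z => (f z : ℂ)) ⊆ D :=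
    closure_minimal (Function.support_subset_iff'.2 fun z hz => by
      rw [hf_zero z hz, Complex.ofReal_zero]) hD.isClosed
  refine ⟨fun z => (f z : ℂ), Complex.ofRealCLM.contDiff.comp
    (contMDiff_iff_contDiff.1 f.contMDiff), hD.of_isClosed_subset (isClosed_tsupport _) hsub,
    hsub.trans hDW, fun z hz => ?_⟩
  filter_upwards [hf_one.filter_mono (nhds_le_nhdsSet hz)] with w hw
  rw [hw, Complex.ofReal_one, Pi.one_apply]

theorem exists_smooth_cutoff_seq (hW : IsOpen W) {C : ℕ → Set ℂ} (hC : ∀ n, IsCompact (C n))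
    (hCW : ∀ n, C n ⊆ W) :
    ∃ θ : ℕ → ℂ → ℂ, (∀ n, ContDiff ℝ ∞ (θ n)) ∧ (∀ n, HasCompactSupport (θ n)) ∧
      (∀ n, tsupport (θ n) ⊆ W) ∧ ∀ m n, m ≤ n → ∀ z ∈ C m, θ n =ᶠ[𝓝 z] 1 := by
  choose θ hθ hθc hθW hθ_one using fun n => exists_smooth_cutoff hW
    ((finite_Iic n).isCompact_biUnion fun m _ => hC m) (iUnion₂_subset fun m _ => hCW m)
  exact ⟨θ, hθ, hθc, hθW, fun m n hmn z hz => hθ_one n z (mem_biUnion (mem_Iic.2 hmn) hz)⟩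

end DbarEquation

section DbarSeries

variable {V : Set ℂ} {h : ℕ → ℂ → ℂ} {u : ℕ → ℝ} {m : ℕ}

theorem tsum_eqOn_sum_add_tsum (hu : Summable u)
    (hle : ∀ n, m ≤ n → ∀ z ∈ V, ‖h n z‖ ≤ u n) :
    EqOn (fun z => ∑' n, h n z) (fun z => ∑ n ∈ Finset.range m, h n z + ∑' n, h (n + m) z) V :=
  fun z hz => by
    have hsum : Summable fun n => h (n + m) z :=
      ((summable_nat_add_iff m).2 hu).of_norm_bounded fun n => hle _ (Nat.le_add_left m n) z hz
    exact (((summable_nat_add_iff (f := fun n => h n z) m).1 hsum).sum_add_tsum_nat_add m).symm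

theorem differentiableOn_tsum_nat_add (hV : IsOpen V) (hu : Summable u)
    (hh : ∀ n, ContDiffOn ℝ ∞ (h n) V) (hhol : ∀ n, m ≤ n → ∀ z ∈ V, wirtDbar (h n) z = 0)
    (hle : ∀ n, m ≤ n → ∀ z ∈ V, ‖h n z‖ ≤ u n) :
    DifferentiableOn ℂ (fun z => ∑' n, h (n + m) z) V :=
  Complex.differentiableOn_tsum_of_summable_norm ((summable_nat_add_iff m).2 hu)
    (fun n z hz => (differentiableAt_complex_of_wirtDbar_eq_zero
      (differentiableAt_of_contDiffOn_isOpen (hh _) hV hz)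
      (hhol _ (Nat.le_add_left m n) z hz)).differentiableWithinAt)
    hV fun n => hle _ (Nat.le_add_left m n)

theorem contDiffOn_tsum_of_wirtDbar_eq_zero (hV : IsOpen V) (hu : Summable u)
    (hh : ∀ n, ContDiffOn ℝ ∞ (h n) V) (hhol : ∀ n, m ≤ n → ∀ z ∈ V, wirtDbar (h n) z = 0)
    (hle : ∀ n, m ≤ n → ∀ z ∈ V, ‖h n z‖ ≤ u n) :
    ContDiffOn ℝ ∞ (fun z => ∑' n, h n z) V :=
  ((ContDiffOn.sum fun n _ => hh n).add (contDiffOn_real_of_differentiableOn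
    (differentiableOn_tsum_nat_add hV hu hh hhol hle) hV)).congr (tsum_eqOn_sum_add_tsum hu hle)

theorem wirtDbar_tsum_eq_sum_range (hV : IsOpen V) (hu : Summable u)
    (hh : ∀ n, ContDiffOn ℝ ∞ (h n) V) (hhol : ∀ n, m ≤ n → ∀ z ∈ V, wirtDbar (h n) z = 0)
    (hle : ∀ n, m ≤ n → ∀ z ∈ V, ‖h n z‖ ≤ u n) {z : ℂ} (hz : z ∈ V) :
    wirtDbar (fun z => ∑' n, h n z) z = ∑ n ∈ Finset.range m, wirtDbar (h n) z := by
  have hdiff : ∀ n, DifferentiableAt ℝ (h n) z := fun n =>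
    differentiableAt_of_contDiffOn_isOpen (hh n) hV hz
  have htail : DifferentiableAt ℂ (fun z => ∑' n, h (n + m) z) z :=
    (differentiableOn_tsum_nat_add hV hu hh hhol hle).differentiableAt (hV.mem_nhds hz)
  rw [wirtDbar_congr ((tsum_eqOn_sum_add_tsum hu hle).eventuallyEq_of_mem (hV.mem_nhds hz)),
    wirtDbar_add (DifferentiableAt.fun_sum fun n _ => hdiff n) (htail.restrictScalars ℝ),
    wirtDbar_sum fun n _ => hdiff n, wirtDbar_of_differentiableAt htail, add_zero]

theorem contDiffAt_tsum_and_wirtDbar_tsum_of_exhaustion {W : Set ℂ}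
    {L : ℕ → Set ℂ} (hLW : ∀ n, L n ⊆ W) (hL : Monotone L) (hu : Summable u)
    (hh : ∀ n, ContDiffOn ℝ ∞ (h n) W) (hhol : ∀ n, ∀ z ∈ L n, wirtDbar (h n) z = 0)
    (hle : ∀ n, ∀ z ∈ L n, ‖h n z‖ ≤ u n) {z : ℂ} (hm : L m ∈ 𝓝 z) :
    ContDiffAt ℝ ∞ (fun z => ∑' n, h n z) z ∧
      wirtDbar (fun z => ∑' n, h n z) z = ∑ n ∈ Finset.range m, wirtDbar (h n) z := by
  have hz : z ∈ interior (L m) := mem_interior_iff_mem_nhds.2 hm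
  have hmem : ∀ n, m ≤ n → ∀ w ∈ interior (L m), w ∈ L n := fun n hmn w hw =>
    hL hmn (interior_subset hw)
  have hh' : ∀ n, ContDiffOn ℝ ∞ (h n) (interior (L m)) := fun n =>
    (hh n).mono (interior_subset.trans (hLW m))
  have hhol' : ∀ n, m ≤ n → ∀ w ∈ interior (L m), wirtDbar (h n) w = 0 := fun n hmn w hw =>
    hhol n w (hmem n hmn w hw)
  have hle' : ∀ n, m ≤ n → ∀ w ∈ interior (L m), ‖h n w‖ ≤ u n := fun n hmn w hw =>
    hle n w (hmem n hmn w hw)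
  exact ⟨(contDiffOn_tsum_of_wirtDbar_eq_zero isOpen_interior hu hh' hhol' hle').contDiffAt
    (isOpen_interior.mem_nhds hz),
    wirtDbar_tsum_eq_sum_range isOpen_interior hu hh' hhol' hle' hz⟩

end DbarSeries

theorem tsupport_sub_subset_diff {W C : Set ℂ} {θ θ' g : ℂ → ℂ} (hθ : tsupport θ ⊆ W)
    (hθ' : tsupport θ' ⊆ W) (hC : ∀ z ∈ C, θ =ᶠ[𝓝 z] 1) (hC' : ∀ z ∈ C, θ' =ᶠ[𝓝 z] 1) :
    tsupport (fun w => θ' w * g w - θ w * g w) ⊆ W \ C := by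
  have hzero : ∀ z, θ =ᶠ[𝓝 z] θ' → z ∉ tsupport fun w => θ' w * g w - θ w * g w := fun z hz =>
    notMem_tsupport_iff_eventuallyEq.2 <| by
      filter_upwards [hz] with w hw
      rw [hw, sub_self, Pi.zero_apply]
  refine fun z hz => ⟨by_contra fun hzW => hzero z ?_ hz,
    fun hzC => hzero z ((hC z hzC).trans (hC' z hzC).symm) hz⟩
  exact (notMem_tsupport_iff_eventuallyEq.1 fun hmem => hzW (hθ hmem)).trans
    (notMem_tsupport_iff_eventuallyEq.1 fun hmem => hzW (hθ' hmem)).symm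

theorem exists_wirtDbar_eq {W : Set ℂ} (hW : IsOpen W) {g : ℂ → ℂ} (hg : ContDiffOn ℝ ∞ g W) :
    ∃ h : ℂ → ℂ, ContDiffOn ℝ ∞ h W ∧ ∀ z ∈ W, wirtDbar h z = g z := by
  obtain ⟨q, hq, hq_le⟩ := exists_norm_isNormalizedUnivalent_le_half hW
  obtain ⟨L, hL_eq⟩ : ∃ L : ℕ → Set ℂ, ∀ n, L n = compactCore W (n + 1) := ⟨_, fun _ => rfl⟩
  have hL : ∀ n, IsCompact (L n) := fun n => hL_eq n ▸ isCompact_compactCore W _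
  have hLW : ∀ n, L n ⊆ W := fun n => hL_eq n ▸ compactCore_subset n.cast_add_one_pos
  have hL_mono : Monotone L := fun m n hmn => by
    rw [hL_eq, hL_eq]
    exact compactCore_mono m.cast_add_one_pos (by gcongr)
  choose C hCW hC hCq using fun n => hq_le (L n) (hLW n) (hL n)
  obtain ⟨θ, hθ, hθc, hθW, hθ_one⟩ := exists_smooth_cutoff_seq hW
    (fun n => (hL n).union (hC n)) fun n => union_subset (hLW n) (hCW n)
  have hθg : ∀ n, ContDiff ℝ ∞ fun w => θ n w * g w := fun n =>
    contDiff_mul_of_tsupport_subset hW (hθ n) (hθW n) hg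
  have hsupp : ∀ n, tsupport (fun w => θ (n + 1) w * g w - θ n w * g w) ⊆ W \ (L n ∪ C n) :=
    fun n => tsupport_sub_subset_diff (hθW n) (hθW _) (hθ_one n n le_rfl)
      (hθ_one n (n + 1) n.le_succ)
  choose h hh hh_eq hh_le using fun n => exists_wirtDbar_eq_norm_le hW
    (fun p hp => (hq p hp).differentiableOn) (fun p hp => (hq p hp).map_self)
    ((hθg (n + 1)).sub (hθg n)) ((hθc (n + 1)).mul_right.sub (hθc n).mul_right)
    ((hsupp n).trans sdiff_subset) (hL n).isBounded
    (fun p hp => hCq n p ⟨(hsupp n hp).1, fun hpC => (hsupp n hp).2 (Or.inr hpC)⟩)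
    (ε := (1 / 2 : ℝ) ^ n) (by positivity)
  have hhol : ∀ n, ∀ z ∈ L n, wirtDbar (h n) z = 0 := fun n z hz => by
    rw [hh_eq n z (hLW n hz)]
    exact image_eq_zero_of_notMem_tsupport (f := fun w => θ (n + 1) w * g w - θ n w * g w)
      fun hz' => (hsupp n hz').2 (Or.inl hz)
  have hC₀ : ContDiff ℝ ∞ (cauchyTransform fun w => θ 0 w * g w) :=
    contDiff_cauchyTransform (hθg 0) (hθc 0).mul_right
  refine ⟨fun z => cauchyTransform (fun w => θ 0 w * g w) z + ∑' n, h n z, fun z hz => ?_,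
    fun z hz => ?_⟩ <;>
    obtain ⟨m, hm⟩ := exists_compactCore_mem_nhds hW hz <;>
    rw [← hL_eq] at hm <;>
    obtain ⟨hsmooth, hsum⟩ := contDiffAt_tsum_and_wirtDbar_tsum_of_exhaustion hLW hL_mono
      summable_geometric_two hh hhol hh_le hm
  · exact (hC₀.contDiffAt.add hsmooth).contDiffWithinAt
  · rw [wirtDbar_add (hC₀.contDiffAt.differentiableAt (by simp))
        (hsmooth.differentiableAt (by simp)),
      wirtDbar_cauchyTransform ((hθg 0).of_le (mod_cast le_top)) (hθc 0).mul_right, hsum,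
      Finset.sum_congr rfl fun n _ => hh_eq n z hz, Finset.sum_range_sub fun n => θ n z * g z,
      (hθ_one m m le_rfl z (Or.inl (mem_of_mem_nhds hm))).self_of_nhds, Pi.one_apply, one_mul,
      add_sub_cancel]

/-! ### Smooth functions with prescribed zeros -/

section Jacobian

theorem det_of_apply_eq {L : ℂ →L[ℝ] ℂ} {A B : ℂ} (h : ∀ v, L v = A * v + B * conj v) :
    L.det = ‖A‖ ^ 2 - ‖B‖ ^ 2 := by
  rw [ContinuousLinearMap.det, ← LinearMap.det_toMatrix Complex.basisOneI, Matrix.det_fin_two]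
  simp only [LinearMap.toMatrix_apply, Complex.coe_basisOneI, Complex.coe_basisOneI_repr]
  simp [h, Complex.sq_norm, Complex.normSq_apply]
  ring

theorem det_fderiv_eq (f : ℂ → ℂ) (z : ℂ) :
    (fderiv ℝ f z).det = ‖wirtD f z‖ ^ 2 - ‖wirtDbar f z‖ ^ 2 :=
  det_of_apply_eq (fderiv_apply_eq_wirtD f z)

open MeasureTheory in
theorem exists_regular_value {E : Type*} [NormedAddCommGroup E] [NormedSpace ℝ E]
    [FiniteDimensional ℝ E] {V : Set E} {t : E → E} (ht : ∀ z ∈ V, DifferentiableAt ℝ t z) :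
    ∃ κ : E, ∀ z ∈ V, t z = κ → (fderiv ℝ t z).det ≠ 0 := by
  borelize E
  have hnull : Measure.addHaar (t '' {z ∈ V | (fderiv ℝ t z).det = 0}) = 0 :=
    addHaar_image_eq_zero_of_det_fderivWithin_eq_zero _ (f' := fderiv ℝ t)
      (fun z hz => (ht z hz.1).hasFDerivAt.hasFDerivWithinAt) fun z hz => hz.2
  obtain ⟨κ, hκ⟩ : ∃ κ, κ ∉ t '' {z ∈ V | (fderiv ℝ t z).det = 0} := by
    by_contra! hall
    rw [eq_univ_of_forall hall] at hnull
    exact isOpen_univ.measure_ne_zero _ univ_nonempty hnull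
  exact ⟨κ, fun z hz hzκ hdet => hκ ⟨z, ⟨hz, hdet⟩, hzκ⟩⟩

theorem eventually_ne_of_det_fderiv_ne_zero {E : Type*} [NormedAddCommGroup E] [NormedSpace ℝ E]
    [FiniteDimensional ℝ E] {f : E → E} {p : E} (hdet : (fderiv ℝ f p).det ≠ 0)
    (hf : DifferentiableAt ℝ f p) (c : E) : ∀ᶠ z in 𝓝[≠] p, f z ≠ c :=
  hf.hasFDerivAt.eventually_ne
    ⟨_, ((fderiv ℝ f p).toContinuousLinearEquivOfDetNeZero hdet).antilipschitz⟩

theorem eventually_norm_lt_norm_of_hasFDerivAt {E F G : Type*} [NormedAddCommGroup E]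
    [NormedSpace ℝ E] [NormedAddCommGroup F] [NormedSpace ℝ F] [NormedAddCommGroup G]
    [NormedSpace ℝ G] {f : E → F} {g : E → G} {f' : E →L[ℝ] F} {g' : E →L[ℝ] G} {p : E}
    (hf : HasFDerivAt f f' p) (hg : HasFDerivAt g g' p) (hfp : f p = 0) (hgp : g p = 0) {a b : ℝ}
    (hba : b < a) (hf' : ∀ v, a * ‖v‖ ≤ ‖f' v‖) (hg' : ∀ v, ‖g' v‖ ≤ b * ‖v‖) :
    ∀ᶠ z in 𝓝[≠] p, ‖g z‖ < ‖f z‖ := by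
  obtain ⟨ε, hε, hεab⟩ : ∃ ε > 0, b + ε < a - ε := ⟨(a - b) / 3, by linarith, by linarith⟩
  filter_upwards [(hf.isLittleO.bound hε).filter_mono nhdsWithin_le_nhds,
    (hg.isLittleO.bound hε).filter_mono nhdsWithin_le_nhds, self_mem_nhdsWithin] with z hfz hgz hzp
  rw [hfp, sub_zero] at hfz
  rw [hgp, sub_zero] at hgz
  have hpos : 0 < ‖z - p‖ := norm_pos_iff.2 (sub_ne_zero.2 hzp)
  calc ‖g z‖ ≤ ‖g' (z - p)‖ + ‖g z - g' (z - p)‖ := norm_le_norm_add_norm_sub' _ _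
    _ ≤ b * ‖z - p‖ + ε * ‖z - p‖ := add_le_add (hg' _) hgz
    _ < a * ‖z - p‖ - ε * ‖z - p‖ := by
        rw [← add_mul, ← sub_mul]
        exact mul_lt_mul_of_pos_right hεab hpos
    _ ≤ ‖f' (z - p)‖ - ‖f z - f' (z - p)‖ := sub_le_sub (hf' _) hfz
    _ ≤ ‖f z‖ := by
        linarith [norm_le_norm_add_norm_sub (f z) (f' (z - p))]

end Jacobian

section ElementaryFactor

theorem eventually_norm_sub_lt_norm {f τ : ℂ → ℂ} {p : ℂ} (hf : DifferentiableAt ℝ f p)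
    (hτ : DifferentiableAt ℝ τ p) (hfp : f p = 0) (hτp : τ p = 0) (hD : wirtD f p = wirtD τ p)
    (hDbar : wirtDbar f p = 0) (hlt : ‖wirtDbar τ p‖ < ‖wirtD τ p‖) :
    ∀ᶠ z in 𝓝[≠] p, ‖τ z - f z‖ < ‖f z‖ := by
  refine eventually_norm_lt_norm_of_hasFDerivAt hf.hasFDerivAt
    (hτ.hasFDerivAt.sub hf.hasFDerivAt) hfp (by simp only [hfp, hτp, sub_zero]) hlt
    (fun v => ?_) (fun v => ?_)
  · rw [fderiv_apply_eq_wirtD, hDbar, hD, zero_mul, add_zero, norm_mul]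
  · rw [sub_apply, fderiv_apply_eq_wirtD, fderiv_apply_eq_wirtD, hDbar, hD, zero_mul,
      add_zero, add_sub_cancel_left, norm_mul, RCLike.norm_conj]

theorem exists_smooth_interpolation {f τ : ℂ → ℂ} {p : ℂ} {U : Set ℂ} (hU : U ∈ 𝓝 p)
    (hf : ContDiffOn ℝ ∞ f U) (hτ : ContDiffOn ℝ ∞ τ U) (hfp : f p = 0) (hτp : τ p = 0)
    (hD : wirtD f p = wirtD τ p) (hDbar : wirtDbar f p = 0) (hlt : ‖wirtDbar τ p‖ < ‖wirtD τ p‖) :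
    ∃ G : ℂ → ℂ, (∀ z, ContDiffAt ℝ ∞ f z → ContDiffAt ℝ ∞ G z) ∧ G =ᶠ[𝓝 p] τ ∧
      (∀ z ∉ U, G z = f z) ∧ ∀ z ≠ p, f z ≠ 0 → G z ≠ 0 := by
  have hfd := (hf.contDiffAt hU).differentiableAt (by simp)
  have hτd := (hτ.contDiffAt hU).differentiableAt (by simp)
  obtain ⟨δ, hδ, hball⟩ := Metric.mem_nhds_iff.1 (Filter.inter_mem (interior_mem_nhds.2 hU)
    (eventually_nhdsWithin_iff.1 (eventually_norm_sub_lt_norm hfd hτd hfp hτp hD hDbar hlt)))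
  let η : ContDiffBump p := ⟨δ / 3, δ / 2, by linarith, by linarith⟩
  have hη_zero : ∀ z ∉ Metric.ball p δ, (η : ℂ → ℝ) =ᶠ[𝓝 z] 0 := fun z hz => by
    refine notMem_tsupport_iff_eventuallyEq.1 fun hmem => hz ?_
    rw [η.tsupport_eq] at hmem
    exact Metric.closedBall_subset_ball (half_lt_self hδ) hmem
  have hη : ContDiff ℝ ∞ fun z => (η z : ℂ) := Complex.ofRealCLM.contDiff.comp η.contDiff
  refine ⟨fun z => f z + η z * (τ z - f z), fun z hfz => ?_, ?_, fun z hz => ?_,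
    fun z hzp hfz => ?_⟩
  · by_cases hz : z ∈ Metric.ball p δ
    · have hτz := hτ.contDiffAt (mem_interior_iff_mem_nhds.1 (hball hz).1)
      exact hfz.add (hη.contDiffAt.mul (hτz.sub hfz))
    · refine hfz.congr_of_eventuallyEq ?_
      filter_upwards [hη_zero z hz] with w hw
      rw [hw, Pi.zero_apply, Complex.ofReal_zero, zero_mul, add_zero]
  · filter_upwards [η.eventuallyEq_one] with z hz
    rw [hz, Pi.one_apply, Complex.ofReal_one, one_mul, add_sub_cancel]
  · have hz' : z ∉ Metric.ball p δ := fun hmem => hz (interior_subset (hball hmem).1)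
    simp only [(hη_zero z hz').self_of_nhds, Pi.zero_apply, Complex.ofReal_zero, zero_mul, add_zero]
  · by_cases hz : z ∈ Metric.ball p δ
    · have hsmall : ‖η z * (τ z - f z)‖ < ‖f z‖ := by
        rw [norm_mul, Complex.norm_real, Real.norm_of_nonneg η.nonneg]
        exact (mul_le_of_le_one_left (norm_nonneg _) η.le_one).trans_lt ((hball hz).2 hzp)
      intro hzero
      have hnorm := congrArg norm (eq_neg_of_add_eq_zero_left hzero)
      rw [norm_neg] at hnorm
      exact hsmall.ne' hnorm
    · simpa only [(hη_zero z hz).self_of_nhds, Pi.zero_apply, Complex.ofReal_zero, zero_mul,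
        add_zero]

theorem exists_smooth_eq_one_sub_nhds_one :
    ∃ β : ℂ → ℂ, ContDiff ℝ ∞ β ∧ (∀ ζ, ‖ζ‖ ≤ 1 / 2 → β ζ = 1) ∧ (∀ ζ, β ζ = 0 ↔ ζ = 1) ∧
      β =ᶠ[𝓝 1] fun ζ => 1 - ζ := by
  let f : ContDiffBump (0 : ℂ) := ⟨1 / 2, 3 / 4, by norm_num, by norm_num⟩
  have hf_zero : ∀ ζ : ℂ, 3 / 4 ≤ ‖ζ‖ → f ζ = 0 := fun ζ hζ =>
    f.zero_of_le_dist (by simpa using hζ)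
  have hβ_far : ∀ ζ : ℂ, 3 / 4 ≤ ‖ζ‖ → 1 - ((1 - f ζ : ℝ) : ℂ) * ζ = 1 - ζ := fun ζ hζ => by
    rw [hf_zero ζ hζ, sub_zero, Complex.ofReal_one, one_mul]
  refine ⟨fun ζ => 1 - ((1 - f ζ : ℝ) : ℂ) * ζ, ?_, fun ζ hζ => ?_, fun ζ => ⟨fun hζ => ?_, ?_⟩, ?_⟩
  · exact contDiff_const.sub ((Complex.ofRealCLM.contDiff.comp
      (contDiff_const.sub f.contDiff)).mul contDiff_id)
  · have hone : f ζ = 1 := f.one_of_mem_closedBall (by simpa [f] using hζ)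
    simp only [hone, sub_self, Complex.ofReal_zero, zero_mul, sub_zero]
  · have hfar : 3 / 4 ≤ ‖ζ‖ := by
      have hnorm : (1 - f ζ) * ‖ζ‖ = 1 := by
        rw [← Real.norm_of_nonneg (sub_nonneg.2 (f.le_one (x := ζ))), ← Complex.norm_real,
          ← norm_mul, ← sub_eq_zero.1 hζ, norm_one]
      nlinarith [f.nonneg (x := ζ), norm_nonneg ζ]
    exact (sub_eq_zero.1 ((hβ_far ζ hfar).symm.trans hζ)).symm
  · rintro rfl
    exact (hβ_far 1 (by rw [norm_one]; norm_num)).trans (sub_self 1)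
  · have hev : ∀ᶠ ζ : ℂ in 𝓝 1, 3 / 4 < ‖ζ‖ :=
      continuous_norm.continuousAt.eventually_const_lt
        (by simpa only [norm_one] using (by norm_num : (3 / 4 : ℝ) < 1))
    filter_upwards [hev] with ζ hζ using hβ_far ζ hζ.le

/-- `F` is a factor on `W` of a smooth function with prescribed zeros: its only zero is `p`, where
it is proportional to the prescribed germ `τ`, and it is `1` wherever the weight `q` is small, which
makes infinite products of such factors locally finite. -/
structure IsElementaryFactor (W : Set ℂ) (p : ℂ) (q τ F : ℂ → ℂ) : Prop where
  contDiffOn : ContDiffOn ℝ ∞ F W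
  eq_zero_iff : ∀ z ∈ W, F z = 0 ↔ z = p
  eq_one : ∀ z ∈ W, ‖q z‖ ≤ 1 / 2 → F z = 1
  eventuallyEq : ∃ c ≠ 0, F =ᶠ[𝓝 p] fun z => c * τ z

variable {W : Set ℂ} {p : ℂ} {q τ F : ℂ → ℂ}

theorem IsElementaryFactor.conj (hF : IsElementaryFactor W p q τ F) :
    IsElementaryFactor W p q (fun z => conj (τ z)) fun z => conj (F z) where
  contDiffOn := contDiffOn_conj_comp hF.contDiffOn
  eq_zero_iff z hz := (map_eq_zero _).trans (hF.eq_zero_iff z hz)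
  eq_one z hz hqz := by rw [hF.eq_one z hz hqz, map_one]
  eventuallyEq := by
    obtain ⟨c, hc, hFc⟩ := hF.eventuallyEq
    refine ⟨conj c, (map_ne_zero _).2 hc, ?_⟩
    filter_upwards [hFc] with z hz
    rw [hz, map_mul]

theorem exists_isElementaryFactor_of_lt (hW : IsOpen W) (hp : p ∈ W)
    (hq : IsNormalizedUnivalent W p q) {U : Set ℂ} (hU : U ∈ 𝓝 p) (hτ : ContDiffOn ℝ ∞ τ U)
    (hτp : τ p = 0) (hlt : ‖wirtDbar τ p‖ < ‖wirtD τ p‖) :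
    ∃ F, IsElementaryFactor W p q τ F := by
  obtain ⟨β, hβ, hβ_one, hβ_zero, hβ_near⟩ := exists_smooth_eq_one_sub_nhds_one
  have hqp := hq.differentiableOn.differentiableAt (hW.mem_nhds hp)
  have hqp_tendsto : Filter.Tendsto q (𝓝 p) (𝓝 1) := hq.map_self ▸ hqp.continuousAt
  have hf : ContDiffOn ℝ ∞ (fun z => β (q z)) W :=
    hβ.comp_contDiffOn (contDiffOn_real_of_differentiableOn hq.differentiableOn hW)
  have hf_near : (fun z => β (q z)) =ᶠ[𝓝 p] fun z => 1 - q z := hqp_tendsto.eventually hβ_near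
  have hfD : wirtD (fun z => β (q z)) p = -deriv q p := by
    rw [wirtD_congr hf_near, wirtD_of_differentiableAt (hqp.const_sub 1), deriv_const_sub]
  have hfDbar : wirtDbar (fun z => β (q z)) p = 0 := by
    rw [wirtDbar_congr hf_near, wirtDbar_of_differentiableAt (hqp.const_sub 1)]
  have hA : wirtD τ p ≠ 0 := norm_pos_iff.1 ((norm_nonneg _).trans_lt hlt)
  obtain ⟨c, hc_eq⟩ : ∃ c, c = -deriv q p / wirtD τ p := ⟨_, rfl⟩
  have hc : c ≠ 0 := hc_eq ▸ div_ne_zero (neg_ne_zero.2 hq.deriv_ne_zero) hA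
  have hτd : DifferentiableAt ℝ τ p := (hτ.contDiffAt hU).differentiableAt (by simp)
  have hcτD : wirtD (fun z => c * τ z) p = c * wirtD τ p := wirtD_const_mul c hτd
  have hcτDbar : wirtDbar (fun z => c * τ z) p = c * wirtDbar τ p := wirtDbar_const_mul c hτd
  obtain ⟨V, hV_eq⟩ : ∃ V : Set ℂ, V = U ∩ (W ∩ {z | 1 / 2 < ‖q z‖}) := ⟨_, rfl⟩
  have hV : V ∈ 𝓝 p := by
    refine hV_eq ▸ Filter.inter_mem hU (Filter.inter_mem (hW.mem_nhds hp) ?_)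
    exact hqp_tendsto.norm.eventually_const_lt (by rw [norm_one]; norm_num)
  have hVsub : V ⊆ U ∩ W := hV_eq ▸ inter_subset_inter_right U inter_subset_left
  obtain ⟨F, hF, hFτ, hFV, hF_ne⟩ := exists_smooth_interpolation hV
    (hf.mono fun z hz => (hVsub hz).2)
    ((contDiffOn_const (c := c)).mul (hτ.mono fun z hz => (hVsub hz).1)) ((hβ_zero _).2 hq.map_self)
    (by rw [hτp, mul_zero]) (by rw [hcτD, hfD, hc_eq, div_mul_cancel₀ _ hA]) hfDbar
    (by rw [hcτD, hcτDbar, norm_mul, norm_mul]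
        exact mul_lt_mul_of_pos_left hlt (norm_pos_iff.2 hc))
  refine ⟨F, fun z hz => (hF z (hf.contDiffAt (hW.mem_nhds hz))).contDiffWithinAt,
    fun z hz => ⟨?_, ?_⟩, fun z _ hqz => ?_, c, hc, hFτ⟩
  · contrapose!
    refine fun hzp => hF_ne z hzp fun hzero => hzp ?_
    exact hq.injOn hz hp (((hβ_zero _).1 hzero).trans hq.map_self.symm)
  · rintro rfl
    exact hFτ.self_of_nhds.trans (by simp only [hτp, mul_zero])
  · rw [hFV z fun hzV => ?_, hβ_one _ hqz]
    rw [hV_eq] at hzV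
    exact hqz.not_gt hzV.2.2

theorem exists_isElementaryFactor (hW : IsOpen W) (hp : p ∈ W) (hq : IsNormalizedUnivalent W p q)
    {U : Set ℂ} (hU : U ∈ 𝓝 p) (hτ : ContDiffOn ℝ ∞ τ U) (hτp : τ p = 0)
    (hdet : (fderiv ℝ τ p).det ≠ 0) : ∃ F, IsElementaryFactor W p q τ F := by
  rw [det_fderiv_eq, sub_ne_zero, Ne, sq_eq_sq₀ (norm_nonneg _) (norm_nonneg _)] at hdet
  rcases lt_or_gt_of_ne hdet with hlt | hlt
  · have hτd : DifferentiableAt ℝ τ p := (hτ.contDiffAt hU).differentiableAt (by simp)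
    obtain ⟨F, hF⟩ := exists_isElementaryFactor_of_lt hW hp hq hU (contDiffOn_conj_comp hτ)
      (by rw [hτp, map_zero])
      (by rwa [wirtD_conj hτd, wirtDbar_conj hτd, RCLike.norm_conj, RCLike.norm_conj])
    exact ⟨_, by simpa only [Complex.conj_conj] using hF.conj⟩
  · exact exists_isElementaryFactor_of_lt hW hp hq hU hτ hτp hlt

end ElementaryFactor

section PrescribedZeros

theorem contDiffAt_complex_div {E : Type*} [NormedAddCommGroup E] [NormedSpace ℝ E] {f g : E → ℂ}
    {n : WithTop ℕ∞} {x : E} (hf : ContDiffAt ℝ n f x) (hg : ContDiffAt ℝ n g x) (hx : g x ≠ 0) :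
    ContDiffAt ℝ n (fun y => f y / g y) x := by
  simp only [div_eq_mul_inv]
  exact hf.mul (hg.inv hx)

theorem finite_inter_of_eventually_notMem {X : Type*} [TopologicalSpace X] {Z K : Set X}
    (hK : IsCompact K) (hZ : ∀ p ∈ K, ∀ᶠ z in 𝓝[≠] p, z ∉ Z) : (Z ∩ K).Finite := by
  by_contra hinf
  obtain ⟨p, hp, hacc⟩ := Set.Infinite.exists_accPt_of_subset_isCompact hinf hK inter_subset_right
  exact accPt_iff_frequently_nhdsNE.1 hacc ((hZ p hp).mono fun z hz hmem => hz hmem.1)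

theorem exists_contDiffOn_mul_eq {E : Type*} [NormedAddCommGroup E] [NormedSpace ℝ E] {U W : Set E}
    {f g u P : E → ℂ} (hU : IsOpen U) (hW : IsOpen W) (hf : ContDiffOn ℝ ∞ f W)
    (hP : ContDiffOn ℝ ∞ P W) (hg : ContDiffOn ℝ ∞ g U) (hu : ContDiffOn ℝ ∞ u U)
    (hu_ne : ∀ z ∈ U, u z ≠ 0) (hP_ne : ∀ z ∈ W \ U, P z ≠ 0)
    (hcompat : ∀ z ∈ U, g z * P z = f z * u z) :
    ∃ v : E → ℂ, ContDiffOn ℝ ∞ v W ∧ (∀ z ∈ U, v z * u z = g z) ∧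
      ∀ z ∈ W \ U, v z * P z = f z := by
  classical
  refine ⟨fun z => if z ∈ U then g z / u z else f z / P z, fun z hz => ?_, fun z hz => ?_,
    fun z hz => ?_⟩
  · by_cases hzU : z ∈ U
    · refine ((contDiffAt_complex_div (hg.contDiffAt (hU.mem_nhds hzU))
        (hu.contDiffAt (hU.mem_nhds hzU)) (hu_ne z hzU)).congr_of_eventuallyEq ?_).contDiffWithinAt
      filter_upwards [hU.mem_nhds hzU] with w hw
      exact if_pos hw
    · have hPz := hP_ne z ⟨hz, hzU⟩
      refine ((contDiffAt_complex_div (hf.contDiffAt (hW.mem_nhds hz))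
        (hP.contDiffAt (hW.mem_nhds hz)) hPz).congr_of_eventuallyEq ?_).contDiffWithinAt
      filter_upwards [(hP.contDiffAt (hW.mem_nhds hz)).continuousAt.eventually_ne hPz] with w hw
      split_ifs with hwU
      · exact (div_eq_div_iff (hu_ne w hwU) hw).2 (hcompat w hwU)
      · rfl
  · simp only [if_pos hz, div_mul_cancel₀ _ (hu_ne z hz)]
  · simp only [if_neg hz.2, div_mul_cancel₀ _ (hP_ne z hz)]

theorem exists_contDiffOn_eq_mul {E : Type*} [NormedAddCommGroup E] [NormedSpace ℝ E] {U : Set E}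
    {τ P : E → ℂ} (hU : IsOpen U) (hτ : ContDiffOn ℝ ∞ τ U) (hP : ContDiffOn ℝ ∞ P U)
    (hτ_ne : ∀ p ∈ U, ∀ᶠ z in 𝓝[≠] p, τ z ≠ 0) (hP_ne : ∀ z ∈ U, τ z ≠ 0 → P z ≠ 0)
    (hgerm : ∀ p ∈ U, τ p = 0 →
      ∃ R : E → ℂ, ContDiffAt ℝ ∞ R p ∧ R p ≠ 0 ∧ P =ᶠ[𝓝 p] fun z => τ z * R z) :
    ∃ u : E → ℂ, ContDiffOn ℝ ∞ u U ∧ (∀ z ∈ U, u z ≠ 0) ∧ ∀ z ∈ U, P z = τ z * u z := by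
  classical
  choose! R hR hR_ne hPR using hgerm
  obtain ⟨u, hu⟩ : ∃ u : E → ℂ, ∀ z, u z = if τ z = 0 then R z z else P z / τ z := ⟨_, fun _ => rfl⟩
  have hu_zero : ∀ z, τ z = 0 → u z = R z z := fun z hz => by rw [hu, if_pos hz]
  have hu_div : ∀ z, τ z ≠ 0 → u z = P z / τ z := fun z hz => by rw [hu, if_neg hz]
  refine ⟨u, fun p hp => ContDiffAt.contDiffWithinAt ?_, fun z hz => ?_, fun z hz => ?_⟩
  · have hτp := hτ.contDiffAt (hU.mem_nhds hp)
    by_cases hp0 : τ p = 0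
    · refine (hR p hp hp0).congr_of_eventuallyEq ?_
      filter_upwards [hPR p hp hp0, eventually_nhdsWithin_iff.1 (hτ_ne p hp)] with z hz hz_ne
      obtain rfl | hzp := eq_or_ne z p
      · exact hu_zero z hp0
      · rw [hu_div z (hz_ne hzp), hz, mul_div_cancel_left₀ _ (hz_ne hzp)]
    · refine (contDiffAt_complex_div (hP.contDiffAt (hU.mem_nhds hp)) hτp
        hp0).congr_of_eventuallyEq ?_
      filter_upwards [hτp.continuousAt.eventually_ne hp0] with z hz using hu_div z hz
  · by_cases hz0 : τ z = 0
    · exact hu_zero z hz0 ▸ hR_ne z hz hz0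
    · exact hu_div z hz0 ▸ div_ne_zero (hP_ne z hz hz0) hz0
  · by_cases hz0 : τ z = 0
    · exact (hPR z hz hz0).self_of_nhds.trans (by simp only [hz0, zero_mul])
    · rw [hu_div z hz0, mul_div_cancel₀ _ hz0]

theorem exists_smooth_prescribed_zeros {W U Z : Set ℂ} {τ : ℂ → ℂ} (hW : IsOpen W) (hU : IsOpen U)
    (hτ : ContDiffOn ℝ ∞ τ U) (hZ : ∀ p ∈ W, ∀ᶠ z in 𝓝[≠] p, z ∉ Z) (hZW : Z ⊆ W) (hZU : Z ⊆ U)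
    (hτ_zero : ∀ p ∈ Z, τ p = 0) (hτ_det : ∀ p ∈ Z, (fderiv ℝ τ p).det ≠ 0) :
    ∃ P : ℂ → ℂ, ContDiffOn ℝ ∞ P W ∧ (∀ z ∈ W, P z = 0 → z ∈ Z) ∧ ∀ p ∈ Z,
      ∃ R : ℂ → ℂ, ContDiffAt ℝ ∞ R p ∧ R p ≠ 0 ∧ P =ᶠ[𝓝 p] fun z => τ z * R z := by
  classical
  obtain ⟨q, hq, hq_small⟩ := exists_norm_isNormalizedUnivalent_le_half hW
  choose F hF using fun p : Z => exists_isElementaryFactor hW (hZW p.2) (hq p (hZW p.2))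
    (hU.mem_nhds (hZU p.2)) hτ (hτ_zero p p.2) (hτ_det p p.2)
  have hlocal : ∀ z ∈ W, ∃ T : Finset Z, ∀ S, T ⊆ S →
      (fun w => ∏ᶠ p, F p w) =ᶠ[𝓝 z] fun w => ∏ p ∈ S, F p w := fun z hz => by
    obtain ⟨K, hK, hKW, hKc⟩ := local_compact_nhds (hW.mem_nhds hz)
    obtain ⟨C, hCW, hC, hCq⟩ := hq_small K hKW hKc
    have hfin := finite_inter_of_eventually_notMem hC fun p hp => hZ p (hCW hp)
    have hT : ((↑) ⁻¹' C : Set Z).Finite :=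
      (hfin.preimage Subtype.val_injective.injOn).subset fun p hp => ⟨p.2, hp⟩
    refine ⟨hT.toFinset, fun S hS => ?_⟩
    filter_upwards [hK] with w hw
    refine finprod_eq_prod_of_mulSupport_subset _ fun p hp => hS (hT.mem_toFinset.2 ?_)
    by_contra hpC
    exact hp ((hF p).eq_one w (hKW hw) (hCq p ⟨hZW p.2, hpC⟩ w hw))
  refine ⟨fun z => ∏ᶠ p, F p z, fun z hz => ?_, fun z hz hz0 => ?_, fun p hp => ?_⟩
  · obtain ⟨T, hT⟩ := hlocal z hz
    exact ((contDiffAt_prod fun p _ => (hF p).contDiffOn.contDiffAt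
      (hW.mem_nhds hz)).congr_of_eventuallyEq (hT T subset_rfl)).contDiffWithinAt
  · obtain ⟨T, hT⟩ := hlocal z hz
    obtain ⟨p, -, hp⟩ := Finset.prod_eq_zero_iff.1 ((hT T subset_rfl).self_of_nhds.symm.trans hz0)
    exact ((hF p).eq_zero_iff z hz).1 hp ▸ p.2
  · obtain ⟨T, hT⟩ := hlocal p (hZW hp)
    obtain ⟨c, hc, hFc⟩ := (hF ⟨p, hp⟩).eventuallyEq
    refine ⟨fun z => c * ∏ s ∈ T.erase ⟨p, hp⟩, F s z, ?_, ?_, ?_⟩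
    · exact contDiffAt_const.mul (contDiffAt_prod fun s _ =>
        (hF s).contDiffOn.contDiffAt (hW.mem_nhds (hZW hp)))
    · refine mul_ne_zero hc (Finset.prod_ne_zero_iff.2 fun s hs hs0 => ?_)
      exact Finset.ne_of_mem_erase hs (Subtype.ext (((hF s).eq_zero_iff p (hZW hp)).1 hs0).symm)
    · filter_upwards [hT (insert ⟨p, hp⟩ T) (Finset.subset_insert _ _), hFc] with z hz hcz
      rw [hz, ← Finset.mul_prod_erase _ _ (Finset.mem_insert_self _ _),
        Finset.erase_insert_eq_erase, hcz]
      ring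

theorem exists_smooth_extension_of_divisor {W U : Set ℂ} {τ : ℂ → ℂ} (hW : IsOpen W) (hU : IsOpen U)
    (hUW : U ⊆ W) (hτ : ContDiffOn ℝ ∞ τ U) (hτ_det : ∀ p ∈ U, τ p = 0 → (fderiv ℝ τ p).det ≠ 0)
    (hτ_off : ∀ p ∈ W \ U, ∀ᶠ z in 𝓝 p, z ∈ U → τ z ≠ 0) :
    ∃ P u : ℂ → ℂ, ContDiffOn ℝ ∞ P W ∧ ContDiffOn ℝ ∞ u U ∧ (∀ z ∈ U, u z ≠ 0) ∧
      (∀ z ∈ U, P z = τ z * u z) ∧ ∀ z ∈ W \ U, P z ≠ 0 := by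
  have hτ_iso : ∀ p ∈ U, ∀ᶠ z in 𝓝[≠] p, τ z ≠ 0 := fun p hp => by
    have hτp := hτ.contDiffAt (hU.mem_nhds hp)
    by_cases hp0 : τ p = 0
    · exact eventually_ne_of_det_fderiv_ne_zero (hτ_det p hp hp0) (hτp.differentiableAt (by simp)) 0
    · exact (hτp.continuousAt.eventually_ne hp0).filter_mono nhdsWithin_le_nhds
  have hZ_iso : ∀ p ∈ W, ∀ᶠ z in 𝓝[≠] p, z ∉ {z ∈ U | τ z = 0} := fun p hp => by
    by_cases hpU : p ∈ U
    · exact (hτ_iso p hpU).mono fun z hz hmem => hz hmem.2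
    · exact ((hτ_off p ⟨hp, hpU⟩).filter_mono nhdsWithin_le_nhds).mono
        fun z hz hmem => hz hmem.1 hmem.2
  obtain ⟨P, hP, hPZ, hPgerm⟩ := exists_smooth_prescribed_zeros hW hU hτ hZ_iso
    (fun z hz => hUW hz.1) (fun z hz => hz.1) (fun p hp => hp.2) fun p hp => hτ_det p hp.1 hp.2
  obtain ⟨u, hu, hu_ne, hPu⟩ := exists_contDiffOn_eq_mul hU hτ (hP.mono hUW) hτ_iso
    (fun z hz hτz hPz => hτz (hPZ z (hUW hz) hPz).2) fun p hp hp0 => hPgerm p ⟨hp, hp0⟩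
  exact ⟨P, u, hP, hu, hu_ne, hPu, fun z hz hPz => hz.2 (hPZ z hz.1 hPz).1⟩

end PrescribedZeros

section NonvanishingSection

variable {W : Set ℂ} {a b c d : ℂ → ℂ}

theorem isOpen_setOf_ne_zero_or_ne_zero {X : Type*} [TopologicalSpace X] {W : Set X} {a b : X → ℂ}
    (hW : IsOpen W) (ha : ContinuousOn a W) (hb : ContinuousOn b W) :
    IsOpen {z ∈ W | a z ≠ 0 ∨ b z ≠ 0} := by
  convert (ha.isOpen_inter_preimage hW isOpen_compl_singleton).union
    (hb.isOpen_inter_preimage hW (isOpen_compl_singleton (x := (0 : ℂ)))) using 1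
  exact Set.ext fun z => and_or_left

theorem mul_conj_add_mul_conj_ne_zero {v₁ v₂ : ℂ} (hv : v₁ ≠ 0 ∨ v₂ ≠ 0) :
    v₁ * conj v₁ + v₂ * conj v₂ ≠ 0 := by
  rw [Complex.mul_conj, Complex.mul_conj, ← Complex.ofReal_add, Complex.ofReal_ne_zero]
  have h₁ := Complex.normSq_nonneg v₁
  have h₂ := Complex.normSq_nonneg v₂
  rcases hv with hv | hv <;> linarith [Complex.normSq_pos.2 hv]

theorem exists_smooth_ratio (hW : IsOpen W) (ha : ContDiffOn ℝ ∞ a W) (hb : ContDiffOn ℝ ∞ b W)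
    (hc : ContDiffOn ℝ ∞ c W) (hd : ContDiffOn ℝ ∞ d W) (hdet : ∀ z ∈ W, a z * d z = b z * c z) :
    ∃ t : ℂ → ℂ, ContDiffOn ℝ ∞ t {z ∈ W | a z ≠ 0 ∨ b z ≠ 0} ∧
      ∀ z ∈ W, a z ≠ 0 ∨ b z ≠ 0 → c z = t z * a z ∧ d z = t z * b z := by
  have hconj {f : ℂ → ℂ} (hf : ContDiffOn ℝ ∞ f W) := contDiffOn_conj_comp hf
  refine ⟨fun z => (c z * conj (a z) + d z * conj (b z)) /
    (a z * conj (a z) + b z * conj (b z)), fun z hz => ?_, fun z hzW hz => ?_⟩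
  · have hzW := hW.mem_nhds hz.1
    exact (contDiffAt_complex_div
      (((hc.mul (hconj ha)).add (hd.mul (hconj hb))).contDiffAt hzW)
      (((ha.mul (hconj ha)).add (hb.mul (hconj hb))).contDiffAt hzW)
      (mul_conj_add_mul_conj_ne_zero hz.2)).contDiffWithinAt
  · constructor <;> rw [div_mul_eq_mul_div, eq_div_iff (mul_conj_add_mul_conj_ne_zero hz)]
    · linear_combination -conj (b z) * hdet z hzW
    · linear_combination conj (a z) * hdet z hzW

theorem exists_regular_ratio_sub (hW : IsOpen W) (ha : ContDiffOn ℝ ∞ a W)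
    (hb : ContDiffOn ℝ ∞ b W) (hc : ContDiffOn ℝ ∞ c W) (hd : ContDiffOn ℝ ∞ d W)
    (hdet : ∀ z ∈ W, a z * d z = b z * c z) :
    ∃ (κ : ℂ) (τ : ℂ → ℂ), ContDiffOn ℝ ∞ τ {z ∈ W | a z ≠ 0 ∨ b z ≠ 0} ∧
      ∀ z ∈ W, a z ≠ 0 ∨ b z ≠ 0 → c z - κ * a z = τ z * a z ∧ d z - κ * b z = τ z * b z ∧
        (τ z = 0 → (fderiv ℝ τ z).det ≠ 0) := by
  obtain ⟨t, ht, htab⟩ := exists_smooth_ratio hW ha hb hc hd hdet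
  have hU := isOpen_setOf_ne_zero_or_ne_zero hW ha.continuousOn hb.continuousOn
  obtain ⟨κ, hκ⟩ := exists_regular_value fun z hz => differentiableAt_of_contDiffOn_isOpen ht hU hz
  refine ⟨κ, fun z => t z - κ, ht.sub contDiffOn_const, fun z hzW hz => ?_⟩
  obtain ⟨hta, htb⟩ := htab z hzW hz
  refine ⟨by rw [hta]; ring, by rw [htb]; ring, fun hzero => ?_⟩
  rw [fderiv_sub_const]
  exact hκ z ⟨hzW, hz⟩ (sub_eq_zero.1 hzero)

theorem exists_nonvanishing_section_of_ratio {τ : ℂ → ℂ} (hW : IsOpen W) (ha : ContDiffOn ℝ ∞ a W)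
    (hb : ContDiffOn ℝ ∞ b W) (hc : ContDiffOn ℝ ∞ c W) (hd : ContDiffOn ℝ ∞ d W)
    (hτ : ContDiffOn ℝ ∞ τ {z ∈ W | a z ≠ 0 ∨ b z ≠ 0})
    (hratio : ∀ z ∈ W, a z ≠ 0 ∨ b z ≠ 0 → c z = τ z * a z ∧ d z = τ z * b z ∧
      (τ z = 0 → (fderiv ℝ τ z).det ≠ 0))
    (hne : ∀ z ∈ W, a z ≠ 0 ∨ b z ≠ 0 ∨ c z ≠ 0 ∨ d z ≠ 0) :
    ∃ v₁ v₂ : ℂ → ℂ, ContDiffOn ℝ ∞ v₁ W ∧ ContDiffOn ℝ ∞ v₂ W ∧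
      ∀ z ∈ W, (v₁ z ≠ 0 ∨ v₂ z ≠ 0) ∧ a z * v₂ z = b z * v₁ z ∧ c z * v₂ z = d z * v₁ z := by
  have hU := isOpen_setOf_ne_zero_or_ne_zero hW ha.continuousOn hb.continuousOn
  have hUW : {z ∈ W | a z ≠ 0 ∨ b z ≠ 0} ⊆ W := sep_subset _ _
  have hcd_ne : ∀ z ∈ W \ {z ∈ W | a z ≠ 0 ∨ b z ≠ 0}, c z ≠ 0 ∨ d z ≠ 0 := fun z hz => by
    by_contra! hcd
    rcases hne z hz.1 with h | h | h | h
    exacts [hz.2 ⟨hz.1, .inl h⟩, hz.2 ⟨hz.1, .inr h⟩, h hcd.1, h hcd.2]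
  have hτ_off : ∀ p ∈ W \ {z ∈ W | a z ≠ 0 ∨ b z ≠ 0},
      ∀ᶠ z in 𝓝 p, z ∈ {z ∈ W | a z ≠ 0 ∨ b z ≠ 0} → τ z ≠ 0 := fun p hp => by
    filter_upwards [(isOpen_setOf_ne_zero_or_ne_zero hW hc.continuousOn hd.continuousOn).mem_nhds
      ⟨hp.1, hcd_ne p hp⟩] with z hz hzU hτz
    obtain ⟨hcz, hdz, -⟩ := hratio z hz.1 hzU.2
    rw [hτz, zero_mul] at hcz hdz
    exact hz.2.elim (· hcz) (· hdz)
  obtain ⟨P, u, hP, hu, hu_ne, hPu, hP_ne⟩ := exists_smooth_extension_of_divisor hW hU hUW hτ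
    (fun z hz => (hratio z hz.1 hz.2).2.2) hτ_off
  obtain ⟨v₁, hv₁, hv₁u, hv₁P⟩ := exists_contDiffOn_mul_eq hU hW hc hP (ha.mono hUW) hu hu_ne hP_ne
    fun z hz => by rw [(hratio z hz.1 hz.2).1, hPu z hz]; ring
  obtain ⟨v₂, hv₂, hv₂u, hv₂P⟩ := exists_contDiffOn_mul_eq hU hW hd hP (hb.mono hUW) hu hu_ne hP_ne
    fun z hz => by rw [(hratio z hz.1 hz.2).2.1, hPu z hz]; ring
  refine ⟨v₁, v₂, hv₁, hv₂, fun z hz => ?_⟩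
  by_cases hab : a z ≠ 0 ∨ b z ≠ 0
  · obtain ⟨hcz, hdz, -⟩ := hratio z hz hab
    have haz := (hv₁u z ⟨hz, hab⟩).symm
    have hbz := (hv₂u z ⟨hz, hab⟩).symm
    rw [hcz, hdz, haz, hbz]
    rw [haz, hbz] at hab
    exact ⟨hab.imp left_ne_zero_of_mul left_ne_zero_of_mul, by ring, by ring⟩
  · have hcd := hcd_ne z ⟨hz, fun h => hab h.2⟩
    obtain ⟨haz, hbz⟩ : a z = 0 ∧ b z = 0 := by simpa only [not_or, not_not] using hab
    rw [← hv₁P z ⟨hz, fun h => hab h.2⟩, ← hv₂P z ⟨hz, fun h => hab h.2⟩] at hcd ⊢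
    exact ⟨hcd.imp left_ne_zero_of_mul left_ne_zero_of_mul, by rw [haz, hbz]; ring, by ring⟩

theorem exists_nonvanishing_section (hW : IsOpen W) (ha : ContDiffOn ℝ ∞ a W)
    (hb : ContDiffOn ℝ ∞ b W) (hc : ContDiffOn ℝ ∞ c W) (hd : ContDiffOn ℝ ∞ d W)
    (hdet : ∀ z ∈ W, a z * d z = b z * c z)
    (hne : ∀ z ∈ W, a z ≠ 0 ∨ b z ≠ 0 ∨ c z ≠ 0 ∨ d z ≠ 0) :
    ∃ v₁ v₂ : ℂ → ℂ, ContDiffOn ℝ ∞ v₁ W ∧ ContDiffOn ℝ ∞ v₂ W ∧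
      ∀ z ∈ W, (v₁ z ≠ 0 ∨ v₂ z ≠ 0) ∧ a z * v₂ z = b z * v₁ z ∧ c z * v₂ z = d z * v₁ z := by
  obtain ⟨κ, τ, hτ, hratio⟩ := exists_regular_ratio_sub hW ha hb hc hd hdet
  obtain ⟨v₁, v₂, hv₁, hv₂, hv⟩ := exists_nonvanishing_section_of_ratio hW ha hb
    (hc.sub (contDiffOn_const.mul ha)) (hd.sub (contDiffOn_const.mul hb)) hτ hratio fun z hz => by
      by_contra! hzero
      obtain ⟨haz, hbz, hcz, hdz⟩ := hzero
      rw [haz, mul_zero, sub_zero] at hcz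
      rw [hbz, mul_zero, sub_zero] at hdz
      exact (hne z hz).elim (· haz) (·.elim (· hbz) (·.elim (· hcz) (· hdz)))
  refine ⟨v₁, v₂, hv₁, hv₂, fun z hz => ?_⟩
  obtain ⟨hv_ne, hab, hcd⟩ := hv z hz
  exact ⟨hv_ne, hab, by linear_combination hcd + κ * hab⟩

end NonvanishingSection

/-! ### Spinors of a conformal immersion -/

section DiracFactorization

variable {W : Set ℂ} {z : ℂ}

theorem wirtDbar_wirtD_comm {f : ℂ → ℂ} (hf : ContDiffAt ℝ 2 f z) :
    wirtDbar (wirtD f) z = wirtD (wirtDbar f) z := by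
  have hD : DifferentiableAt ℝ (fderiv ℝ f) z :=
    (hf.fderiv_right (m := 1) (by norm_num)).differentiableAt (by simp)
  have hsymm : IsSymmSndFDerivAt ℝ f z := hf.isSymmSndFDerivAt (by simp)
  have hd (v : ℂ) : DifferentiableAt ℝ (fun y => fderiv ℝ f y v) z :=
    hD.clm_apply (differentiableAt_const v)
  have hfderiv (v w : ℂ) :
      fderiv ℝ (fun y => fderiv ℝ f y v) z w = fderiv ℝ (fderiv ℝ f) z w v := by
    rw [fderiv_clm_apply hD (differentiableAt_const v)]
    simp
  have hwirtD (w : ℂ) : fderiv ℝ (wirtD f) z w =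
      (fderiv ℝ (fderiv ℝ f) z w 1 - Complex.I * fderiv ℝ (fderiv ℝ f) z w Complex.I) / 2 := by
    have := (((hd 1).hasFDerivAt.sub ((hd Complex.I).hasFDerivAt.const_mul Complex.I)).mul_const
      (2⁻¹ : ℂ)).fderiv
    refine (congrArg (· w) this).trans ?_
    simp only [smul_apply, sub_apply, hfderiv, smul_eq_mul]
    ring
  have hwirtDbar (w : ℂ) : fderiv ℝ (wirtDbar f) z w =
      (fderiv ℝ (fderiv ℝ f) z w 1 + Complex.I * fderiv ℝ (fderiv ℝ f) z w Complex.I) / 2 := by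
    have := (((hd 1).hasFDerivAt.add ((hd Complex.I).hasFDerivAt.const_mul Complex.I)).mul_const
      (2⁻¹ : ℂ)).fderiv
    refine (congrArg (· w) this).trans ?_
    simp only [smul_apply, add_apply, hfderiv, smul_eq_mul]
    ring
  rw [wirtDbar, wirtD, hwirtD, hwirtD, hwirtDbar, hwirtDbar, hsymm 1 Complex.I]
  ring

theorem wirtDbar_eq_of_eqOn_mul (hW : IsOpen W) {f u v : ℂ → ℂ} (hu : ContDiffOn ℝ ∞ u W)
    (hv : ContDiffOn ℝ ∞ v W) (hf : EqOn f (fun y => u y * v y) W) (hz : z ∈ W) :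
    wirtDbar f z = wirtDbar u z * v z + u z * wirtDbar v z := by
  rw [wirtDbar_congr (hf.eventuallyEq_of_mem (hW.mem_nhds hz)),
    wirtDbar_mul (differentiableAt_of_contDiffOn_isOpen hu hW hz)
      (differentiableAt_of_contDiffOn_isOpen hv hW hz)]

theorem exists_rescaling_wirtDbar_orthogonal (hW : IsOpen W) {w₁ w₂ : ℂ → ℂ}
    (hw₁ : ContDiffOn ℝ ∞ w₁ W) (hw₂ : ContDiffOn ℝ ∞ w₂ W)
    (hne : ∀ z ∈ W, w₁ z ≠ 0 ∨ w₂ z ≠ 0) :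
    ∃ ρ : ℂ → ℂ, ContDiffOn ℝ ∞ ρ W ∧ (∀ z, ρ z ≠ 0) ∧ ∀ z ∈ W,
      wirtDbar (fun y => ρ y * w₁ y) z * conj (ρ z * w₁ z) +
        wirtDbar (fun y => ρ y * w₂ y) z * conj (ρ z * w₂ z) = 0 := by
  have hw₁_conj := contDiffOn_conj_comp hw₁
  have hw₂_conj := contDiffOn_conj_comp hw₂
  have hn_ne : ∀ z ∈ W, w₁ z * conj (w₁ z) + w₂ z * conj (w₂ z) ≠ 0 := fun z hz =>
    mul_conj_add_mul_conj_ne_zero (hne z hz)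
  have hg : ContDiffOn ℝ ∞ (fun z => -(wirtDbar w₁ z * conj (w₁ z) + wirtDbar w₂ z * conj (w₂ z)) *
      (w₁ z * conj (w₁ z) + w₂ z * conj (w₂ z))⁻¹) W :=
    (((contDiffOn_wirtDbar hw₁ hW).mul hw₁_conj).add
      ((contDiffOn_wirtDbar hw₂ hW).mul hw₂_conj)).neg.mul
      (((hw₁.mul hw₁_conj).add (hw₂.mul hw₂_conj)).inv hn_ne)
  obtain ⟨h, hh, hDbar⟩ := exists_wirtDbar_eq hW hg
  have hρ : ContDiffOn ℝ ∞ (fun z => Complex.exp (h z)) W := hh.cexp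
  refine ⟨fun z => Complex.exp (h z), hρ, fun z => Complex.exp_ne_zero _, fun z hz => ?_⟩
  rw [wirtDbar_eq_of_eqOn_mul hW hρ hw₁ (fun _ _ => rfl) hz,
    wirtDbar_eq_of_eqOn_mul hW hρ hw₂ (fun _ _ => rfl) hz,
    wirtDbar_cexp (differentiableAt_of_contDiffOn_isOpen hh hW hz), map_mul, map_mul]
  have hDbar_mul := congrArg (· * (w₁ z * conj (w₁ z) + w₂ z * conj (w₂ z))) (hDbar z hz)
  simp only [inv_mul_cancel_right₀ (hn_ne z hz)] at hDbar_mul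
  linear_combination (Complex.exp (h z) * conj (Complex.exp (h z))) * hDbar_mul

theorem exists_rescaling_dirac (hW : IsOpen W) {w₁ w₂ : ℂ → ℂ} (hw₁ : ContDiffOn ℝ ∞ w₁ W)
    (hw₂ : ContDiffOn ℝ ∞ w₂ W) (hne : ∀ z ∈ W, w₁ z ≠ 0 ∨ w₂ z ≠ 0) :
    ∃ ρ V : ℂ → ℂ, ContDiffOn ℝ ∞ ρ W ∧ ContDiffOn ℝ ∞ V W ∧ (∀ z, ρ z ≠ 0) ∧ ∀ z ∈ W,
      wirtDbar (fun y => ρ y * w₁ y) z = V z * conj (ρ z * w₂ z) ∧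
        wirtDbar (fun y => ρ y * w₂ y) z = -(V z * conj (ρ z * w₁ z)) := by
  obtain ⟨ρ, hρ, hρ_ne, horth⟩ := exists_rescaling_wirtDbar_orthogonal hW hw₁ hw₂ hne
  have hv₁ := hρ.mul hw₁
  have hv₂ := hρ.mul hw₂
  obtain ⟨V, hV, hVratio⟩ := exists_smooth_ratio hW (contDiffOn_conj_comp hv₂)
    (contDiffOn_conj_comp hv₁).neg (contDiffOn_wirtDbar hv₁ hW) (contDiffOn_wirtDbar hv₂ hW)
    fun z hz => by linear_combination horth z hz
  have hv_ne : ∀ z ∈ W, conj (ρ z * w₂ z) ≠ 0 ∨ -conj (ρ z * w₁ z) ≠ 0 := fun z hz => by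
    rw [neg_ne_zero, map_ne_zero, map_ne_zero]
    exact ((hne z hz).imp (mul_ne_zero (hρ_ne z)) (mul_ne_zero (hρ_ne z))).symm
  refine ⟨ρ, V, hρ, hV.mono fun z hz => ⟨hz, hv_ne z hz⟩, hρ_ne, fun z hz => ?_⟩
  obtain ⟨h₁, h₂⟩ := hVratio z hz (hv_ne z hz)
  exact ⟨h₁, h₂.trans (mul_neg _ _)⟩

theorem dual_dirac_of_dirac {u₁ u₂ v₁ v₂ V p q : ℂ} (hv : v₁ ≠ 0 ∨ v₂ ≠ 0)
    (h₁ : q * v₂ + u₂ * -(V * conj v₁) = -conj (p * v₁ + u₁ * (V * conj v₂)))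
    (h₂ : p * v₂ + u₁ * -(V * conj v₁) = conj (q * v₁ + u₂ * (V * conj v₂))) :
    p = conj V * conj u₂ ∧ q = -(conj V * conj u₁) := by
  have hn := mul_conj_add_mul_conj_ne_zero hv
  have h₁' := congrArg conj h₁
  have h₂' := congrArg conj h₂
  simp only [map_add, map_mul, map_neg, Complex.conj_conj] at h₁ h₂ h₁' h₂'
  constructor <;> refine mul_right_cancel₀ hn ?_
  · linear_combination conj v₂ * h₂ + conj v₁ * h₁'
  · linear_combination conj v₂ * h₁ - conj v₁ * h₂'

theorem diracOp_eq_zero_iff {U : ℂ → ℂ} {ψ : ℂ → Fin 2 → ℂ} : diracOp U ψ z = 0 ↔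
    wirtD (fun w => ψ w 1) z = -(U z * ψ z 0) ∧
      wirtDbar (fun w => ψ w 0) z = conj (U z) * ψ z 1 := by
  rw [diracOp, Matrix.cons_eq_zero_iff, Matrix.cons_eq_zero_iff, add_eq_zero_iff_eq_neg,
    neg_add_eq_zero]
  simp

theorem diracOpDual_eq_zero_iff {U : ℂ → ℂ} {φ : ℂ → Fin 2 → ℂ} : diracOpDual U φ z = 0 ↔
    wirtD (fun w => φ w 1) z = -(conj (U z) * φ z 0) ∧
      wirtDbar (fun w => φ w 0) z = U z * φ z 1 := by
  rw [diracOpDual, Matrix.cons_eq_zero_iff, Matrix.cons_eq_zero_iff, add_eq_zero_iff_eq_neg,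
    neg_add_eq_zero]
  simp

theorem exists_dirac_factorization (hW : IsOpen W) {a b c d : ℂ → ℂ}
    (ha : ContDiffOn ℝ ∞ a W) (hb : ContDiffOn ℝ ∞ b W) (hc : ContDiffOn ℝ ∞ c W)
    (hd : ContDiffOn ℝ ∞ d W) (hdet : ∀ z ∈ W, a z * d z = b z * c z)
    (hne : ∀ z ∈ W, a z ≠ 0 ∨ b z ≠ 0 ∨ c z ≠ 0 ∨ d z ≠ 0)
    (hda : ∀ z ∈ W, wirtDbar d z = -conj (wirtDbar a z))
    (hbc : ∀ z ∈ W, wirtDbar b z = conj (wirtDbar c z)) :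
    ∃ (ψ φ : ℂ → Fin 2 → ℂ) (U : ℂ → ℂ), ContDiffOn ℝ ∞ ψ W ∧ ContDiffOn ℝ ∞ φ W ∧
      ContDiffOn ℝ ∞ U W ∧ ∀ z ∈ W, diracOp U ψ z = 0 ∧ diracOpDual U φ z = 0 ∧
        a z = φ z 0 * ψ z 0 ∧ b z = φ z 0 * conj (ψ z 1) ∧
        c z = conj (φ z 1) * ψ z 0 ∧ d z = conj (φ z 1) * conj (ψ z 1) := by
  obtain ⟨w₁, w₂, hw₁, hw₂, hw⟩ := exists_nonvanishing_section hW ha hb hc hd hdet hne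
  obtain ⟨ρ, V, hρ, hV, hρ_ne, hdirac⟩ := exists_rescaling_dirac hW hw₁ hw₂ fun z hz => (hw z hz).1
  have hv₁ := hρ.mul hw₁
  have hv₂ := hρ.mul hw₂
  have hv_ne : ∀ z ∈ W, ρ z * w₁ z ≠ 0 ∨ ρ z * w₂ z ≠ 0 := fun z hz =>
    (hw z hz).1.imp (mul_ne_zero (hρ_ne z)) (mul_ne_zero (hρ_ne z))
  obtain ⟨u₁, hu₁, hab⟩ := exists_smooth_ratio hW hv₁ hv₂ ha hb fun z hz => by
    linear_combination -ρ z * (hw z hz).2.1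
  obtain ⟨u₂, hu₂, hcd⟩ := exists_smooth_ratio hW hv₁ hv₂ hc hd fun z hz => by
    linear_combination -ρ z * (hw z hz).2.2
  replace hu₁ : ContDiffOn ℝ ∞ u₁ W := hu₁.mono fun z hz => ⟨hz, hv_ne z hz⟩
  replace hu₂ : ContDiffOn ℝ ∞ u₂ W := hu₂.mono fun z hz => ⟨hz, hv_ne z hz⟩
  have hdual : ∀ z ∈ W, wirtDbar u₁ z = conj (V z) * conj (u₂ z) ∧
      wirtDbar u₂ z = -(conj (V z) * conj (u₁ z)) := fun z hz => by
    have hDa := wirtDbar_eq_of_eqOn_mul hW hu₁ hv₁ (fun y hy => (hab y hy (hv_ne y hy)).1) hz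
    have hDb := wirtDbar_eq_of_eqOn_mul hW hu₁ hv₂ (fun y hy => (hab y hy (hv_ne y hy)).2) hz
    have hDc := wirtDbar_eq_of_eqOn_mul hW hu₂ hv₁ (fun y hy => (hcd y hy (hv_ne y hy)).1) hz
    have hDd := wirtDbar_eq_of_eqOn_mul hW hu₂ hv₂ (fun y hy => (hcd y hy (hv_ne y hy)).2) hz
    rw [(hdirac z hz).1] at hDa hDc
    rw [(hdirac z hz).2] at hDb hDd
    exact dual_dirac_of_dirac (hv_ne z hz) (hDa ▸ hDd ▸ hda z hz) (hDb ▸ hDc ▸ hbc z hz)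
  refine ⟨fun z => ![ρ z * w₁ z, conj (ρ z * w₂ z)], fun z => ![u₁ z, conj (u₂ z)],
    fun z => conj (V z), ?_, ?_, contDiffOn_conj_comp hV, fun z hz => ⟨?_, ?_, ?_⟩⟩
  · exact contDiffOn_pi.2 (Fin.forall_fin_two.2 ⟨hv₁, contDiffOn_conj_comp hv₂⟩)
  · exact contDiffOn_pi.2 (Fin.forall_fin_two.2 ⟨hu₁, contDiffOn_conj_comp hu₂⟩)
  · rw [diracOp_eq_zero_iff]
    simp only [Matrix.cons_val_zero, Matrix.cons_val_one, Complex.conj_conj]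
    rw [wirtD_conj (differentiableAt_of_contDiffOn_isOpen hv₂ hW hz), (hdirac z hz).2]
    exact ⟨by simp, (hdirac z hz).1⟩
  · rw [diracOpDual_eq_zero_iff]
    simp only [Matrix.cons_val_zero, Matrix.cons_val_one, Complex.conj_conj]
    rw [wirtD_conj (differentiableAt_of_contDiffOn_isOpen hu₂ hW hz), (hdual z hz).2]
    exact ⟨by simp, (hdual z hz).1⟩
  · simpa only [Matrix.cons_val_zero, Matrix.cons_val_one, Complex.conj_conj, and_assoc] using
      And.intro (hab z hz (hv_ne z hz)) (hcd z hz (hv_ne z hz))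

end DiracFactorization

section NullVectors

variable {W : Set ℂ} {z : ℂ}

/-- The vector of `ℂ⁴` with matrix `(a, b; c, d)`, in coordinates where `x₁² + x₂² + x₃² + x₄²` is
the quadratic form `bc - ad`: null vectors are the matrices of rank at most one, and the
Weierstrass coefficients come from `(φ₁, φ̄₂)ᵀ (ψ₁, ψ̄₂)`. -/
noncomputable def matrixCoord (a b c d : ℂ) : Fin 4 → ℂ :=
  ![Complex.I / 2 * (d + a), 1 / 2 * (d - a), 1 / 2 * (c + b), Complex.I / 2 * (c - b)]

theorem weierstrassCoeff_eq_matrixCoord (ψ φ : ℂ → Fin 2 → ℂ) (z : ℂ) :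
    weierstrassCoeff ψ φ z = matrixCoord (φ z 0 * ψ z 0) (φ z 0 * conj (ψ z 1))
      (conj (φ z 1) * ψ z 0) (conj (φ z 1) * conj (ψ z 1)) :=
  rfl

theorem matrixCoord_eq_self (x : Fin 4 → ℂ) :
    matrixCoord (-(x 1 + Complex.I * x 0)) (x 2 + Complex.I * x 3) (x 2 - Complex.I * x 3)
      (x 1 - Complex.I * x 0) = x := by
  ext k
  fin_cases k <;> simp only [matrixCoord, Fin.reduceFinMk, Matrix.cons_val]
  · linear_combination -x 0 * Complex.I_sq
  · ring
  · ring
  · linear_combination -x 3 * Complex.I_sq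

theorem sum_norm_sq_matrixCoord (a b c d : ℂ) :
    ∑ k, ‖matrixCoord a b c d k‖ ^ 2 = (‖a‖ ^ 2 + ‖b‖ ^ 2 + ‖c‖ ^ 2 + ‖d‖ ^ 2) / 2 := by
  have h₁ := parallelogram_law_with_norm ℝ d a
  have h₂ := parallelogram_law_with_norm ℝ c b
  simp only [Fin.sum_univ_four, matrixCoord, Matrix.cons_val, norm_mul, norm_div, Complex.norm_I,
    norm_one, Complex.norm_ofNat]
  linear_combination h₁ / 4 + h₂ / 4

theorem wirtDbar_matrixCoord {a b c d : ℂ → ℂ} (ha : DifferentiableAt ℝ a z)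
    (hb : DifferentiableAt ℝ b z) (hc : DifferentiableAt ℝ c z) (hd : DifferentiableAt ℝ d z)
    (k : Fin 4) : wirtDbar (fun w => matrixCoord (a w) (b w) (c w) (d w) k) z =
      matrixCoord (wirtDbar a z) (wirtDbar b z) (wirtDbar c z) (wirtDbar d z) k := by
  fin_cases k <;> simp only [matrixCoord, Fin.reduceFinMk, Matrix.cons_val]
  · rw [wirtDbar_const_mul _ (hd.fun_add ha), wirtDbar_add hd ha]
  · rw [wirtDbar_const_mul _ (hd.fun_sub ha), wirtDbar_sub hd ha]
  · rw [wirtDbar_const_mul _ (hc.fun_add hb), wirtDbar_add hc hb]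
  · rw [wirtDbar_const_mul _ (hc.fun_sub hb), wirtDbar_sub hc hb]

theorem sum_norm_sq_weierstrassCoeff (ψ φ : ℂ → Fin 2 → ℂ) (z : ℂ) :
    ∑ k, ‖weierstrassCoeff ψ φ z k‖ ^ 2 =
      (‖ψ z 0‖ ^ 2 + ‖ψ z 1‖ ^ 2) * (‖φ z 0‖ ^ 2 + ‖φ z 1‖ ^ 2) / 2 := by
  rw [weierstrassCoeff_eq_matrixCoord, sum_norm_sq_matrixCoord]
  simp only [norm_mul, RCLike.norm_conj]
  ring

theorem norm_sq_add_norm_sq_spinor (s t u v : ℂ) :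
    ‖s * u + t * v‖ ^ 2 + ‖s * conj v - t * conj u‖ ^ 2 =
      (‖s‖ ^ 2 + ‖t‖ ^ 2) * (‖u‖ ^ 2 + ‖v‖ ^ 2) := by
  apply Complex.ofReal_injective
  push_cast
  simp only [← Complex.mul_conj', map_add, map_sub, map_mul, Complex.conj_conj]
  ring

theorem sum_norm_sq_wirtDbar_weierstrassCoeff {ψ φ : ℂ → Fin 2 → ℂ} {U : ℂ → ℂ}
    (hψ : DifferentiableAt ℝ ψ z) (hφ : DifferentiableAt ℝ φ z) (hdirac : diracOp U ψ z = 0)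
    (hdual : diracOpDual U φ z = 0) :
    ∑ k, ‖wirtDbar (fun w => weierstrassCoeff ψ φ w k) z‖ ^ 2 =
      ‖U z‖ ^ 2 * ((‖ψ z 0‖ ^ 2 + ‖ψ z 1‖ ^ 2) * (‖φ z 0‖ ^ 2 + ‖φ z 1‖ ^ 2)) := by
  have hψ₀ := differentiableAt_pi.1 hψ 0
  have hψ₁ := differentiableAt_pi.1 hψ 1
  have hφ₀ := differentiableAt_pi.1 hφ 0
  have hφ₁ := differentiableAt_pi.1 hφ 1
  have hψ₁_conj : DifferentiableAt ℝ (fun w => conj (ψ w 1)) z := hψ₁.star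
  have hφ₁_conj : DifferentiableAt ℝ (fun w => conj (φ w 1)) z := hφ₁.star
  obtain ⟨hD_ψ, hDbar_ψ⟩ := diracOp_eq_zero_iff.1 hdirac
  obtain ⟨hD_φ, hDbar_φ⟩ := diracOpDual_eq_zero_iff.1 hdual
  have h₁ := norm_sq_add_norm_sq_spinor (U z * φ z 1) (φ z 0 * conj (U z)) (ψ z 0) (ψ z 1)
  have h₂ := norm_sq_add_norm_sq_spinor (-(U z * conj (φ z 0))) (conj (φ z 1) * conj (U z))
    (ψ z 0) (ψ z 1)
  simp only [norm_mul, norm_neg, RCLike.norm_conj] at h₁ h₂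
  simp only [weierstrassCoeff_eq_matrixCoord]
  simp only [wirtDbar_matrixCoord (hφ₀.fun_mul hψ₀) (hφ₀.fun_mul hψ₁_conj)
    (hφ₁_conj.fun_mul hψ₀) (hφ₁_conj.fun_mul hψ₁_conj), sum_norm_sq_matrixCoord,
    wirtDbar_mul hφ₀ hψ₀, wirtDbar_mul hφ₀ hψ₁_conj, wirtDbar_mul hφ₁_conj hψ₀,
    wirtDbar_mul hφ₁_conj hψ₁_conj, wirtDbar_conj hψ₁, wirtDbar_conj hφ₁, hD_ψ, hDbar_ψ, hD_φ,
    hDbar_φ, map_neg, map_mul, Complex.conj_conj, mul_neg, ← sub_eq_add_neg, ← mul_assoc]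
  linear_combination h₁ / 2 + h₂ / 2

theorem exists_weierstrassCoeff_eq (hW : IsOpen W) {f : ℂ → Fin 4 → ℂ}
    (hf : ContDiffOn ℝ ∞ f W) (hnull : ∀ z ∈ W, ∑ k, f z k ^ 2 = 0) (hne : ∀ z ∈ W, f z ≠ 0)
    (hreal : ∀ z ∈ W, ∀ k, conj (wirtDbar (fun w => f w k) z) = wirtDbar (fun w => f w k) z) :
    ∃ (ψ φ : ℂ → Fin 2 → ℂ) (U : ℂ → ℂ), ContDiffOn ℝ ∞ ψ W ∧ ContDiffOn ℝ ∞ φ W ∧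
      ContDiffOn ℝ ∞ U W ∧ ∀ z ∈ W, diracOp U ψ z = 0 ∧ diracOpDual U φ z = 0 ∧
        weierstrassCoeff ψ φ z = f z := by
  have hf_coord (k : Fin 4) : ContDiffOn ℝ ∞ (fun w => f w k) W := contDiffOn_pi.1 hf k
  have hdiff (k : Fin 4) {z : ℂ} (hz : z ∈ W) : DifferentiableAt ℝ (fun w => f w k) z :=
    differentiableAt_of_contDiffOn_isOpen (hf_coord k) hW hz
  have hI_mul (k : Fin 4) : ContDiffOn ℝ ∞ (fun w => Complex.I * f w k) W :=
    contDiffOn_const.mul (hf_coord k)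
  have hDbar_add (j k : Fin 4) {z : ℂ} (hz : z ∈ W) :
      wirtDbar (fun w => f w j + Complex.I * f w k) z =
        wirtDbar (fun w => f w j) z + Complex.I * wirtDbar (fun w => f w k) z := by
    rw [wirtDbar_add (hdiff j hz) ((hdiff k hz).const_mul _), wirtDbar_const_mul _ (hdiff k hz)]
  have hDbar_sub (j k : Fin 4) {z : ℂ} (hz : z ∈ W) :
      wirtDbar (fun w => f w j - Complex.I * f w k) z =
        wirtDbar (fun w => f w j) z - Complex.I * wirtDbar (fun w => f w k) z := by
    rw [wirtDbar_sub (hdiff j hz) ((hdiff k hz).const_mul _), wirtDbar_const_mul _ (hdiff k hz)]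
  obtain ⟨ψ, φ, U, hψ, hφ, hU, hfactor⟩ := exists_dirac_factorization hW
    (a := fun z => -(f z 1 + Complex.I * f z 0)) (b := fun z => f z 2 + Complex.I * f z 3)
    (c := fun z => f z 2 - Complex.I * f z 3) (d := fun z => f z 1 - Complex.I * f z 0)
    ((hf_coord 1).add (hI_mul 0)).neg ((hf_coord 2).add (hI_mul 3))
    ((hf_coord 2).sub (hI_mul 3)) ((hf_coord 1).sub (hI_mul 0))
    (fun z hz => by
      have hsum := hnull z hz
      rw [Fin.sum_univ_four] at hsum
      linear_combination -hsum + (f z 0 ^ 2 + f z 3 ^ 2) * Complex.I_sq)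
    (fun z hz => by
      by_contra! hzero
      obtain ⟨ha, hb, hc, hd⟩ := hzero
      refine hne z hz ?_
      rw [← matrixCoord_eq_self (f z), ha, hb, hc, hd]
      ext k
      fin_cases k <;> simp [matrixCoord])
    (fun z hz => by
      rw [hDbar_sub 1 0 hz, wirtDbar_neg, hDbar_add 1 0 hz]
      simp only [map_neg, map_add, map_mul, Complex.conj_I, hreal z hz]
      ring)
    (fun z hz => by
      rw [hDbar_add 2 3 hz, hDbar_sub 2 3 hz]
      simp only [map_sub, map_mul, Complex.conj_I, hreal z hz]
      ring)
  refine ⟨ψ, φ, U, hψ, hφ, hU, fun z hz => ?_⟩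
  obtain ⟨hdirac, hdual, ha, hb, hc, hd⟩ := hfactor z hz
  refine ⟨hdirac, hdual, ?_⟩
  rw [weierstrassCoeff_eq_matrixCoord, ← ha, ← hb, ← hc, ← hd, matrixCoord_eq_self]

end NullVectors

section ConformalImmersion

variable {W : Set ℂ} {X : ℂ → EuclideanSpace ℝ (Fin 4)} {z : ℂ}

theorem contDiffOn_coord_complex (hX : ContDiffOn ℝ ∞ X W) (k : Fin 4) :
    ContDiffOn ℝ ∞ (fun w => ((X w k : ℝ) : ℂ)) W :=
  Complex.ofRealCLM.contDiff.comp_contDiffOn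
    ((EuclideanSpace.proj (𝕜 := ℝ) k).contDiff.comp_contDiffOn hX)

theorem fderiv_coord_complex (hX : DifferentiableAt ℝ X z) (k : Fin 4) (v : ℂ) :
    fderiv ℝ (fun w => ((X w k : ℝ) : ℂ)) z v = ((fderiv ℝ X z v k : ℝ) : ℂ) :=
  congrArg (· v) (Complex.ofRealCLM.hasFDerivAt.comp z
    ((EuclideanSpace.proj (𝕜 := ℝ) k).hasFDerivAt.comp z hX.hasFDerivAt)).fderiv

theorem wirtDbar_ofReal {x : ℂ → ℝ} (hx : DifferentiableAt ℝ (fun w => (x w : ℂ)) z) :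
    wirtDbar (fun w => (x w : ℂ)) z = conj (wirtD (fun w => (x w : ℂ)) z) := by
  simpa only [Complex.conj_ofReal] using wirtDbar_conj hx

theorem conj_wirtDbar_wirtD_ofReal (hW : IsOpen W) {x : ℂ → ℝ}
    (hx : ContDiffOn ℝ ∞ (fun w => (x w : ℂ)) W) (hz : z ∈ W) :
    conj (wirtDbar (wirtD fun w => (x w : ℂ)) z) = wirtDbar (wirtD fun w => (x w : ℂ)) z := by
  have hx₂ : ContDiffAt ℝ 2 (fun w => (x w : ℂ)) z :=
    contDiffAt_infty.1 (hx.contDiffAt (hW.mem_nhds hz)) 2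
  rw [← wirtD_conj (differentiableAt_of_contDiffOn_isOpen (contDiffOn_wirtD hx hW) hW hz),
    wirtDbar_wirtD_comm hx₂]
  refine wirtD_congr (Filter.eventuallyEq_of_mem (hW.mem_nhds hz) fun w hw => ?_)
  exact (wirtDbar_ofReal (differentiableAt_of_contDiffOn_isOpen hx hW hw)).symm

theorem conformalFactor_pos (hX : ConformalAt X z) : 0 < conformalFactor X z := by
  obtain ⟨c, hc, hinner⟩ := conformalAt_iff'.1 hX
  rw [conformalFactor, ← real_inner_self_eq_norm_sq, hinner]
  simpa using hc

theorem sum_fderiv_coord_mul_of_conformalAt (hX : ConformalAt X z) (v w : ℂ) :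
    ∑ k, fderiv ℝ X z v k * fderiv ℝ X z w k = conformalFactor X z * inner ℝ v w := by
  obtain ⟨c, -, hinner⟩ := conformalAt_iff'.1 hX
  have hc : conformalFactor X z = c := by
    rw [conformalFactor, ← real_inner_self_eq_norm_sq, hinner]
    simp
  rw [hc, ← hinner, PiLp.inner_apply]
  exact Finset.sum_congr rfl fun k _ => mul_comm _ _

theorem sum_wirtD_coord_sq_eq_zero (hX : ConformalAt X z) :
    ∑ k, wirtD (fun w => ((X w k : ℝ) : ℂ)) z ^ 2 = 0 := by
  have hsq (s t : ℝ) : ((s - Complex.I * t) / 2) ^ 2 =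
      (((s * s - t * t : ℝ) : ℂ) - 2 * Complex.I * ((s * t : ℝ) : ℂ)) / 4 := by
    push_cast
    linear_combination (t ^ 2 / 4 : ℂ) * Complex.I_sq
  simp only [wirtD, fderiv_coord_complex hX.differentiableAt, hsq, ← Finset.sum_div,
    Finset.sum_sub_distrib, ← Finset.mul_sum, ← Complex.ofReal_sum,
    sum_fderiv_coord_mul_of_conformalAt hX]
  simp

theorem sum_norm_sq_wirtD_coord (hX : ConformalAt X z) :
    ∑ k, ‖wirtD (fun w => ((X w k : ℝ) : ℂ)) z‖ ^ 2 = conformalFactor X z / 2 := by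
  have hnorm_sq (s t : ℝ) : ‖((s : ℂ) - Complex.I * t) / 2‖ ^ 2 = (s * s + t * t) / 4 := by
    rw [← Complex.normSq_eq_norm_sq, Complex.normSq_div, Complex.normSq_apply]
    norm_num
  simp only [wirtD, fderiv_coord_complex hX.differentiableAt, hnorm_sq, ← Finset.sum_div,
    Finset.sum_add_distrib, sum_fderiv_coord_mul_of_conformalAt hX]
  simp
  ring

theorem curveIntegral_eq_sub_of_fderiv {E F : Type*} [NormedAddCommGroup E] [NormedSpace ℝ E]
    [NormedAddCommGroup F] [NormedSpace ℝ F] [CompleteSpace F] {s : Set E} {f : E → F}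
    {η : E → E →L[ℝ] F} (hf : ∀ x ∈ s, HasFDerivAt f (η x) x) (hη : ContinuousOn η s) {a b : E}
    (γ : Path a b) (hγs : ∀ t, γ t ∈ s) (hγ : ContDiffOn ℝ 1 γ.extend (Icc 0 1)) :
    curveIntegral η γ = f b - f a := by
  have hγ_extend_mem (t : ℝ) : γ.extend t ∈ s := hγs _
  have hderiv (t : ℝ) (ht : t ∈ Ioo (0 : ℝ) 1) :
      HasDerivAt (fun t => f (γ.extend t)) (curveIntegralFun η γ t) t := by
    have hγ' : HasDerivAt γ.extend (derivWithin γ.extend (Icc 0 1) t) t :=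
      (hγ.differentiableOn one_ne_zero t (Ioo_subset_Icc_self ht)).hasDerivWithinAt.hasDerivAt
        (Icc_mem_nhds ht.1 ht.2)
    rw [curveIntegralFun_def]
    exact (hf _ (hγ_extend_mem t)).comp_hasDerivAt t hγ'
  have hcont : ContinuousOn (fun t => f (γ.extend t)) (Icc 0 1) := fun t ht =>
    (hf _ (hγ_extend_mem t)).continuousAt.comp_continuousWithinAt (hγ.continuousOn t ht)
  rw [curveIntegral_def, intervalIntegral.integral_eq_sub_of_hasDerivAt_of_le zero_le_one hcont
    hderiv (hη.curveIntegrable_of_contDiffOn hγ hγs), γ.extend_one, γ.extend_zero]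

theorem isWeierstrassRepresentation_of_wirtD_eq (hW : IsOpen W) (hX : ContDiffOn ℝ ∞ X W)
    {ψ φ : ℂ → Fin 2 → ℂ} {U : ℂ → ℂ} (hψ : ContDiffOn ℝ ∞ ψ W) (hφ : ContDiffOn ℝ ∞ φ W)
    (hU : ContDiffOn ℝ ∞ U W) (hdirac : ∀ z ∈ W, diracOp U ψ z = 0)
    (hdual : ∀ z ∈ W, diracOpDual U φ z = 0)
    (hcoeff : ∀ z ∈ W, ∀ k, weierstrassCoeff ψ φ z k = wirtD (fun w => ((X w k : ℝ) : ℂ)) z) :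
    IsWeierstrassRepresentation W X ψ φ U where
  smooth_psi := hψ
  smooth_phi := hφ
  smooth_potential := hU
  dirac := hdirac
  dirac_dual := hdual
  integral a b γ hγW hγ k := by
    have hx := contDiffOn_coord_complex hX k
    have hdiff : ∀ z ∈ W, DifferentiableAt ℝ (fun w => ((X w k : ℝ) : ℂ)) z := fun z hz =>
      differentiableAt_of_contDiffOn_isOpen hx hW hz
    have hform : ∀ z ∈ W,
        weierstrassForm ψ φ k z = fderiv ℝ (fun w => ((X w k : ℝ) : ℂ)) z := fun z hz => by
      ext v
      rw [fderiv_apply_eq_wirtD, wirtDbar_ofReal (hdiff z hz), ← hcoeff z hz]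
      simp [weierstrassForm]
    rw [curveIntegral_eq_sub_of_fderiv (fun z hz => hform z hz ▸ (hdiff z hz).hasFDerivAt)
      ((hx.continuousOn_fderiv_of_isOpen hW (by simp)).congr hform) γ hγW hγ]
    ring

theorem norm_sq_meanCurvatureVector (X : ℂ → EuclideanSpace ℝ (Fin 4)) (z : ℂ) :
    ‖meanCurvatureVector X z‖ ^ 2 =
      4 * (∑ k, ‖wirtD (wirtDbar fun w => ((X w k : ℝ) : ℂ)) z‖ ^ 2) / conformalFactor X z ^ 2 := by
  rw [EuclideanSpace.norm_sq_eq, Finset.mul_sum, Finset.sum_div]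
  refine Finset.sum_congr rfl fun k _ => ?_
  rw [meanCurvatureVector, norm_div, norm_mul, Complex.norm_ofNat, Complex.norm_real, div_pow,
    mul_pow, Real.norm_eq_abs, sq_abs]
  norm_num

theorem exists_weierstrassRepresentation (hW : IsOpen W) (hX : ContDiffOn ℝ ∞ X W)
    (hconf : ∀ z ∈ W, ConformalAt X z) :
    ∃ (ψ φ : ℂ → Fin 2 → ℂ) (U : ℂ → ℂ),
      IsWeierstrassRepresentation W X ψ φ U ∧
      (∀ z ∈ W, conformalFactor X z =
        (‖ψ z 0‖ ^ 2 + ‖ψ z 1‖ ^ 2) * (‖φ z 0‖ ^ 2 + ‖φ z 1‖ ^ 2)) ∧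
      ∀ z ∈ W, ‖U z‖ = ‖meanCurvatureVector X z‖ * Real.sqrt (conformalFactor X z) / 2 := by
  have hx := contDiffOn_coord_complex hX
  obtain ⟨ψ, φ, U, hψ, hφ, hU, hspinor⟩ := exists_weierstrassCoeff_eq hW
    (f := fun z k => wirtD (fun w => ((X w k : ℝ) : ℂ)) z)
    (contDiffOn_pi.2 fun k => contDiffOn_wirtD (hx k) hW)
    (fun z hz => sum_wirtD_coord_sq_eq_zero (hconf z hz))
    (fun z hz hzero => by
      have hsum := sum_norm_sq_wirtD_coord (hconf z hz)
      simp only [funext_iff, Pi.zero_apply] at hzero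
      have hpos := conformalFactor_pos (hconf z hz)
      simp only [hzero, norm_zero] at hsum
      norm_num at hsum
      linarith)
    (fun z hz k => conj_wirtDbar_wirtD_ofReal hW (hx k) hz)
  choose! hdirac hdual hcoeff using hspinor
  have hfactor : ∀ z ∈ W, conformalFactor X z =
      (‖ψ z 0‖ ^ 2 + ‖ψ z 1‖ ^ 2) * (‖φ z 0‖ ^ 2 + ‖φ z 1‖ ^ 2) := fun z hz => by
    have hsum := sum_norm_sq_weierstrassCoeff ψ φ z
    rw [hcoeff z hz, sum_norm_sq_wirtD_coord (hconf z hz)] at hsum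
    linarith
  refine ⟨ψ, φ, U, isWeierstrassRepresentation_of_wirtD_eq hW hX hψ hφ hU hdirac hdual
    fun z hz k => congrFun (hcoeff z hz) k, hfactor, fun z hz => ?_⟩
  have hpos := conformalFactor_pos (hconf z hz)
  have hcurv : ∑ k, ‖wirtD (wirtDbar fun w => ((X w k : ℝ) : ℂ)) z‖ ^ 2 =
      ‖U z‖ ^ 2 * conformalFactor X z := by
    rw [hfactor z hz, ← sum_norm_sq_wirtDbar_weierstrassCoeff
      (differentiableAt_of_contDiffOn_isOpen hψ hW hz)
      (differentiableAt_of_contDiffOn_isOpen hφ hW hz) (hdirac z hz) (hdual z hz)]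
    refine Finset.sum_congr rfl fun k _ => ?_
    have hcoeff_k : (fun w => weierstrassCoeff ψ φ w k) =ᶠ[𝓝 z]
        wirtD fun w => ((X w k : ℝ) : ℂ) :=
      Filter.eventuallyEq_of_mem (hW.mem_nhds hz) fun w hw => congrFun (hcoeff w hw) k
    rw [wirtDbar_congr hcoeff_k,
      wirtDbar_wirtD_comm (contDiffAt_infty.1 ((hx k).contDiffAt (hW.mem_nhds hz)) 2)]
  have hnorm_sq : ‖U z‖ ^ 2 =
      (‖meanCurvatureVector X z‖ * Real.sqrt (conformalFactor X z) / 2) ^ 2 := by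
    rw [div_pow, mul_pow, Real.sq_sqrt hpos.le, norm_sq_meanCurvatureVector, hcurv]
    field_simp
    norm_num
  exact (sq_eq_sq₀ (norm_nonneg _) (by positivity)).1 hnorm_sq

end ConformalImmersion

/-! ### Fourier series of functions supported in the unit square -/

section PlaneWaves

open MeasureTheory

/-- The exponential `x + iy ↦ exp (2πi (n₀ x + n₁ y))` of the square lattice. -/
noncomputable def planeWave (n : Fin 2 → ℤ) (z : ℂ) : ℂ :=
  Complex.exp (2 * Real.pi * Complex.I * (n 0 * z.re + n 1 * z.im))

/-- The Fourier coefficients with respect to `planeWave`. The integral is over the whole plane, so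
they belong to the Fourier series only of a function supported in the square `|x|, |y| ≤ 1/2`. -/
noncomputable def planeCoeff (g : ℂ → ℂ) (n : Fin 2 → ℤ) : ℂ := ∫ z, g z * planeWave (-n) z

/-- The symbol of `∂/∂z̄`, that is its eigenvalue on `planeWave n`. -/
noncomputable def dbarSymbol (n : Fin 2 → ℤ) : ℂ := Real.pi * Complex.I * (n 0 + Complex.I * n 1)

/-- The symbol of `∂/∂z`, that is its eigenvalue on `planeWave n`. -/
noncomputable def dSymbol (n : Fin 2 → ℤ) : ℂ := Real.pi * Complex.I * (n 0 - Complex.I * n 1)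

theorem norm_planeWave (n : Fin 2 → ℤ) (z : ℂ) : ‖planeWave n z‖ = 1 := by
  have hphase : 2 * Real.pi * Complex.I * (n 0 * z.re + n 1 * z.im) =
      ((2 * Real.pi * (n 0 * z.re + n 1 * z.im) : ℝ) : ℂ) * Complex.I := by push_cast; ring
  rw [planeWave, hphase, Complex.norm_exp_ofReal_mul_I]

theorem planeWave_add (m n : Fin 2 → ℤ) (z : ℂ) :
    planeWave (m + n) z = planeWave m z * planeWave n z := by
  simp only [planeWave, ← Complex.exp_add, Pi.add_apply]
  congr 1
  push_cast
  ring

theorem hasFDerivAt_planeWave (n : Fin 2 → ℤ) (z : ℂ) :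
    HasFDerivAt (planeWave n) ((dSymbol n * planeWave n z) • ContinuousLinearMap.id ℝ ℂ +
      (dbarSymbol n * planeWave n z) • Complex.conjCLE.toContinuousLinearMap) z := by
  have hphase : HasFDerivAt (fun z : ℂ => 2 * Real.pi * Complex.I * (n 0 * z.re + n 1 * z.im))
      ((2 * Real.pi * Complex.I : ℂ) • ((n 0 : ℂ) • (Complex.ofRealCLM.comp Complex.reCLM) +
        (n 1 : ℂ) • (Complex.ofRealCLM.comp Complex.imCLM))) z :=
    (((Complex.ofRealCLM.comp Complex.reCLM).hasFDerivAt.const_mul _).add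
      ((Complex.ofRealCLM.comp Complex.imCLM).hasFDerivAt.const_mul _)).const_mul _
  refine hphase.cexp.congr_fderiv (ContinuousLinearMap.ext fun v => ?_)
  simp only [smul_apply, add_apply, ContinuousLinearMap.comp_apply, Complex.reCLM_apply,
    Complex.imCLM_apply, Complex.ofRealCLM_apply, smul_eq_mul, ContinuousLinearMap.id_apply,
    ContinuousLinearEquiv.coe_coe, Complex.conjCLE_apply, planeWave, dSymbol, dbarSymbol]
  generalize Complex.exp (2 * Real.pi * Complex.I * (n 0 * z.re + n 1 * z.im)) = E
  rw [Complex.re_eq_add_conj, Complex.im_eq_sub_conj]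
  field_simp
  linear_combination (E * v * n 1 - E * conj v * n 1) * Complex.I_sq

theorem contDiff_planeWave (n : Fin 2 → ℤ) : ContDiff ℝ ∞ (planeWave n) := by
  have hphase : ContDiff ℝ ∞ fun z : ℂ => 2 * Real.pi * Complex.I * (n 0 * z.re + n 1 * z.im) :=
    contDiff_const.mul ((contDiff_const.mul (Complex.ofRealCLM.comp Complex.reCLM).contDiff).add
      (contDiff_const.mul (Complex.ofRealCLM.comp Complex.imCLM).contDiff))
  exact hphase.cexp

theorem continuous_planeWave (n : Fin 2 → ℤ) : Continuous (planeWave n) :=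
  (contDiff_planeWave n).continuous

theorem wirtDbar_planeWave (n : Fin 2 → ℤ) (z : ℂ) :
    wirtDbar (planeWave n) z = dbarSymbol n * planeWave n z :=
  wirtDbar_eq_of_fderiv fun v => by rw [(hasFDerivAt_planeWave n z).fderiv]; rfl

theorem dbarSymbol_neg (n : Fin 2 → ℤ) : dbarSymbol (-n) = -dbarSymbol n := by
  simp only [dbarSymbol, Pi.neg_apply, Int.cast_neg]
  ring

theorem norm_dbarSymbol (n : Fin 2 → ℤ) :
    ‖dbarSymbol n‖ = Real.pi * ‖(n 0 + Complex.I * n 1 : ℂ)‖ := by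
  rw [dbarSymbol, norm_mul, norm_mul, Complex.norm_I, Complex.norm_real,
    Real.norm_of_nonneg Real.pi_pos.le, mul_one]

theorem norm_dSymbol (n : Fin 2 → ℤ) : ‖dSymbol n‖ = ‖dbarSymbol n‖ := by
  have hconj : dbarSymbol n = -conj (dSymbol n) := by
    simp [dbarSymbol, dSymbol]
  rw [hconj, norm_neg, RCLike.norm_conj]

theorem norm_le_norm_dbarSymbol (n : Fin 2 → ℤ) : ‖n‖ ≤ ‖dbarSymbol n‖ := by
  have hn : ‖n‖ ≤ ‖(n 0 + Complex.I * n 1 : ℂ)‖ := by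
    refine (pi_norm_le_iff_of_nonneg (norm_nonneg _)).2 (Fin.forall_fin_two.2 ⟨?_, ?_⟩)
    · simpa [Int.norm_eq_abs] using Complex.abs_re_le_norm (n 0 + Complex.I * n 1)
    · simpa [Int.norm_eq_abs] using Complex.abs_im_le_norm (n 0 + Complex.I * n 1)
  rw [norm_dbarSymbol]
  nlinarith [Real.pi_gt_three, norm_nonneg (n 0 + Complex.I * n 1 : ℂ)]

theorem norm_dbarSymbol_le (n : Fin 2 → ℤ) : ‖dbarSymbol n‖ ≤ 8 * ‖n‖ := by
  have hn : ‖(n 0 + Complex.I * n 1 : ℂ)‖ ≤ ‖n‖ + ‖n‖ := by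
    refine (norm_add_le _ _).trans (add_le_add ?_ ?_)
    · simpa [Complex.norm_intCast, Int.norm_eq_abs] using norm_le_pi_norm n 0
    · simpa [Complex.norm_intCast, Int.norm_eq_abs] using norm_le_pi_norm n 1
  rw [norm_dbarSymbol]
  nlinarith [Real.pi_lt_four, Real.pi_pos, norm_nonneg n]

theorem dbarSymbol_ne_zero {n : Fin 2 → ℤ} (hn : n ≠ 0) : dbarSymbol n ≠ 0 :=
  norm_pos_iff.1 ((norm_pos_iff.2 hn).trans_le (norm_le_norm_dbarSymbol n))

theorem mFourier_coe_eq_planeWave (n : Fin 2 → ℤ) (x : Fin 2 → ℝ) :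
    UnitAddTorus.mFourier n (fun i => (x i : UnitAddCircle)) =
      planeWave n (x 0 + x 1 * Complex.I) := by
  simp only [UnitAddTorus.mFourier, ContinuousMap.coe_mk, Fin.prod_univ_two, fourier_coe_apply,
    planeWave, ← Complex.exp_add]
  congr 1
  simp
  ring

/-- The representative in `(-1/2, 1/2]` of a point of `ℝ / ℤ`. -/
noncomputable def centeredRep (t : UnitAddCircle) : ℝ := AddCircle.equivIoc 1 (-(1 / 2)) t

theorem centeredRep_coe {x : ℝ} (hx : x ∈ Ioc (-(1 / 2) : ℝ) (-(1 / 2) + 1)) :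
    centeredRep x = x :=
  AddCircle.equivIoc_coe_of_mem hx

theorem coe_centeredRep (t : UnitAddCircle) : (centeredRep t : UnitAddCircle) = t :=
  AddCircle.coe_equivIoc

theorem continuousAt_centeredRep_coe {x : ℝ} (hx : |x| < 1 / 2) :
    ContinuousAt centeredRep (x : UnitAddCircle) := by
  rw [abs_lt] at hx
  refine continuous_subtype_val.continuousAt.comp (AddCircle.continuousAt_equivIoc 1 _ fun h => ?_)
  exact hx.1.ne' ((AddCircle.coe_eq_coe_iff_of_mem_Ico
    (mem_Ico.2 ⟨hx.1.le, by linarith [hx.2]⟩) ⟨le_rfl, by norm_num⟩).1 h)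

/-- The periodisation on the torus of a function supported in the square `|x|, |y| < 1/2`. -/
noncomputable def squarePeriodization (g : ℂ → ℂ) (t : UnitAddTorus (Fin 2)) : ℂ :=
  g (centeredRep (t 0) + centeredRep (t 1) * Complex.I)

variable {g : ℂ → ℂ} {r : ℝ}

theorem squarePeriodization_coe {x : Fin 2 → ℝ}
    (hx : ∀ i, x i ∈ Ioc (-(1 / 2) : ℝ) (-(1 / 2) + 1)) :
    squarePeriodization g (fun i => (x i : UnitAddCircle)) = g (x 0 + x 1 * Complex.I) := by
  simp only [squarePeriodization, centeredRep_coe (hx _)]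

theorem continuous_squarePeriodization (hg : Continuous g) (hr : r < 1 / 2)
    (hsupp : ∀ z : ℂ, (r < |z.re| ∨ r < |z.im|) → g z = 0) :
    Continuous (squarePeriodization g) := by
  obtain ⟨C, hC⟩ : ∃ C : Set UnitAddCircle, C = (↑) '' Icc (-r) r := ⟨_, rfl⟩
  have hC_closed : IsClosed C :=
    hC ▸ (isCompact_Icc.image (AddCircle.continuous_mk' 1)).isClosed
  have hrep_gt (s : UnitAddCircle) (hs : s ∉ C) : r < |centeredRep s| := by
    by_contra! hle
    exact hs (hC ▸ ⟨centeredRep s, abs_le.1 hle, coe_centeredRep s⟩)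
  have hrep_cont (s : UnitAddCircle) (hs : s ∈ C) : ContinuousAt centeredRep s := by
    obtain ⟨x, hx, rfl⟩ := hC ▸ hs
    exact continuousAt_centeredRep_coe ((abs_le.2 hx).trans_lt hr)
  refine continuous_iff_continuousAt.2 fun t => ?_
  have hcoord (i : Fin 2) : Continuous fun t : UnitAddTorus (Fin 2) => t i := continuous_apply i
  by_cases ht : t 0 ∈ C ∧ t 1 ∈ C
  · have hrep {i : Fin 2} (hi : t i ∈ C) :
        ContinuousAt (fun t : UnitAddTorus (Fin 2) => (centeredRep (t i) : ℂ)) t :=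
      Complex.continuous_ofReal.continuousAt.comp
        ((hrep_cont _ hi).comp (f := fun t : UnitAddTorus (Fin 2) => t i) (hcoord i).continuousAt)
    exact hg.continuousAt.comp ((hrep ht.1).add ((hrep ht.2).mul continuousAt_const))
  · have hopen : IsOpen {t : UnitAddTorus (Fin 2) | t 0 ∉ C ∨ t 1 ∉ C} :=
      (hC_closed.isOpen_compl.preimage (hcoord 0)).union
        (hC_closed.isOpen_compl.preimage (hcoord 1))
    refine (continuousAt_const (y := (0 : ℂ))).congr ?_
    filter_upwards [hopen.mem_nhds (not_and_or.1 ht)] with s hs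
    exact (hsupp _ (hs.imp (fun h => by simpa using hrep_gt _ h)
      fun h => by simpa using hrep_gt _ h)).symm

theorem mFourierCoeff_squarePeriodization (hr : r < 1 / 2)
    (hsupp : ∀ z : ℂ, (r < |z.re| ∨ r < |z.im|) → g z = 0) :
    UnitAddTorus.mFourierCoeff (squarePeriodization g) = planeCoeff g := by
  funext n
  rw [UnitAddTorus.mFourierCoeff_eq_integral _ n fun _ => -(1 / 2)]
  obtain ⟨B, hB⟩ : ∃ B : Set (Fin 2 → ℝ), B = {x | ∀ i, x i ∈ Ioc (-(1 / 2) : ℝ) (-(1 / 2) + 1)} :=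
    ⟨_, rfl⟩
  have hB_meas : MeasurableSet B := by
    simp only [hB, Set.ofPred_forall]
    exact MeasurableSet.iInter fun i => measurableSet_Ioc.preimage (measurable_pi_apply i)
  have hoff (x : Fin 2 → ℝ) (hx : x ∉ B) :
      g (x 0 + x 1 * Complex.I) * planeWave (-n) (x 0 + x 1 * Complex.I) = 0 := by
    rw [hsupp, zero_mul]
    by_contra! hle
    have hle' : |x 0| ≤ r ∧ |x 1| ≤ r := by simpa using hle
    rw [abs_le, abs_le] at hle'
    refine hx (hB ▸ Fin.forall_fin_two.2 ⟨⟨?_, ?_⟩, ⟨?_, ?_⟩⟩) <;> linarith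
  calc _
      = ∫ x in B, g (x 0 + x 1 * Complex.I) * planeWave (-n) (x 0 + x 1 * Complex.I) := by
        rw [← hB]
        refine setIntegral_congr_fun hB_meas fun x hx => ?_
        rw [hB] at hx
        simp only [mFourier_coe_eq_planeWave, squarePeriodization_coe hx, smul_eq_mul, mul_comm]
    _ = ∫ x : Fin 2 → ℝ, g (x 0 + x 1 * Complex.I) * planeWave (-n) (x 0 + x 1 * Complex.I) :=
        setIntegral_eq_integral_of_forall_compl_eq_zero hoff
    _ = planeCoeff g n := by
        rw [planeCoeff, ← Complex.volume_preserving_equiv_pi.symm.integral_comp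
          Complex.measurableEquivPi.symm.measurableEmbedding]
        rfl

theorem hasSum_planeCoeff_mul_planeWave (hg : Continuous g) (hr : r < 1 / 2)
    (hsupp : ∀ z : ℂ, (r < |z.re| ∨ r < |z.im|) → g z = 0) (hsum : Summable (planeCoeff g)) {z : ℂ}
    (hre : |z.re| ≤ r) (him : |z.im| ≤ r) :
    HasSum (fun n => planeCoeff g n * planeWave n z) (g z) := by
  obtain ⟨x, hx⟩ : ∃ x : Fin 2 → ℝ, x = ![z.re, z.im] := ⟨_, rfl⟩
  have hxz : (x 0 + x 1 * Complex.I : ℂ) = z := by simp [hx, Complex.re_add_im]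
  have hx_mem : ∀ i, x i ∈ Ioc (-(1 / 2) : ℝ) (-(1 / 2) + 1) := by
    rw [abs_le] at hre him
    rw [hx]
    refine Fin.forall_fin_two.2 ⟨⟨?_, ?_⟩, ⟨?_, ?_⟩⟩ <;> simp <;> linarith
  have hcoeff := mFourierCoeff_squarePeriodization hr hsupp
  have hseries := UnitAddTorus.hasSum_mFourier_series_apply_of_summable
    (f := ⟨squarePeriodization g, continuous_squarePeriodization hg hr hsupp⟩) (hcoeff ▸ hsum)
    (fun i => (x i : UnitAddCircle))
  simpa only [ContinuousMap.coe_mk, hcoeff, squarePeriodization_coe hx_mem,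
    mFourier_coe_eq_planeWave, hxz, smul_eq_mul] using hseries

end PlaneWaves

/-! ### Rapidly decreasing Fourier coefficients -/

section Decay

open MeasureTheory

variable {g : ℂ → ℂ}

theorem contDiff_iterate_wirtDbar (hg : ContDiff ℝ ∞ g) (k : ℕ) :
    ContDiff ℝ ∞ (wirtDbar^[k] g) := by
  induction k with
  | zero => exact hg
  | succ k ih => rw [Function.iterate_succ_apply']; exact contDiff_wirtDbar ih

theorem iterate_wirtDbar_eq_zero {C : Set ℂ} (hC : IsClosed C) (hg : ∀ z ∉ C, g z = 0) (k : ℕ)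
    {z : ℂ} (hz : z ∉ C) : wirtDbar^[k] g z = 0 := by
  induction k generalizing z with
  | zero => exact hg z hz
  | succ k ih =>
    rw [Function.iterate_succ_apply',
      wirtDbar_congr (Filter.eventually_of_mem (hC.isOpen_compl.mem_nhds hz) fun w hw => ih hw)]
    exact wirtDbar_const 0

theorem hasCompactSupport_iterate_wirtDbar (hc : HasCompactSupport g) (k : ℕ) :
    HasCompactSupport (wirtDbar^[k] g) :=
  HasCompactSupport.intro hc fun _ hz =>
    iterate_wirtDbar_eq_zero (isClosed_tsupport g) (fun _ => image_eq_zero_of_notMem_tsupport) k hz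

theorem integral_fderiv_apply_eq_zero {E F : Type*} [NormedAddCommGroup E] [NormedSpace ℝ E]
    [FiniteDimensional ℝ E] [MeasurableSpace E] [BorelSpace E] [NormedAddCommGroup F]
    [NormedSpace ℝ F] {μ : Measure E} [μ.IsAddHaarMeasure] {g : E → F} (hg : ContDiff ℝ 1 g)
    (hc : HasCompactSupport g) (v : E) : ∫ z, fderiv ℝ g z v ∂μ = 0 := by
  have hcont : Continuous fun z => fderiv ℝ g z v :=
    (hg.continuous_fderiv (by simp)).clm_apply continuous_const
  have hint : Integrable (fun z => fderiv ℝ g z v) μ :=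
    hcont.integrable_of_hasCompactSupport (hc.fderiv_apply ℝ v)
  simpa using integral_smul_fderiv_eq_neg_fderiv_smul_of_integrable (μ := μ)
    (f := fun _ : E => (1 : ℝ)) (g := g) (v := v) (by simp) (by simpa using hint)
    (by simpa using hg.continuous.integrable_of_hasCompactSupport hc)
    (fun _ _ => differentiableAt_const _) (fun z _ => hg.differentiable (by simp) z)

theorem integral_wirtDbar_eq_zero (hg : ContDiff ℝ 1 g) (hc : HasCompactSupport g) :
    ∫ z, wirtDbar g z = 0 := by
  have hint (v : ℂ) : Integrable fun z => fderiv ℝ g z v :=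
    ((hg.continuous_fderiv (by simp)).clm_apply continuous_const).integrable_of_hasCompactSupport
      (hc.fderiv_apply ℝ v)
  simp only [wirtDbar]
  rw [integral_div, integral_add (hint 1) ((hint _).const_mul _), integral_const_mul,
    integral_fderiv_apply_eq_zero hg hc, integral_fderiv_apply_eq_zero hg hc]
  simp

theorem planeCoeff_wirtDbar (hg : ContDiff ℝ ∞ g) (hc : HasCompactSupport g) (n : Fin 2 → ℤ) :
    planeCoeff (wirtDbar g) n = dbarSymbol n * planeCoeff g n := by
  have hint {f : ℂ → ℂ} (hf : ContDiff ℝ ∞ f) (hcf : HasCompactSupport f) :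
      Integrable fun z => f z * planeWave (-n) z :=
    (hf.continuous.mul (continuous_planeWave _)).integrable_of_hasCompactSupport hcf.mul_right
  have hleibniz (z : ℂ) : wirtDbar (fun w => g w * planeWave (-n) w) z =
      wirtDbar g z * planeWave (-n) z - dbarSymbol n * (g z * planeWave (-n) z) := by
    rw [wirtDbar_mul (hg.differentiable (by simp) z)
      ((contDiff_planeWave (-n)).differentiable (by simp) z), wirtDbar_planeWave, dbarSymbol_neg]
    ring
  have hzero : ∫ z, wirtDbar (fun w => g w * planeWave (-n) w) z = 0 :=
    integral_wirtDbar_eq_zero ((hg.mul (contDiff_planeWave (-n))).of_le (mod_cast le_top))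
      hc.mul_right
  simp only [hleibniz] at hzero
  rw [integral_sub (hint (contDiff_wirtDbar hg) (hasCompactSupport_iterate_wirtDbar hc 1))
    ((hint hg hc).const_mul _), integral_const_mul] at hzero
  exact sub_eq_zero.1 hzero

theorem norm_pow_mul_norm_planeCoeff_le (hg : ContDiff ℝ ∞ g) (hc : HasCompactSupport g) (k : ℕ)
    (n : Fin 2 → ℤ) : ‖n‖ ^ k * ‖planeCoeff g n‖ ≤ ∫ z, ‖wirtDbar^[k] g z‖ := by
  have hcoeff : planeCoeff (wirtDbar^[k] g) n = dbarSymbol n ^ k * planeCoeff g n := by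
    induction k with
    | zero => simp
    | succ k ih =>
      rw [Function.iterate_succ_apply', planeCoeff_wirtDbar (contDiff_iterate_wirtDbar hg k)
        (hasCompactSupport_iterate_wirtDbar hc k), ih]
      ring
  calc ‖n‖ ^ k * ‖planeCoeff g n‖ ≤ ‖dbarSymbol n‖ ^ k * ‖planeCoeff g n‖ := by
        gcongr; exact norm_le_norm_dbarSymbol n
    _ = ‖planeCoeff (wirtDbar^[k] g) n‖ := by rw [hcoeff, norm_mul, norm_pow]
    _ ≤ ∫ z, ‖wirtDbar^[k] g z * planeWave (-n) z‖ := norm_integral_le_integral_norm _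
    _ = ∫ z, ‖wirtDbar^[k] g z‖ := by simp only [norm_mul, norm_planeWave, mul_one]

theorem one_add_norm_pow_mul_norm_planeCoeff_le (hg : ContDiff ℝ ∞ g) (hc : HasCompactSupport g)
    (k : ℕ) (n : Fin 2 → ℤ) :
    (1 + ‖n‖) ^ k * ‖planeCoeff g n‖ ≤
      ((1 + ‖n‖) ^ 3)⁻¹ * (2 ^ (k + 2) * ((∫ z, ‖g z‖) + ∫ z, ‖wirtDbar^[k + 3] g z‖)) := by
  have hlow : ‖planeCoeff g n‖ ≤ ∫ z, ‖g z‖ := by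
    simpa using norm_pow_mul_norm_planeCoeff_le hg hc 0 n
  have hhigh := norm_pow_mul_norm_planeCoeff_le hg hc (k + 3) n
  have hpow : (1 + ‖n‖) ^ (k + 3) ≤ 2 ^ (k + 2) * (1 + ‖n‖ ^ (k + 3)) := by
    simpa using add_pow_le (zero_le_one' ℝ) (norm_nonneg n) (k + 3)
  rw [inv_mul_eq_div, le_div_iff₀ (by positivity)]
  calc (1 + ‖n‖) ^ k * ‖planeCoeff g n‖ * (1 + ‖n‖) ^ 3
      = (1 + ‖n‖) ^ (k + 3) * ‖planeCoeff g n‖ := by ring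
    _ ≤ 2 ^ (k + 2) * (1 + ‖n‖ ^ (k + 3)) * ‖planeCoeff g n‖ := by gcongr
    _ = 2 ^ (k + 2) * (‖planeCoeff g n‖ + ‖n‖ ^ (k + 3) * ‖planeCoeff g n‖) := by ring
    _ ≤ 2 ^ (k + 2) * ((∫ z, ‖g z‖) + ∫ z, ‖wirtDbar^[k + 3] g z‖) := by gcongr

/-- The family `c` decays faster than every power of the norm of the index. -/
def RapidDecay {ι E : Type*} [Norm ι] [Norm E] (c : ι → E) : Prop :=
  ∀ k : ℕ, Summable fun n => (1 + ‖n‖) ^ k * ‖c n‖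

theorem summable_inv_one_add_norm_pow_three :
    Summable fun n : Fin 2 → ℤ => ((1 + ‖n‖) ^ 3)⁻¹ := by
  refine (EisensteinSeries.summable_one_div_norm_rpow (k := 3)
    (by norm_num)).of_norm_bounded_eventually ((finite_singleton 0).subset fun n hn => ?_)
  by_contra hne
  refine hn (?_ : ‖((1 + ‖n‖) ^ 3)⁻¹‖ ≤ ‖n‖ ^ (-3 : ℝ))
  rw [Real.rpow_neg (norm_nonneg _), Real.norm_of_nonneg (by positivity)]
  norm_cast
  exact inv_anti₀ (pow_pos (norm_pos_iff.2 hne) 3) (by gcongr; linarith)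

theorem rapidDecay_planeCoeff (hg : ContDiff ℝ ∞ g) (hc : HasCompactSupport g) :
    RapidDecay (planeCoeff g) := fun k =>
  (summable_inv_one_add_norm_pow_three.mul_right _).of_nonneg_of_le (fun _ => by positivity)
    (one_add_norm_pow_mul_norm_planeCoeff_le hg hc k)

theorem tsum_norm_planeCoeff_le (hg : ContDiff ℝ ∞ g) (hc : HasCompactSupport g) :
    ∑' n, ‖planeCoeff g n‖ ≤ (∑' n : Fin 2 → ℤ, ((1 + ‖n‖) ^ 3)⁻¹) *
      (4 * ((∫ z, ‖g z‖) + ∫ z, ‖wirtDbar^[3] g z‖)) := by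
  rw [← tsum_mul_right]
  refine Summable.tsum_le_tsum (fun n => ?_) (by simpa using rapidDecay_planeCoeff hg hc 0)
    (summable_inv_one_add_norm_pow_three.mul_right _)
  have hle := one_add_norm_pow_mul_norm_planeCoeff_le hg hc 0 n
  norm_num at hle ⊢
  exact hle

end Decay

section Parametric

open MeasureTheory

variable {E : Type*} [NormedAddCommGroup E] [NormedSpace ℝ E] {F : E × ℂ → ℂ}

theorem contDiff_iterate_wirtDbar_snd (hF : ContDiff ℝ ∞ F) (k : ℕ) :
    ContDiff ℝ ∞ fun p : E × ℂ => wirtDbar^[k] (fun z => F (p.1, z)) p.2 := by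
  induction k with
  | zero => exact hF
  | succ k ih =>
    have hslice (p : E × ℂ) (v : ℂ) : fderiv ℝ (wirtDbar^[k] (fun z => F (p.1, z))) p.2 v =
        fderiv ℝ (fun p : E × ℂ => wirtDbar^[k] (fun z => F (p.1, z)) p.2) p (0, v) := by
      have hcomp := HasFDerivAt.comp (f := fun z => (p.1, z)) p.2
        (ih.differentiable (by simp) p).hasFDerivAt (hasFDerivAt_prodMk_right p.1 p.2)
      exact congrArg (· v) hcomp.fderiv
    have hsmooth (v : ℂ) : ContDiff ℝ ∞ fun p =>
        fderiv ℝ (fun p : E × ℂ => wirtDbar^[k] (fun z => F (p.1, z)) p.2) p (0, v) :=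
      (ih.fderiv_right (m := ∞) (by simp)).clm_apply contDiff_const
    simp only [Function.iterate_succ_apply', wirtDbar, hslice]
    exact ((hsmooth 1).add (contDiff_const.mul (hsmooth _))).div_const _

theorem continuous_integral_norm_iterate_wirtDbar_snd [LocallyCompactSpace E]
    (hF : ContDiff ℝ ∞ F) {K : Set ℂ} (hK : IsCompact K) (hFK : ∀ t, ∀ z ∉ K, F (t, z) = 0)
    (k : ℕ) :
    Continuous fun t => ∫ z, ‖wirtDbar^[k] (fun z => F (t, z)) z‖ := by
  have hcont := continuous_parametric_integral_of_continuous (μ := (volume : Measure ℂ))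
    (f := fun t z => ‖wirtDbar^[k] (fun z => F (t, z)) z‖)
    (contDiff_iterate_wirtDbar_snd hF k).continuous.norm hK
  convert hcont using 2 with t
  refine (setIntegral_eq_integral_of_forall_compl_eq_zero fun z hz => ?_).symm
  rw [iterate_wirtDbar_eq_zero hK.isClosed (hFK t) k hz, norm_zero]

/-- Zooming in at a zero of `μ` makes the localised function small in every `C^k` norm, hence in
the `ℓ¹` norm of its Fourier coefficients. -/
theorem exists_forall_tsum_norm_planeCoeff_lt {μ χ : ℂ → ℂ} (hμ : ContDiff ℝ ∞ μ) (hμ0 : μ 0 = 0)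
    (hχ : ContDiff ℝ ∞ χ) (hc : HasCompactSupport χ) {ε : ℝ} (hε : 0 < ε) :
    ∃ δ₀ > 0, ∀ δ : ℝ, 0 < δ → δ < δ₀ →
      ∑' n, ‖planeCoeff (fun z => χ z * μ (δ * z)) n‖ < ε := by
  have hsmooth : ContDiff ℝ ∞ fun p : ℝ × ℂ => χ p.2 * μ (p.1 * p.2) :=
    (hχ.comp contDiff_snd).mul
      (hμ.comp ((Complex.ofRealCLM.contDiff.comp contDiff_fst).mul contDiff_snd))
  have hcont := continuous_integral_norm_iterate_wirtDbar_snd hsmooth hc fun t z hz => by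
    simp only [image_eq_zero_of_notMem_tsupport hz, zero_mul]
  have hzero (k : ℕ) : ∫ z, ‖wirtDbar^[k] (fun z => χ z * μ ((0 : ℝ) * z)) z‖ = 0 := by
    have hvanish (z : ℂ) : wirtDbar^[k] (fun z => χ z * μ ((0 : ℝ) * z)) z = 0 :=
      iterate_wirtDbar_eq_zero isClosed_empty (fun w _ => by simp [hμ0]) k (notMem_empty z)
    simp only [hvanish, norm_zero, integral_zero]
  have hlim : Continuous fun δ : ℝ => (∑' n : Fin 2 → ℤ, ((1 + ‖n‖) ^ 3)⁻¹) *
      (4 * ((∫ z, ‖wirtDbar^[0] (fun z => χ z * μ (δ * z)) z‖) +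
        ∫ z, ‖wirtDbar^[3] (fun z => χ z * μ (δ * z)) z‖)) :=
    continuous_const.mul (continuous_const.mul ((hcont 0).add (hcont 3)))
  obtain ⟨δ₀, hδ₀, hball⟩ := Metric.eventually_nhds_iff.1
    (hlim.continuousAt (x := 0) |>.eventually_lt (continuousAt_const (y := ε))
      (by simp only [hzero, add_zero, mul_zero, hε]))
  refine ⟨δ₀, hδ₀, fun δ hpos hlt => ?_⟩
  refine (tsum_norm_planeCoeff_le (hsmooth.comp (contDiff_prodMk_right δ)) hc.mul_right).trans_lt ?_
  exact hball (by rwa [dist_zero_right, Real.norm_of_nonneg hpos.le])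

end Parametric

/-! ### Neumann series for convolution equations -/

section Neumann

open scoped ENNReal

theorem enorm_mul_le_mul_enorm {R : Type*} [NormedRing R] (a b : R) :
    ‖a * b‖ₑ ≤ ‖a‖ₑ * ‖b‖ₑ := by
  simpa only [enorm_eq_nnnorm, ← ENNReal.coe_mul] using ENNReal.coe_le_coe.2 (nnnorm_mul_le a b)

theorem enorm_mul_le_of_norm_le_one {R : Type*} [NormedRing R] {s : R} (hs : ‖s‖ ≤ 1) (b : R) :
    ‖s * b‖ₑ ≤ ‖b‖ₑ :=
  enorm_le_iff_norm_le.2 ((norm_mul_le s b).trans (mul_le_of_le_one_left (norm_nonneg b) hs))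

variable {ι R : Type*} [AddGroup ι] [NormedRing R] {u : ι → ℝ≥0∞} {m S a b : ι → R}

/-- The convolution of two families indexed by a discrete group; the value is `0` at the indices
where the defining series diverges. -/
noncomputable def discreteConv (a b : ι → R) (n : ι) : R := ∑' j, a (n - j) * b j

/-- The weighted `ℓ¹` norm `∑ u(n) ‖c(n)‖`, with value `∞` allowed. -/
noncomputable def weightedENorm {ι R : Type*} [NormedRing R] (u : ι → ℝ≥0∞) (c : ι → R) : ℝ≥0∞ :=
  ∑' n, u n * ‖c n‖ₑ

/-- The `k`-th term of the Neumann series for the equation `w = m + m ∗ (S w)`. -/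
noncomputable def neumannTerm (m S : ι → R) (k : ℕ) : ι → R :=
  (fun w => discreteConv m (S * w))^[k] m

/-- The sum of the Neumann series for the equation `w = m + m ∗ (S w)`. -/
noncomputable def neumannSeries (m S : ι → R) (n : ι) : R := ∑' k, neumannTerm m S k n

theorem neumannTerm_succ (m S : ι → R) (k : ℕ) :
    neumannTerm m S (k + 1) = discreteConv m (S * neumannTerm m S k) :=
  Function.iterate_succ_apply' _ _ _

theorem weightedENorm_discreteConv_le (hu : ∀ a b, u (a + b) ≤ u a * u b) :
    weightedENorm u (discreteConv a b) ≤ weightedENorm u a * weightedENorm u b := by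
  have hpoint (n : ι) : u n * ‖discreteConv a b n‖ₑ ≤
      ∑' j, u (n - j) * ‖a (n - j)‖ₑ * (u j * ‖b j‖ₑ) :=
    calc u n * ‖discreteConv a b n‖ₑ ≤ u n * ∑' j, ‖a (n - j) * b j‖ₑ := by
          gcongr
          exact enorm_tsum_le_tsum_enorm
      _ = ∑' j, u n * ‖a (n - j) * b j‖ₑ := ENNReal.tsum_mul_left.symm
      _ ≤ ∑' j, u (n - j) * u j * (‖a (n - j)‖ₑ * ‖b j‖ₑ) := by
          gcongr with j
          · simpa only [sub_add_cancel] using hu (n - j) j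
          · exact enorm_mul_le_mul_enorm _ _
      _ = ∑' j, u (n - j) * ‖a (n - j)‖ₑ * (u j * ‖b j‖ₑ) :=
          tsum_congr fun j => mul_mul_mul_comm _ _ _ _
  calc weightedENorm u (discreteConv a b)
      ≤ ∑' n, ∑' j, u (n - j) * ‖a (n - j)‖ₑ * (u j * ‖b j‖ₑ) := ENNReal.tsum_le_tsum hpoint
    _ = ∑' j, (∑' n, u (n - j) * ‖a (n - j)‖ₑ) * (u j * ‖b j‖ₑ) := by
        rw [ENNReal.tsum_comm]
        exact tsum_congr fun j => ENNReal.tsum_mul_right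
    _ = ∑' j, weightedENorm u a * (u j * ‖b j‖ₑ) :=
        tsum_congr fun j => congrArg (· * _) ((Equiv.subRight j).tsum_eq fun n => u n * ‖a n‖ₑ)
    _ = weightedENorm u a * weightedENorm u b := ENNReal.tsum_mul_left

theorem weightedENorm_mul_le {ι : Type*} {u : ι → ℝ≥0∞} {S b : ι → R} (hS : ∀ n, ‖S n‖ ≤ 1) :
    weightedENorm u (S * b) ≤ weightedENorm u b := by
  refine ENNReal.tsum_le_tsum fun n => ?_
  gcongr
  exact enorm_mul_le_of_norm_le_one (hS n) _

theorem weightedENorm_neumannTerm_le (hu : ∀ a b, u (a + b) ≤ u a * u b) (hS : ∀ n, ‖S n‖ ≤ 1)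
    (k : ℕ) : weightedENorm u (neumannTerm m S k) ≤ weightedENorm u m ^ (k + 1) := by
  induction k with
  | zero => rw [zero_add, pow_one]; rfl
  | succ k ih =>
    calc weightedENorm u (neumannTerm m S (k + 1))
        ≤ weightedENorm u m * weightedENorm u (S * neumannTerm m S k) := by
          rw [neumannTerm_succ]
          exact weightedENorm_discreteConv_le hu
      _ ≤ weightedENorm u m * weightedENorm u m ^ (k + 1) := by
          gcongr
          exact (weightedENorm_mul_le hS).trans ih
      _ = weightedENorm u m ^ (k + 1 + 1) := (pow_succ' _ _).symm

theorem tsum_weightedENorm_neumannTerm_le (hu : ∀ a b, u (a + b) ≤ u a * u b)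
    (hS : ∀ n, ‖S n‖ ≤ 1) :
    ∑' k, weightedENorm u (neumannTerm m S k) ≤
      weightedENorm u m * (1 - weightedENorm u m)⁻¹ :=
  (ENNReal.tsum_le_tsum fun k => weightedENorm_neumannTerm_le hu hS k).trans_eq
    (ENNReal.tsum_geometric_add_one _)

theorem weightedENorm_neumannSeries_le (hu : ∀ a b, u (a + b) ≤ u a * u b)
    (hS : ∀ n, ‖S n‖ ≤ 1) :
    weightedENorm u (neumannSeries m S) ≤ weightedENorm u m * (1 - weightedENorm u m)⁻¹ :=
  calc weightedENorm u (neumannSeries m S) ≤ ∑' n, ∑' k, u n * ‖neumannTerm m S k n‖ₑ := by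
        refine ENNReal.tsum_le_tsum fun n => ?_
        rw [ENNReal.tsum_mul_left]
        gcongr
        exact enorm_tsum_le_tsum_enorm
    _ = ∑' k, weightedENorm u (neumannTerm m S k) := ENNReal.tsum_comm
    _ ≤ weightedENorm u m * (1 - weightedENorm u m)⁻¹ := tsum_weightedENorm_neumannTerm_le hu hS

theorem neumannSeries_eq_add_discreteConv [CompleteSpace R] (hS : ∀ n, ‖S n‖ ≤ 1)
    (hm : weightedENorm 1 m < 1) :
    neumannSeries m S = m + discreteConv m (S * neumannSeries m S) := by
  have htotal : ∑' k, weightedENorm 1 (neumannTerm m S k) ≠ ⊤ :=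
    ((tsum_weightedENorm_neumannTerm_le (fun _ _ => (one_mul _).ge) hS).trans_lt
      (ENNReal.mul_lt_top hm.lt_top (ENNReal.inv_lt_top.2 (tsub_pos_of_lt hm)))).ne
  have hle (c : ι → R) (n : ι) : ‖c n‖ₑ ≤ weightedENorm 1 c :=
    (one_mul _).ge.trans (ENNReal.le_tsum (f := fun n => 1 * ‖c n‖ₑ) n)
  have hterm (n : ι) : Summable fun k => neumannTerm m S k n :=
    .of_enorm <| ne_top_of_le_ne_top htotal <| ENNReal.tsum_le_tsum fun k => hle _ n
  have hdouble (n : ι) : Summable (Function.uncurry fun j k =>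
      m (n - j) * (S j * neumannTerm m S k j)) := by
    refine .of_enorm <| ne_top_of_le_ne_top htotal ?_
    rw [ENNReal.tsum_prod', ENNReal.tsum_comm]
    refine ENNReal.tsum_le_tsum fun k => ENNReal.tsum_le_tsum fun j => ?_
    exact (enorm_mul_le_mul_enorm _ _).trans
      (mul_le_mul' ((hle m _).trans hm.le) (enorm_mul_le_of_norm_le_one (hS j) _))
  funext n
  calc neumannSeries m S n = m n + ∑' k, neumannTerm m S (k + 1) n := (hterm n).tsum_eq_zero_add
    _ = m n + ∑' j, ∑' k, m (n - j) * (S j * neumannTerm m S k j) := by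
        simp only [neumannTerm_succ, discreteConv, Pi.mul_apply]
        exact congrArg (m n + ·) (hdouble n).tsum_comm
    _ = m n + discreteConv m (S * neumannSeries m S) n := by
        refine congrArg (m n + ·) (tsum_congr fun j => ?_)
        rw [((hterm j).mul_left (S j)).tsum_mul_left, (hterm j).tsum_mul_left]
        rfl

end Neumann

section NeumannDecay

variable {ι R : Type*} [SeminormedAddGroup ι] [NormedRing R] {m S : ι → R}

theorem RapidDecay.summable_norm {ι E : Type*} [Norm ι] [Norm E] {c : ι → E}
    (hc : RapidDecay c) : Summable fun n => ‖c n‖ := by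
  simpa only [pow_zero, one_mul] using hc 0

theorem weightedENorm_ofReal {ι : Type*} {c : ι → R} {u : ι → ℝ} (hu : ∀ n, 0 ≤ u n)
    (hc : Summable fun n => u n * ‖c n‖) :
    weightedENorm (fun n => ENNReal.ofReal (u n)) c = ENNReal.ofReal (∑' n, u n * ‖c n‖) := by
  rw [ENNReal.ofReal_tsum_of_nonneg (fun n => mul_nonneg (hu n) (norm_nonneg _)) hc]
  exact tsum_congr fun n => by rw [ENNReal.ofReal_mul (hu n), ofReal_norm]

theorem summable_of_weightedENorm_ofReal_ne_top {ι : Type*} {c : ι → R} {u : ι → ℝ}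
    (hu : ∀ n, 0 ≤ u n) (hc : weightedENorm (fun n => ENNReal.ofReal (u n)) c ≠ ⊤) :
    Summable fun n => u n * ‖c n‖ := by
  refine (ENNReal.summable_toReal hc).congr fun n => ?_
  rw [ENNReal.toReal_mul, ENNReal.toReal_ofReal (hu n), toReal_enorm]

theorem exists_pos_tsum_one_add_mul_pow_lt {ι E : Type*} [SeminormedAddGroup ι]
    [SeminormedAddGroup E] {c : ι → E} (hc : RapidDecay c) {q : ℝ} (hq : ∑' n, ‖c n‖ < q) (k : ℕ) :
    ∃ ε : ℝ, 0 < ε ∧ (Summable fun n => (1 + ε * ‖n‖) ^ k * ‖c n‖) ∧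
      ∑' n, (1 + ε * ‖n‖) ^ k * ‖c n‖ < q := by
  have hle {ε : ℝ} (hε : ε ∈ Ioo 0 1) (n : ι) :
      (1 + ε * ‖n‖) ^ k * ‖c n‖ ≤ (1 + ‖n‖) ^ k * ‖c n‖ := by
    have hε0 : 0 ≤ ε := hε.1.le
    gcongr
    exact mul_le_of_le_one_left (norm_nonneg _) hε.2.le
  have hnonneg {ε : ℝ} (hε : ε ∈ Ioo 0 1) (n : ι) : 0 ≤ (1 + ε * ‖n‖) ^ k * ‖c n‖ := by
    have hε0 : 0 ≤ ε := hε.1.le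
    positivity
  have hlim : Filter.Tendsto (fun ε : ℝ => ∑' n, (1 + ε * ‖n‖) ^ k * ‖c n‖) (𝓝[>] 0)
      (𝓝 (∑' n, ‖c n‖)) := by
    refine tendsto_tsum_of_dominated_convergence (hc k) (fun n => ?_) ?_
    · have hcont : Continuous fun ε : ℝ => (1 + ε * ‖n‖) ^ k * ‖c n‖ := by fun_prop
      simpa using (hcont.tendsto 0).mono_left nhdsWithin_le_nhds
    · filter_upwards [Ioo_mem_nhdsGT (zero_lt_one' ℝ)] with ε hε n
      rw [Real.norm_of_nonneg (hnonneg hε n)]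
      exact hle hε n
  obtain ⟨ε, hlt, hε⟩ := ((hlim.eventually_lt_const hq).and
    (Ioo_mem_nhdsGT (zero_lt_one' ℝ))).exists
  exact ⟨ε, hε.1, (hc k).of_nonneg_of_le (hnonneg hε) (hle hε), hlt⟩

theorem one_add_mul_norm_pow_add_le {ε : ℝ} (hε : 0 ≤ ε) (k : ℕ) (a b : ι) :
    (1 + ε * ‖a + b‖) ^ k ≤ (1 + ε * ‖a‖) ^ k * (1 + ε * ‖b‖) ^ k := by
  rw [← mul_pow]
  refine pow_le_pow_left₀ (by positivity) ?_ k
  calc 1 + ε * ‖a + b‖ ≤ 1 + ε * (‖a‖ + ‖b‖) := by gcongr; exact norm_add_le a b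
    _ ≤ 1 + ε * (‖a‖ + ‖b‖) + ε * ‖a‖ * (ε * ‖b‖) := le_add_of_nonneg_right (by positivity)
    _ = (1 + ε * ‖a‖) * (1 + ε * ‖b‖) := by ring

theorem summable_one_add_pow_mul_of_pos {ι E : Type*} [SeminormedAddGroup ι] [SeminormedAddGroup E]
    {c : ι → E} {ε : ℝ} (hε : 0 < ε) {k : ℕ} (hc : Summable fun n => (1 + ε * ‖n‖) ^ k * ‖c n‖) :
    Summable fun n => (1 + ‖n‖) ^ k * ‖c n‖ := by
  refine (hc.mul_left ((1 + ε⁻¹) ^ k)).of_nonneg_of_le (fun n => by positivity) fun n => ?_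
  rw [← mul_assoc, ← mul_pow]
  gcongr
  calc 1 + ‖n‖ ≤ 1 + ‖n‖ + (ε⁻¹ + ε * ‖n‖) := le_add_of_nonneg_right (by positivity)
    _ = (1 + ε⁻¹) * (1 + ε * ‖n‖) := by field_simp; ring

/-- Every power weight is comparable with the submultiplicative weight `(1 + ε‖n‖)ᵏ`, in which the
kernel still has norm less than one when `ε` is small. -/
theorem rapidDecay_neumannSeries (hm : RapidDecay m) (hm1 : ∑' n, ‖m n‖ < 1)
    (hS : ∀ n, ‖S n‖ ≤ 1) : RapidDecay (neumannSeries m S) := fun k => by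
  obtain ⟨ε, hε, hsum, hlt⟩ := exists_pos_tsum_one_add_mul_pow_lt hm hm1 k
  have hpos (n : ι) : 0 ≤ (1 + ε * ‖n‖) ^ k := by positivity
  have hnorm : weightedENorm (fun n => ENNReal.ofReal ((1 + ε * ‖n‖) ^ k)) m < 1 := by
    rw [weightedENorm_ofReal hpos hsum]
    exact ENNReal.ofReal_lt_one.2 hlt
  refine summable_one_add_pow_mul_of_pos hε (summable_of_weightedENorm_ofReal_ne_top hpos ?_)
  refine ne_top_of_le_ne_top ?_ (weightedENorm_neumannSeries_le (fun a b => ?_) hS)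
  · exact ENNReal.mul_ne_top hnorm.ne_top (ENNReal.inv_ne_top.2 (tsub_pos_of_lt hnorm).ne')
  · rw [← ENNReal.ofReal_mul (hpos a)]
    exact ENNReal.ofReal_le_ofReal (one_add_mul_norm_pow_add_le hε.le k a b)

theorem weightedENorm_one {ι : Type*} {c : ι → R} (hc : Summable fun n => ‖c n‖) :
    weightedENorm 1 c = ENNReal.ofReal (∑' n, ‖c n‖) := by
  rw [ENNReal.ofReal_tsum_of_nonneg (fun n => norm_nonneg _) hc]
  exact tsum_congr fun n => by rw [Pi.one_apply, one_mul, ofReal_norm]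

theorem tsum_norm_neumannSeries_le (hm : RapidDecay m) (hm1 : ∑' n, ‖m n‖ < 1)
    (hS : ∀ n, ‖S n‖ ≤ 1) :
    ∑' n, ‖neumannSeries m S n‖ ≤ (∑' n, ‖m n‖) / (1 - ∑' n, ‖m n‖) := by
  have hle := weightedENorm_neumannSeries_le (u := 1) (m := m) (fun _ _ => (one_mul _).ge) hS
  rw [weightedENorm_one (rapidDecay_neumannSeries hm hm1 hS).summable_norm,
    weightedENorm_one hm.summable_norm, ← ENNReal.ofReal_one,
    ← ENNReal.ofReal_sub _ (tsum_nonneg fun _ => norm_nonneg _),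
    ← ENNReal.ofReal_inv_of_pos (sub_pos.2 hm1),
    ← ENNReal.ofReal_mul (tsum_nonneg fun _ => norm_nonneg _), ← div_eq_mul_inv] at hle
  refine (ENNReal.ofReal_le_ofReal_iff ?_).1 hle
  exact div_nonneg (tsum_nonneg fun _ => norm_nonneg _) (sub_nonneg.2 hm1.le)

end NeumannDecay

/-! ### Fourier series with rapidly decaying coefficients -/

section PlaneSums

theorem tsum_mul_tsum_eq_tsum_discreteConv {ι R : Type*} [AddGroup ι] [NormedRing R]
    [CompleteSpace R] {a b : ι → R} (ha : Summable fun n => ‖a n‖) (hb : Summable fun n => ‖b n‖) :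
    (∑' n, a n) * ∑' n, b n = ∑' n, discreteConv a b n := by
  let shear : ι × ι ≃ ι × ι :=
    { toFun := fun p => (p.1 - p.2, p.2)
      invFun := fun p => (p.1 + p.2, p.2)
      left_inv := fun p => by simp
      right_inv := fun p => by simp }
  have hsheared : Summable fun p : ι × ι => a (p.1 - p.2) * b p.2 :=
    shear.summable_iff.2 (summable_mul_of_summable_norm ha hb)
  calc (∑' n, a n) * ∑' n, b n = ∑' p : ι × ι, a p.1 * b p.2 :=
        tsum_mul_tsum_of_summable_norm ha hb
    _ = ∑' p : ι × ι, a (p.1 - p.2) * b p.2 := (shear.tsum_eq fun p => a p.1 * b p.2).symm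
    _ = ∑' n, discreteConv a b n := hsheared.tsum_prod

theorem RapidDecay.mul_left {ι R : Type*} [SeminormedAddGroup ι] [NormedRing R] {c s : ι → R}
    (hc : RapidDecay c) {A : ℝ} (hs : ∀ n, ‖s n‖ ≤ A * (1 + ‖n‖)) :
    RapidDecay fun n => s n * c n := fun k => by
  refine ((hc (k + 1)).mul_left A).of_nonneg_of_le (fun _ => by positivity) fun n => ?_
  calc (1 + ‖n‖) ^ k * ‖s n * c n‖ ≤ (1 + ‖n‖) ^ k * (A * (1 + ‖n‖) * ‖c n‖) := by
        gcongr
        exact (norm_mul_le _ _).trans (by gcongr; exact hs n)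
    _ = A * ((1 + ‖n‖) ^ (k + 1) * ‖c n‖) := by ring

/-- The Fourier series with coefficients `c`. -/
noncomputable def planeSum (c : (Fin 2 → ℤ) → ℂ) (z : ℂ) : ℂ := ∑' n, c n * planeWave n z

variable {a b c : (Fin 2 → ℤ) → ℂ}

theorem RapidDecay.dbarSymbol_mul (hc : RapidDecay c) : RapidDecay fun n => dbarSymbol n * c n :=
  hc.mul_left (A := 8) fun n => (norm_dbarSymbol_le n).trans (by gcongr; linarith)

theorem RapidDecay.dSymbol_mul (hc : RapidDecay c) : RapidDecay fun n => dSymbol n * c n :=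
  hc.mul_left (A := 8) fun n =>
    (norm_dSymbol n).trans_le ((norm_dbarSymbol_le n).trans (by gcongr; linarith))

theorem RapidDecay.norm_mul_planeWave (hc : RapidDecay c) (z : ℂ) :
    Summable fun n => ‖c n * planeWave n z‖ := by
  simpa only [norm_mul, norm_planeWave, mul_one] using hc.summable_norm

theorem norm_planeSum_le (hc : RapidDecay c) (z : ℂ) : ‖planeSum c z‖ ≤ ∑' n, ‖c n‖ :=
  tsum_of_norm_bounded hc.summable_norm.hasSum fun n => by
    rw [norm_mul, norm_planeWave, mul_one]

theorem planeSum_sub (ha : RapidDecay a) (hb : RapidDecay b) (z : ℂ) :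
    planeSum (a - b) z = planeSum a z - planeSum b z := by
  simp only [planeSum, Pi.sub_apply, sub_mul]
  exact (ha.norm_mul_planeWave z).of_norm.tsum_sub (hb.norm_mul_planeWave z).of_norm

theorem planeSum_mul_planeSum (ha : RapidDecay a) (hb : RapidDecay b) (z : ℂ) :
    planeSum a z * planeSum b z = planeSum (discreteConv a b) z := by
  rw [planeSum, planeSum, tsum_mul_tsum_eq_tsum_discreteConv (ha.norm_mul_planeWave z)
    (hb.norm_mul_planeWave z)]
  refine tsum_congr fun n => ?_
  rw [discreteConv, discreteConv, ← tsum_mul_right]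
  refine tsum_congr fun j => ?_
  have hwave : planeWave n z = planeWave (n - j) z * planeWave j z := by
    rw [← planeWave_add, sub_add_cancel]
  rw [hwave]
  ring

theorem hasFDerivAt_planeSum (hc : RapidDecay c) (z : ℂ) :
    HasFDerivAt (planeSum c) (planeSum (fun n => dSymbol n * c n) z • ContinuousLinearMap.id ℝ ℂ +
      planeSum (fun n => dbarSymbol n * c n) z • Complex.conjCLE.toContinuousLinearMap) z := by
  generalize hJ : (Complex.conjCLE.toContinuousLinearMap : ℂ →L[ℝ] ℂ) = J
  have hterm (n : Fin 2 → ℤ) (z : ℂ) : HasFDerivAt (fun z => c n * planeWave n z)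
      ((dSymbol n * c n * planeWave n z) • ContinuousLinearMap.id ℝ ℂ +
        (dbarSymbol n * c n * planeWave n z) • J) z := by
    refine ((hasFDerivAt_planeWave n z).const_mul (c n)).congr_fderiv ?_
    rw [hJ, smul_add, smul_smul, smul_smul, mul_left_comm, ← mul_assoc, mul_left_comm (c n),
      ← mul_assoc (dbarSymbol n)]
  have hbound (n : Fin 2 → ℤ) (z : ℂ) :
      ‖(dSymbol n * c n * planeWave n z) • ContinuousLinearMap.id ℝ ℂ +
        (dbarSymbol n * c n * planeWave n z) • J‖ ≤
      ‖dSymbol n * c n‖ * ‖ContinuousLinearMap.id ℝ ℂ‖ + ‖dbarSymbol n * c n‖ * ‖J‖ :=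
    (norm_add_le _ _).trans_eq (by
      rw [norm_smul, norm_smul, norm_mul (_ * _), norm_mul (_ * _), norm_planeWave, mul_one,
        mul_one])
  have hderiv := hasFDerivAt_tsum
    ((hc.dSymbol_mul.summable_norm.mul_right _).add (hc.dbarSymbol_mul.summable_norm.mul_right _))
    hterm hbound (hc.norm_mul_planeWave 0).of_norm z
  exact hderiv.congr_fderiv
    (((hc.dSymbol_mul.norm_mul_planeWave z).of_norm.hasSum.smul_const _).add
      ((hc.dbarSymbol_mul.norm_mul_planeWave z).of_norm.hasSum.smul_const J)).tsum_eq

theorem contDiff_planeSum (hc : RapidDecay c) : ContDiff ℝ ∞ (planeSum c) := by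
  refine contDiff_infty.2 fun k => ?_
  induction k generalizing c with
  | zero =>
    exact contDiff_zero.2 (continuous_iff_continuousAt.2 fun z =>
      (hasFDerivAt_planeSum hc z).continuousAt)
  | succ k ih =>
    refine contDiff_succ_iff_hasFDerivAt.2 ⟨_, ?_, hasFDerivAt_planeSum hc⟩
    exact ((ih hc.dSymbol_mul).smul contDiff_const).add ((ih hc.dbarSymbol_mul).smul contDiff_const)

theorem wirtD_planeSum (hc : RapidDecay c) (z : ℂ) :
    wirtD (planeSum c) z = planeSum (fun n => dSymbol n * c n) z :=
  wirtD_eq_of_fderiv fun v => by rw [(hasFDerivAt_planeSum hc z).fderiv]; rfl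

theorem wirtDbar_planeSum (hc : RapidDecay c) (z : ℂ) :
    wirtDbar (planeSum c) z = planeSum (fun n => dbarSymbol n * c n) z :=
  wirtDbar_eq_of_fderiv fun v => by rw [(hasFDerivAt_planeSum hc z).fderiv]; rfl

end PlaneSums

section DbarPrimitive

variable {w : (Fin 2 → ℤ) → ℂ}

/-- The multiplier of the Beurling transform, which turns `∂f/∂z̄` into `∂f/∂z` for doubly periodic
`f`. At the frequency `0`, where `dbarSymbol` vanishes, its value is `0`. -/
noncomputable def beurlingSymbol (n : Fin 2 → ℤ) : ℂ := dSymbol n / dbarSymbol n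

/-- A solution of `∂f/∂z̄ = planeSum w`. The mean value `w 0` is not `∂/∂z̄` of a doubly periodic
function and contributes the term `w 0 * z̄`; for the other frequencies one divides by
`dbarSymbol`. -/
noncomputable def dbarPrimitive (w : (Fin 2 → ℤ) → ℂ) (z : ℂ) : ℂ :=
  w 0 * conj z + planeSum (fun n => (dbarSymbol n)⁻¹ * w n) z

theorem dbarSymbol_zero : dbarSymbol 0 = 0 := by
  simp [dbarSymbol]

theorem one_le_norm_dbarSymbol {n : Fin 2 → ℤ} (hn : n ≠ 0) : 1 ≤ ‖dbarSymbol n‖ := by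
  obtain ⟨i, hi⟩ := Function.ne_iff.1 hn
  calc (1 : ℝ) ≤ ‖n i‖ := by
        rw [Int.norm_eq_abs]
        exact_mod_cast Int.one_le_abs hi
    _ ≤ ‖dbarSymbol n‖ := (norm_le_pi_norm n i).trans (norm_le_norm_dbarSymbol n)

theorem norm_inv_dbarSymbol_le_one (n : Fin 2 → ℤ) : ‖(dbarSymbol n)⁻¹‖ ≤ 1 := by
  rcases eq_or_ne n 0 with rfl | hn
  · rw [dbarSymbol_zero, inv_zero, norm_zero]
    exact zero_le_one
  · rw [norm_inv]
    exact inv_le_one_of_one_le₀ (one_le_norm_dbarSymbol hn)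

theorem norm_beurlingSymbol_le_one (n : Fin 2 → ℤ) : ‖beurlingSymbol n‖ ≤ 1 := by
  rw [beurlingSymbol, norm_div, norm_dSymbol]
  exact div_self_le_one _

theorem RapidDecay.mul_left_of_norm_le_one {s : (Fin 2 → ℤ) → ℂ} (hw : RapidDecay w)
    (hs : ∀ n, ‖s n‖ ≤ 1) : RapidDecay fun n => s n * w n :=
  hw.mul_left (A := 1) fun n => (hs n).trans (by linarith [norm_nonneg n])

theorem contDiff_dbarPrimitive (hw : RapidDecay w) : ContDiff ℝ ∞ (dbarPrimitive w) :=
  (contDiff_const.mul Complex.conjCLE.contDiff).add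
    (contDiff_planeSum (hw.mul_left_of_norm_le_one norm_inv_dbarSymbol_le_one))

theorem wirtD_dbarPrimitive (hw : RapidDecay w) (z : ℂ) :
    wirtD (dbarPrimitive w) z = planeSum (beurlingSymbol * w) z := by
  have hprim := hw.mul_left_of_norm_le_one norm_inv_dbarSymbol_le_one
  have hconj : DifferentiableAt ℝ (fun z : ℂ => conj z) z := Complex.conjCLE.differentiableAt
  have hsymbol : (fun n => dSymbol n * ((dbarSymbol n)⁻¹ * w n)) = beurlingSymbol * w :=
    funext fun n => (mul_assoc _ _ _).symm
  calc wirtD (dbarPrimitive w) z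
      = w 0 * conj (wirtDbar (fun z => z) z) + wirtD (planeSum _) z := by
        rw [← wirtD_conj differentiableAt_fun_id, ← wirtD_const_mul _ hconj]
        exact wirtD_add (hconj.const_mul _) (hasFDerivAt_planeSum hprim z).differentiableAt
    _ = planeSum (beurlingSymbol * w) z := by
        rw [wirtDbar_fun_id, wirtD_planeSum hprim, hsymbol, map_zero, mul_zero, zero_add]

theorem wirtDbar_dbarPrimitive (hw : RapidDecay w) (z : ℂ) :
    wirtDbar (dbarPrimitive w) z = planeSum w z := by
  have hprim := hw.mul_left_of_norm_le_one norm_inv_dbarSymbol_le_one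
  have hconj : DifferentiableAt ℝ (fun z : ℂ => conj z) z := Complex.conjCLE.differentiableAt
  have hsplit : planeSum w z =
      w 0 + planeSum (fun n => dbarSymbol n * ((dbarSymbol n)⁻¹ * w n)) z := by
    have hterm (n : Fin 2 → ℤ) : w n * planeWave n z = (if n = 0 then w 0 else 0) +
        dbarSymbol n * ((dbarSymbol n)⁻¹ * w n) * planeWave n z := by
      rcases eq_or_ne n 0 with rfl | hn
      · simp [dbarSymbol_zero, planeWave]
      · rw [if_neg hn, zero_add, mul_inv_cancel_left₀ (dbarSymbol_ne_zero hn)]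
    rw [planeSum, tsum_congr hterm, (hasSum_ite_eq 0 (w 0)).summable.tsum_add
      (hprim.dbarSymbol_mul.norm_mul_planeWave z).of_norm, tsum_ite_eq, planeSum]
  calc wirtDbar (dbarPrimitive w) z
      = w 0 * conj (wirtD (fun z => z) z) + wirtDbar (planeSum _) z := by
        rw [← wirtDbar_conj differentiableAt_fun_id, ← wirtDbar_const_mul _ hconj]
        exact wirtDbar_add (hconj.const_mul _) (hasFDerivAt_planeSum hprim z).differentiableAt
    _ = planeSum w z := by
        rw [wirtD_fun_id, wirtDbar_planeSum hprim, hsplit, map_one, mul_one]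

/-- The function `f` has complex dilatation `c` at `z`: it solves the Beltrami equation
`∂̄f = c ∂f` at this point and `∂f` does not vanish there. -/
def HasDilatationAt (f : ℂ → ℂ) (c z : ℂ) : Prop :=
  wirtDbar f z = c * wirtD f z ∧ wirtD f z ≠ 0

theorem exists_sub_eq_discreteConv_beurlingSymbol_mul {m : (Fin 2 → ℤ) → ℂ} (hm : RapidDecay m)
    (hm_lt : ∑' n, ‖m n‖ < 1 / 2) :
    ∃ w, RapidDecay w ∧ ∑' n, ‖w n‖ < 1 ∧ w - m = discreteConv m (beurlingSymbol * w) := by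
  have hm1 : ∑' n, ‖m n‖ < 1 := by linarith
  refine ⟨neumannSeries m beurlingSymbol,
    rapidDecay_neumannSeries hm hm1 norm_beurlingSymbol_le_one,
    (tsum_norm_neumannSeries_le hm hm1 norm_beurlingSymbol_le_one).trans_lt ?_,
    sub_eq_iff_eq_add'.2 (neumannSeries_eq_add_discreteConv norm_beurlingSymbol_le_one ?_)⟩
  · rw [div_lt_one (by linarith)]
    linarith
  · rw [weightedENorm_one hm.summable_norm]
    exact ENNReal.ofReal_lt_one.2 hm1

/-- In the ansatz `f = z + dbarPrimitive w` the Beltrami equation becomes the convolution equation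
`w = m + m ∗ (beurlingSymbol w)`. -/
theorem exists_forall_hasDilatationAt_planeSum {m : (Fin 2 → ℤ) → ℂ} (hm : RapidDecay m)
    (hm_lt : ∑' n, ‖m n‖ < 1 / 2) :
    ∃ f : ℂ → ℂ, ContDiff ℝ ∞ f ∧ ∀ z, HasDilatationAt f (planeSum m z) z := by
  obtain ⟨w, hw, hw_lt, hconv⟩ := exists_sub_eq_discreteConv_beurlingSymbol_mul hm hm_lt
  have hSw : RapidDecay (beurlingSymbol * w) :=
    hw.mul_left_of_norm_le_one norm_beurlingSymbol_le_one
  have hprim (z : ℂ) := (contDiff_dbarPrimitive hw).differentiable (by simp) z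
  have hD (z : ℂ) : wirtD (fun z => z + dbarPrimitive w z) z =
      1 + planeSum (beurlingSymbol * w) z := by
    rw [wirtD_add differentiableAt_fun_id (hprim z), wirtD_dbarPrimitive hw, wirtD_fun_id]
  have hSw_lt (z : ℂ) : ‖planeSum (beurlingSymbol * w) z‖ < 1 :=
    calc ‖planeSum (beurlingSymbol * w) z‖ ≤ ∑' n, ‖(beurlingSymbol * w) n‖ :=
          norm_planeSum_le hSw z
      _ ≤ ∑' n, ‖w n‖ := hSw.summable_norm.tsum_le_tsum (fun n => by
          rw [Pi.mul_apply, norm_mul]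
          exact mul_le_of_le_one_left (norm_nonneg _) (norm_beurlingSymbol_le_one n))
          hw.summable_norm
      _ < 1 := hw_lt
  refine ⟨fun z => z + dbarPrimitive w z, contDiff_id.add (contDiff_dbarPrimitive hw),
    fun z => ⟨?_, fun hzero => ?_⟩⟩
  · rw [hD, wirtDbar_add differentiableAt_fun_id (hprim z), wirtDbar_dbarPrimitive hw,
      wirtDbar_fun_id, mul_add, mul_one, planeSum_mul_planeSum hm hSw, zero_add]
    exact sub_eq_iff_eq_add'.1 ((planeSum_sub hw hm z).symm.trans (by rw [hconv]))
  · rw [hD, add_comm] at hzero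
    have hlt := hSw_lt z
    rw [eq_neg_of_add_eq_zero_left hzero, norm_neg, norm_one] at hlt
    exact lt_irrefl 1 hlt

end DbarPrimitive

/-! ### The Beltrami equation -/

section Beltrami

variable {f g : ℂ → ℂ} {c z : ℂ}

theorem HasDilatationAt.differentiableAt (hf : HasDilatationAt f c z) :
    DifferentiableAt ℝ f z := by
  by_contra hnot
  exact hf.2 (by simp [wirtD, fderiv_zero_of_not_differentiableAt hnot])

theorem HasDilatationAt.det_fderiv_pos (hf : HasDilatationAt f c z) (hc : ‖c‖ < 1) :
    0 < (fderiv ℝ f z).det := by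
  rw [det_fderiv_eq, hf.1, norm_mul, sub_pos]
  exact pow_lt_pow_left₀ (mul_lt_of_lt_one_left (norm_pos_iff.2 hf.2) hc) (by positivity)
    two_ne_zero

theorem HasDilatationAt.comp (hg : HasDilatationAt g c (f z)) (hf : DifferentiableAt ℝ f z)
    (hne : wirtD f z + c * conj (wirtDbar f z) ≠ 0) :
    HasDilatationAt (fun w => g (f w))
      ((wirtDbar f z + c * conj (wirtD f z)) / (wirtD f z + c * conj (wirtDbar f z))) z := by
  have hD : wirtD (fun w => g (f w)) z =
      wirtD g (f z) * (wirtD f z + c * conj (wirtDbar f z)) := by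
    rw [wirtD_comp hg.differentiableAt hf, hg.1]
    ring
  refine ⟨?_, hD ▸ mul_ne_zero hg.2 hne⟩
  rw [hD, wirtDbar_comp hg.differentiableAt hf, hg.1]
  field_simp

theorem HasDilatationAt.comp_real_mul {δ : ℝ} (hδ : δ ≠ 0) (hg : HasDilatationAt g c (δ * z)) :
    HasDilatationAt (fun w => g (δ * w)) c z := by
  have hδ' : (δ : ℂ) ≠ 0 := Complex.ofReal_ne_zero.2 hδ
  have hD : wirtD (fun w => (δ : ℂ) * w) z = δ := by
    rw [wirtD_const_mul _ differentiableAt_fun_id, wirtD_fun_id, mul_one]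
  have hDbar : wirtDbar (fun w => (δ : ℂ) * w) z = 0 := by
    rw [wirtDbar_const_mul _ differentiableAt_fun_id, wirtDbar_fun_id, mul_zero]
  have hcomp := hg.comp (f := fun w => δ * w) (by fun_prop) (by simpa [hD, hDbar] using hδ)
  rwa [hD, hDbar, map_zero, mul_zero, add_zero, zero_add, Complex.conj_ofReal,
    mul_div_cancel_right₀ _ hδ'] at hcomp

theorem HasDilatationAt.comp_of_wirtD_eq_one {a : ℂ} (hg : HasDilatationAt g
      ((c - a) / (1 - c * conj a)) (f z)) (hf : DifferentiableAt ℝ f z) (hD : wirtD f z = 1)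
    (hDbar : wirtDbar f z = a) (ha : 1 - a * conj a ≠ 0) (hc : 1 - c * conj a ≠ 0) :
    HasDilatationAt (fun w => g (f w)) c z := by
  have hden : 1 + (c - a) / (1 - c * conj a) * conj a = (1 - a * conj a) / (1 - c * conj a) := by
    field_simp
    ring
  have hcomp := hg.comp hf (by rw [hD, hDbar, hden]; exact div_ne_zero ha hc)
  have hdil : (a + (c - a) / (1 - c * conj a)) / ((1 - a * conj a) / (1 - c * conj a)) = c := by
    field_simp
    ring
  rwa [hD, hDbar, map_one, mul_one, hden, hdil] at hcomp

theorem planeSum_planeCoeff {r : ℝ} (hg : ContDiff ℝ ∞ g) (hr : r < 1 / 2)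
    (hsupp : tsupport g ⊆ Metric.ball 0 r) (hz : ‖z‖ ≤ r) : planeSum (planeCoeff g) z = g z := by
  have hcompact : HasCompactSupport g :=
    (isCompact_closedBall (0 : ℂ) r).of_isClosed_subset (isClosed_tsupport g)
      (hsupp.trans Metric.ball_subset_closedBall)
  have hzero (w : ℂ) (hw : r < |w.re| ∨ r < |w.im|) : g w = 0 := by
    refine image_eq_zero_of_notMem_tsupport fun hmem => ?_
    have hnorm := mem_ball_zero_iff.1 (hsupp hmem)
    rcases hw with hre | him
    · linarith [Complex.abs_re_le_norm w]
    · linarith [Complex.abs_im_le_norm w]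
  exact (hasSum_planeCoeff_mul_planeWave hg.continuous hr hzero
    (rapidDecay_planeCoeff hg hcompact).summable_norm.of_norm
    ((Complex.abs_re_le_norm z).trans hz) ((Complex.abs_im_le_norm z).trans hz)).tsum_eq

/-- Zooming in by a small factor `δ` makes `μ (δ z)` small near the origin, so that the Neumann
series converges. -/
theorem exists_hasDilatationAt_of_eq_zero {V : Set ℂ} (hV : IsOpen V) (h0 : (0 : ℂ) ∈ V)
    {μ : ℂ → ℂ} (hμ : ContDiffOn ℝ ∞ μ V) (hμ0 : μ 0 = 0) :
    ∃ f : ℂ → ℂ, ContDiff ℝ ∞ f ∧ ∀ᶠ z in 𝓝 0, HasDilatationAt f (μ z) z := by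
  obtain ⟨θ, hθ, -, hθV, hθ_one⟩ := exists_smooth_cutoff hV isCompact_singleton
    (singleton_subset_iff.2 h0)
  obtain ⟨χ, hχ, hχc, hχ_supp, hχ_one⟩ := exists_smooth_cutoff
    (Metric.isOpen_ball (x := (0 : ℂ)) (ε := 1 / 4)) isCompact_singleton
    (singleton_subset_iff.2 (Metric.mem_ball_self (by norm_num)))
  obtain ⟨δ₀, hδ₀, hsmall⟩ := exists_forall_tsum_norm_planeCoeff_lt
    (contDiff_mul_of_tsupport_subset hV hθ hθV hμ) (by rw [hμ0, mul_zero]) hχ hχc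
    (ε := 1 / 2) (by norm_num)
  obtain ⟨δ, hδ, hδ_lt⟩ := exists_between hδ₀
  obtain ⟨g, hg_eq⟩ : ∃ g : ℂ → ℂ, g = fun z => χ z * (θ (δ * z) * μ (δ * z)) := ⟨_, rfl⟩
  have hg : ContDiff ℝ ∞ g := hg_eq ▸ hχ.mul
    ((contDiff_mul_of_tsupport_subset hV hθ hθV hμ).comp (contDiff_const.mul contDiff_id))
  have hg_supp : tsupport g ⊆ Metric.ball 0 (1 / 4) :=
    hg_eq ▸ (tsupport_mul_subset_left).trans hχ_supp
  have hgc : HasCompactSupport g := hg_eq ▸ hχc.mul_right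
  obtain ⟨f, hf, hf_dil⟩ := exists_forall_hasDilatationAt_planeSum (rapidDecay_planeCoeff hg hgc)
    (hg_eq ▸ hsmall δ hδ hδ_lt)
  have hscale : Filter.Tendsto (fun z : ℂ => ((δ⁻¹ : ℝ) : ℂ) * z) (𝓝 0) (𝓝 0) :=
    Continuous.tendsto' (by fun_prop) _ _ (mul_zero _)
  refine ⟨fun z => f ((δ⁻¹ : ℝ) * z), hf.comp (contDiff_const.mul contDiff_id), ?_⟩
  filter_upwards [hθ_one 0 rfl, hscale.eventually (hχ_one 0 rfl),
    hscale.eventually (Metric.ball_mem_nhds (0 : ℂ) (ε := 1 / 4) (by norm_num))]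
    with z hθz hχz hz
  have hδz : (δ : ℂ) * ((δ⁻¹ : ℝ) * z) = z := by
    rw [← mul_assoc, ← Complex.ofReal_mul, mul_inv_cancel₀ hδ.ne', Complex.ofReal_one, one_mul]
  have hvalue : planeSum (planeCoeff g) ((δ⁻¹ : ℝ) * z) = μ z := by
    rw [planeSum_planeCoeff hg (by norm_num) hg_supp (mem_ball_zero_iff.1 hz).le, hg_eq]
    simp only [hδz, hθz, hχz, Pi.one_apply, one_mul]
  exact HasDilatationAt.comp_real_mul (inv_ne_zero hδ.ne') (hvalue ▸ hf_dil _)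

theorem exists_contDiff_leftInverse_dilatation_eq {a : ℂ} (ha : 1 - a * conj a ≠ 0) (z₀ : ℂ) :
    ∃ L A : ℂ → ℂ, ContDiff ℝ ∞ L ∧ ContDiff ℝ ∞ A ∧ Function.LeftInverse A L ∧ L z₀ = 0 ∧
      ∀ z, wirtD L z = 1 ∧ wirtDbar L z = a := by
  have hsub : ContDiff ℝ ∞ fun z : ℂ => z - z₀ := contDiff_id.sub contDiff_const
  have hconj : ContDiff ℝ ∞ fun z : ℂ => conj (z - z₀) := Complex.conjCLE.contDiff.comp hsub
  refine ⟨fun z => (z - z₀) + a * conj (z - z₀),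
    fun ζ => z₀ + (ζ - a * conj ζ) / (1 - a * conj a),
    hsub.add (contDiff_const.mul hconj), contDiff_const.add ((contDiff_id.sub
      (contDiff_const.mul Complex.conjCLE.contDiff)).div_const _), fun z => ?_, by simp,
    fun z => ?_⟩
  · simp only [map_add, map_mul, Complex.conj_conj]
    field_simp
    ring
  · have hsub_at : DifferentiableAt ℝ (fun z : ℂ => z - z₀) z := hsub.differentiable (by simp) z
    have hconj_at : DifferentiableAt ℝ (fun z : ℂ => conj (z - z₀)) z :=
      hconj.differentiable (by simp) z
    have hD : wirtD (fun z => z - z₀) z = 1 := by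
      rw [wirtD_sub differentiableAt_fun_id (differentiableAt_const _), wirtD_fun_id, wirtD_const,
        sub_zero]
    have hDbar : wirtDbar (fun z => z - z₀) z = 0 := by
      rw [wirtDbar_sub differentiableAt_fun_id (differentiableAt_const _), wirtDbar_fun_id,
        wirtDbar_const, sub_zero]
    rw [wirtD_add hsub_at (hconj_at.const_mul a), wirtDbar_add hsub_at (hconj_at.const_mul a),
      wirtD_const_mul a hconj_at, wirtDbar_const_mul a hconj_at, wirtD_conj hsub_at,
      wirtDbar_conj hsub_at, hD, hDbar]
    simp

/-- The affine change of variables `z ↦ (z - z₀) + a conj (z - z₀)` with `a = μ z₀` reduces to a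
coefficient vanishing at the origin. -/
theorem exists_hasDilatationAt {W : Set ℂ} (hW : IsOpen W) {z₀ : ℂ} (hz₀ : z₀ ∈ W) {μ : ℂ → ℂ}
    (hμ : ContDiffOn ℝ ∞ μ W) (hμ1 : ‖μ z₀‖ < 1) :
    ∃ f : ℂ → ℂ, ContDiff ℝ ∞ f ∧ ∀ᶠ z in 𝓝 z₀, HasDilatationAt f (μ z) z := by
  obtain ⟨a, ha_eq⟩ : ∃ a, a = μ z₀ := ⟨_, rfl⟩
  have ha : 1 - a * conj a ≠ 0 := by
    rw [Complex.mul_conj', sub_ne_zero, ha_eq]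
    exact_mod_cast (pow_lt_one₀ (norm_nonneg _) hμ1 two_ne_zero).ne'
  have hden : ContDiffOn ℝ ∞ (fun z => 1 - μ z * conj a) W :=
    contDiffOn_const.sub (hμ.mul contDiffOn_const)
  obtain ⟨W', hW'_eq⟩ : ∃ W', W' = W ∩ (fun z => 1 - μ z * conj a) ⁻¹' {0}ᶜ := ⟨_, rfl⟩
  have hW' : IsOpen W' :=
    hW'_eq ▸ hden.continuousOn.isOpen_inter_preimage hW isOpen_compl_singleton
  have hW'W : W' ⊆ W := hW'_eq ▸ inter_subset_left
  have hden_ne : ∀ z ∈ W', 1 - μ z * conj a ≠ 0 := fun z hz => (hW'_eq ▸ hz).2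
  have hz₀W' : z₀ ∈ W' := by
    rw [hW'_eq]
    exact ⟨hz₀, ha_eq ▸ ha⟩
  have hν : ContDiffOn ℝ ∞ (fun z => (μ z - a) / (1 - μ z * conj a)) W' := fun z hz =>
    ((hμ.sub contDiffOn_const).mono hW'W z hz).mul ((hden.mono hW'W z hz).inv (hden_ne z hz))
  obtain ⟨L, A, hL, hA, hAL, hLz₀, hL_dil⟩ := exists_contDiff_leftInverse_dilatation_eq ha z₀
  have hAzero : A 0 = z₀ := hLz₀ ▸ hAL z₀
  obtain ⟨h, hh, hh_dil⟩ := exists_hasDilatationAt_of_eq_zero (hW'.preimage hA.continuous)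
    (by rwa [mem_preimage, hAzero]) (hν.comp hA.contDiffOn fun _ hz => hz)
    (by rw [Function.comp_apply, hAzero, ha_eq, sub_self, zero_div])
  have hL_tendsto : Filter.Tendsto L (𝓝 z₀) (𝓝 0) := hLz₀ ▸ hL.continuous.tendsto z₀
  refine ⟨fun z => h (L z), hh.comp hL, ?_⟩
  filter_upwards [hL_tendsto.eventually hh_dil, hW'.mem_nhds hz₀W'] with z hz hzW'
  rw [Function.comp_apply, hAL] at hz
  exact hz.comp_of_wirtD_eq_one (hL.differentiable (by simp) z) (hL_dil z).1 (hL_dil z).2 ha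
    (hden_ne z hzW')

end Beltrami

/-! ### Isothermal coordinates -/

section PullbackMetric

open scoped RealInnerProductSpace

variable {E : Type*} [NormedAddCommGroup E] [InnerProductSpace ℝ E] {L : ℂ →L[ℝ] E}

theorem norm_sq_apply_eq (L : ℂ →L[ℝ] E) (u : ℂ) :
    ‖L u‖ ^ 2 = ‖L 1‖ ^ 2 * u.re ^ 2 + 2 * ⟪L 1, L Complex.I⟫ * u.re * u.im +
      ‖L Complex.I‖ ^ 2 * u.im ^ 2 := by
  have hdecomp : L u = u.re • L 1 + u.im • L Complex.I := by
    rw [← map_smul, ← map_smul, ← map_add]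
    congr 1
    simp [Complex.re_add_im]
  rw [hdecomp, norm_add_sq_real, norm_smul, norm_smul, inner_smul_left, inner_smul_right, mul_pow,
    mul_pow, Real.norm_eq_abs, Real.norm_eq_abs, sq_abs, sq_abs, conj_trivial]
  ring

/-- The Gram determinant `EG - F²` of the quadratic form `u ↦ ‖L u‖²` in the basis `1, i`. -/
noncomputable def gramDet (L : ℂ →L[ℝ] E) : ℝ :=
  ‖L 1‖ ^ 2 * ‖L Complex.I‖ ^ 2 - ⟪L 1, L Complex.I⟫ ^ 2

theorem gramDet_pos (hL : Function.Injective L) : 0 < gramDet L := by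
  have hL_ne {v : ℂ} (hv : v ≠ 0) : 0 < ‖L v‖ ^ 2 :=
    pow_pos (norm_pos_iff.2 ((map_ne_zero_iff L hL).2 hv)) 2
  obtain ⟨u, hu_eq⟩ : ∃ u : ℂ, u = ⟨-⟪L 1, L Complex.I⟫, ‖L 1‖ ^ 2⟩ := ⟨_, rfl⟩
  have hu : u ≠ 0 := fun h => (hL_ne one_ne_zero).ne' (by simpa [hu_eq] using congrArg Complex.im h)
  have hLu : ‖L u‖ ^ 2 = ‖L 1‖ ^ 2 * gramDet L := by
    rw [norm_sq_apply_eq, gramDet, hu_eq]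
    ring
  exact (mul_pos_iff_of_pos_left (hL_ne one_ne_zero)).1 (hLu ▸ hL_ne hu)

/-- The factor `l` in the normal form `‖L u‖² = l |u + μ ū|²`. -/
noncomputable def pullbackScale (L : ℂ →L[ℝ] E) : ℝ :=
  (‖L 1‖ ^ 2 + ‖L Complex.I‖ ^ 2 + 2 * √(gramDet L)) / 4

/-- The coefficient `μ` in the normal form `‖L u‖² = l |u + μ ū|²`: the complex dilatation of the
conformal structure pulled back by `L`. -/
noncomputable def pullbackDilatation (L : ℂ →L[ℝ] E) : ℂ :=
  ((‖L 1‖ ^ 2 - ‖L Complex.I‖ ^ 2 : ℝ) + (2 * ⟪L 1, L Complex.I⟫ : ℝ) * Complex.I) /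
    (4 * pullbackScale L : ℝ)

theorem pullbackScale_pos (hL : Function.Injective L) : 0 < pullbackScale L := by
  have hsqrt := Real.sqrt_pos.2 (gramDet_pos hL)
  unfold pullbackScale
  positivity

theorem norm_pullbackDilatation_lt_one (hL : Function.Injective L) :
    ‖pullbackDilatation L‖ < 1 := by
  have hscale : 0 < 4 * pullbackScale L := mul_pos (by norm_num) (pullbackScale_pos hL)
  have hsqrt := Real.sqrt_pos.2 (gramDet_pos hL)
  have hsq : √(gramDet L) ^ 2 = ‖L 1‖ ^ 2 * ‖L Complex.I‖ ^ 2 - ⟪L 1, L Complex.I⟫ ^ 2 :=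
    Real.sq_sqrt (gramDet_pos hL).le
  rw [pullbackDilatation, norm_div, Complex.norm_real, Real.norm_of_nonneg hscale.le,
    div_lt_one hscale]
  refine lt_of_pow_lt_pow_left₀ 2 hscale.le ?_
  rw [← Complex.normSq_eq_norm_sq, Complex.normSq_add_mul_I]
  calc (‖L 1‖ ^ 2 - ‖L Complex.I‖ ^ 2) ^ 2 + (2 * ⟪L 1, L Complex.I⟫) ^ 2
      = (‖L 1‖ ^ 2 + ‖L Complex.I‖ ^ 2) ^ 2 - 4 * √(gramDet L) ^ 2 := by rw [hsq]; ring
    _ < (‖L 1‖ ^ 2 + ‖L Complex.I‖ ^ 2) ^ 2 := by linarith [pow_pos hsqrt 2]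
    _ ≤ (4 * pullbackScale L) ^ 2 := by
      refine pow_le_pow_left₀ (by positivity) ?_ 2
      rw [pullbackScale]
      linarith

theorem add_div_mul_conj_eq (a b s : ℝ) (u : ℂ) :
    u + (a + b * Complex.I) / s * conj u =
      ⟨u.re + (a * u.re + b * u.im) / s, u.im + (b * u.re - a * u.im) / s⟩ := by
  apply Complex.ext
  · simp [Complex.div_ofReal_re, Complex.div_ofReal_im]
    ring
  · simp [Complex.div_ofReal_re, Complex.div_ofReal_im]
    ring

theorem norm_sq_apply_eq_pullbackScale_mul (hL : Function.Injective L) (u : ℂ) :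
    ‖L u‖ ^ 2 = pullbackScale L * ‖u + pullbackDilatation L * conj u‖ ^ 2 := by
  have hscale := (pullbackScale_pos hL).ne'
  have hsq : √(gramDet L) ^ 2 = ‖L 1‖ ^ 2 * ‖L Complex.I‖ ^ 2 - ⟪L 1, L Complex.I⟫ ^ 2 :=
    Real.sq_sqrt (gramDet_pos hL).le
  rw [pullbackDilatation, add_div_mul_conj_eq, ← Complex.normSq_eq_norm_sq, Complex.normSq_mk,
    norm_sq_apply_eq]
  field_simp
  rw [pullbackScale]
  linear_combination -(4 * (u.re ^ 2 + u.im ^ 2)) * hsq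

theorem isConformalMap_of_norm_sq_eq {F : Type*} [NormedAddCommGroup F] [InnerProductSpace ℝ F]
    {A : F →L[ℝ] E} {c : ℝ} (hc : 0 < c) (hA : ∀ v, ‖A v‖ ^ 2 = c * ‖v‖ ^ 2) :
    IsConformalMap A := by
  refine (isConformalMap_iff A).2 ⟨c, hc, fun u v => ?_⟩
  rw [real_inner_eq_norm_add_mul_self_sub_norm_mul_self_sub_norm_mul_self_div_two,
    real_inner_eq_norm_add_mul_self_sub_norm_mul_self_sub_norm_mul_self_div_two, ← map_add]
  simp only [← sq, hA]
  ring

theorem isConformalMap_comp_of_pullbackDilatation {A B : ℂ →L[ℝ] ℂ} {p : ℂ}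
    (hL : Function.Injective L) (hp : p ≠ 0)
    (hA : ∀ u, A u = p * (u + pullbackDilatation L * conj u))
    (hAB : A.comp B = ContinuousLinearMap.id ℝ ℂ) : IsConformalMap (L.comp B) := by
  have hp_norm : ‖p‖ ≠ 0 := norm_ne_zero_iff.2 hp
  refine isConformalMap_of_norm_sq_eq (c := pullbackScale L / ‖p‖ ^ 2)
    (div_pos (pullbackScale_pos hL) (by positivity)) fun v => ?_
  have hv : v = p * (B v + pullbackDilatation L * conj (B v)) :=
    (DFunLike.congr_fun hAB v).symm.trans (hA (B v))
  rw [ContinuousLinearMap.comp_apply, norm_sq_apply_eq_pullbackScale_mul hL]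
  conv_rhs => rw [hv, norm_mul]
  field_simp

theorem contDiffOn_pullbackDilatation_fderiv {X : ℂ → E} {V : Set ℂ} (hV : IsOpen V)
    (hX : ContDiffOn ℝ ∞ X V) (hinj : ∀ z ∈ V, Function.Injective (fderiv ℝ X z)) :
    ContDiffOn ℝ ∞ (fun z => pullbackDilatation (fderiv ℝ X z)) V := by
  have hX1 := contDiffOn_fderiv_apply hX hV 1
  have hXI := contDiffOn_fderiv_apply hX hV Complex.I
  have hgram : ContDiffOn ℝ ∞ (fun z => gramDet (fderiv ℝ X z)) V :=
    ((hX1.norm_sq ℝ).mul (hXI.norm_sq ℝ)).sub ((hX1.inner ℝ hXI).pow 2)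
  have hscale : ContDiffOn ℝ ∞ (fun z => pullbackScale (fderiv ℝ X z)) V :=
    (((hX1.norm_sq ℝ).add (hXI.norm_sq ℝ)).add (contDiffOn_const.mul
      (hgram.sqrt fun z hz => (gramDet_pos (hinj z hz)).ne'))).div_const 4
  have hofReal {h : ℂ → ℝ} (hh : ContDiffOn ℝ ∞ h V) : ContDiffOn ℝ ∞ (fun z => (h z : ℂ)) V :=
    Complex.ofRealCLM.contDiff.comp_contDiffOn hh
  simp only [pullbackDilatation, div_eq_mul_inv]
  exact ((hofReal ((hX1.norm_sq ℝ).sub (hXI.norm_sq ℝ))).add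
    ((hofReal (contDiffOn_const.mul (hX1.inner ℝ hXI))).mul contDiffOn_const)).mul
    ((hofReal (contDiffOn_const.mul hscale)).inv fun z hz => Complex.ofReal_ne_zero.2
      (mul_pos (by norm_num) (pullbackScale_pos (hinj z hz))).ne')

end PullbackMetric

section LocalInverse

theorem exists_contDiffOn_ball_local_inverse {E F : Type*} [NormedAddCommGroup E]
    [NormedSpace ℝ E] [CompleteSpace E] [NormedAddCommGroup F] [NormedSpace ℝ F] {f : E → F}
    {N : Set E} (hN : IsOpen N) (hf : ContDiffOn ℝ ∞ f N)
    (hinv : ∀ x ∈ N, (fderiv ℝ f x).IsInvertible) {x₀ : E} (hx₀ : x₀ ∈ N) :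
    ∃ ρ > 0, ∃ g : F → E, ContDiffOn ℝ ∞ g (Metric.ball (f x₀) ρ) ∧
      MapsTo g (Metric.ball (f x₀) ρ) N ∧ InjOn g (Metric.ball (f x₀) ρ) ∧
      IsOpen (g '' Metric.ball (f x₀) ρ) ∧ g (f x₀) = x₀ ∧
      ∀ y ∈ Metric.ball (f x₀) ρ,
        (fderiv ℝ f (g y)).comp (fderiv ℝ g y) = ContinuousLinearMap.id ℝ F := by
  have hf_at (x : E) (hx : x ∈ N) : ContDiffAt ℝ ∞ f x := hf.contDiffAt (hN.mem_nhds hx)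
  choose f' hf'_eq using hinv
  have hf' (x : E) (hx : x ∈ N) : HasFDerivAt f (f' x hx : E →L[ℝ] F) x :=
    hf'_eq x hx ▸ ((hf_at x hx).differentiableAt (by simp)).hasFDerivAt
  obtain ⟨e, he, hx₀e⟩ : ∃ e : OpenPartialHomeomorph E F, e = f ∧ x₀ ∈ e.source :=
    ⟨(hf_at x₀ hx₀).toOpenPartialHomeomorph f (hf' x₀ hx₀) (by simp), rfl,
      (hf_at x₀ hx₀).mem_toOpenPartialHomeomorph_source (hf' x₀ hx₀) (by simp)⟩
  have hleft : e.symm (f x₀) = x₀ := he ▸ e.left_inv hx₀e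
  obtain ⟨ρ, hρ, hball⟩ := Metric.isOpen_iff.1 (e.symm.isOpen_inter_preimage hN) (f x₀)
    ⟨he ▸ e.map_source hx₀e, by rwa [mem_preimage, hleft]⟩
  have htarget : Metric.ball (f x₀) ρ ⊆ e.target := fun y hy => (hball hy).1
  have hmaps : MapsTo e.symm (Metric.ball (f x₀) ρ) N := fun y hy => (hball hy).2
  have hsymm (y : F) (hy : y ∈ Metric.ball (f x₀) ρ) : ContDiffAt ℝ ∞ e.symm y :=
    e.contDiffAt_symm (htarget hy) (he ▸ hf' _ (hmaps hy)) (he ▸ hf_at _ (hmaps hy))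
  refine ⟨ρ, hρ, e.symm, fun y hy => (hsymm y hy).contDiffWithinAt, hmaps,
    e.symm.injOn.mono htarget, e.symm.isOpen_image_of_subset_source Metric.isOpen_ball htarget,
    hleft, fun y hy => ?_⟩
  have hright : f ∘ e.symm =ᶠ[𝓝 y] id := by
    filter_upwards [e.open_target.mem_nhds (htarget hy)] with w hw
    rw [Function.comp_apply, ← he, e.right_inv hw, id]
  rw [← fderiv_comp y ((hf_at _ (hmaps hy)).differentiableAt (by simp))
    ((hsymm y hy).differentiableAt (by simp)), hright.fderiv_eq, fderiv_id]

end LocalInverse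

section Reparametrization

variable {E : Type*} [NormedAddCommGroup E] [InnerProductSpace ℝ E] {X : ℂ → E} {V : Set ℂ} {z₀ : ℂ}

theorem isSimplyConnected_ball {F : Type*} [NormedAddCommGroup F] [NormedSpace ℝ F] (x : F) {ρ : ℝ}
    (hρ : 0 < ρ) : IsSimplyConnected (Metric.ball x ρ) := by
  have : ContractibleSpace (Metric.ball x ρ) :=
    (convex_ball x ρ).contractibleSpace ⟨x, Metric.mem_ball_self hρ⟩
  exact inferInstanceAs (SimplyConnectedSpace (Metric.ball x ρ))

theorem det_comp_eq_mul (A B : ℂ →L[ℝ] ℂ) : (A.comp B).det = A.det * B.det :=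
  LinearMap.det_comp _ _

theorem exists_isOpen_forall_injective_fderiv (hV : IsOpen V) (hz₀ : z₀ ∈ V)
    (hX : ContDiffOn ℝ ∞ X V) (hinj : Function.Injective (fderiv ℝ X z₀)) :
    ∃ V' ⊆ V, IsOpen V' ∧ z₀ ∈ V' ∧ ∀ z ∈ V', Function.Injective (fderiv ℝ X z) :=
  ⟨V ∩ fderiv ℝ X ⁻¹' {L | Function.Injective L}, inter_subset_left,
    (hX.continuousOn_fderiv_of_isOpen hV (by simp)).isOpen_inter_preimage hV
      ContinuousLinearMap.isOpen_injective, ⟨hz₀, hinj⟩, fun _ hz => hz.2⟩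

theorem exists_conformal_reparametrization (hV : IsOpen V) (hz₀ : z₀ ∈ V)
    (hX : ContDiffOn ℝ ∞ X V) (hinj : Function.Injective (fderiv ℝ X z₀)) :
    ∃ (W : Set ℂ) (g : ℂ → ℂ), IsOpen W ∧ IsSimplyConnected W ∧ ContDiffOn ℝ ∞ g W ∧
      MapsTo g W V ∧ InjOn g W ∧ IsOpen (g '' W) ∧ z₀ ∈ g '' W ∧
      ∀ z ∈ W, 0 < (fderiv ℝ g z).det ∧ ConformalAt (X ∘ g) z := by
  obtain ⟨V', hV'V, hV', hz₀V', hinj'⟩ := exists_isOpen_forall_injective_fderiv hV hz₀ hX hinj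
  obtain ⟨f, hf, hf_dil⟩ := exists_hasDilatationAt hV' hz₀V'
    (contDiffOn_pullbackDilatation_fderiv hV' (hX.mono hV'V) hinj')
    (norm_pullbackDilatation_lt_one hinj)
  obtain ⟨N, hN_dil, hN, hz₀N⟩ := eventually_nhds_iff.1 (hf_dil.and (hV'.mem_nhds hz₀V'))
  have hdet (z : ℂ) (hz : z ∈ N) : 0 < (fderiv ℝ f z).det :=
    (hN_dil z hz).1.det_fderiv_pos (norm_pullbackDilatation_lt_one (hinj' z (hN_dil z hz).2))
  obtain ⟨ρ, hρ, g, hg, hgN, hg_inj, hg_open, hg_center, hg_inv⟩ :=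
    exists_contDiffOn_ball_local_inverse hN hf.contDiffOn (fun z hz =>
      ⟨(fderiv ℝ f z).toContinuousLinearEquivOfDetNeZero (hdet z hz).ne',
        ContinuousLinearMap.coe_toContinuousLinearEquivOfDetNeZero _ _⟩) hz₀N
  have hgV' : MapsTo g (Metric.ball (f z₀) ρ) V' := fun z hz => (hN_dil _ (hgN hz)).2
  refine ⟨Metric.ball (f z₀) ρ, g, Metric.isOpen_ball, isSimplyConnected_ball _ hρ, hg,
    hgV'.mono_right hV'V, hg_inj, hg_open, ⟨f z₀, Metric.mem_ball_self hρ, hg_center⟩,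
    fun z hz => ⟨?_, ?_⟩⟩
  · have hdet_mul : (fderiv ℝ f (g z)).det * (fderiv ℝ g z).det = 1 := by
      rw [← det_comp_eq_mul, hg_inv z hz]
      exact LinearMap.det_id
    exact pos_of_mul_pos_right (hdet_mul ▸ one_pos) (hdet _ (hgN hz)).le
  · obtain ⟨hf_beltrami, hf_ne⟩ := (hN_dil _ (hgN hz)).1
    have hX_deriv : HasFDerivAt X (fderiv ℝ X (g z)) (g z) :=
      (differentiableAt_of_contDiffOn_isOpen hX hV (hV'V (hgV' hz))).hasFDerivAt
    have hg_deriv : HasFDerivAt g (fderiv ℝ g z) z :=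
      (differentiableAt_of_contDiffOn_isOpen hg Metric.isOpen_ball hz).hasFDerivAt
    refine ⟨_, hX_deriv.comp z hg_deriv, isConformalMap_comp_of_pullbackDilatation
      (hinj' _ (hgV' hz)) hf_ne (fun u => ?_) (hg_inv z hz)⟩
    rw [fderiv_apply_eq_wirtD, hf_beltrami]
    ring

end Reparametrization

section ConformalParameters

variable {S : Type*} [TopologicalSpace S] [ChartedSpace ℂ S]

theorem differentiableAt_of_det_fderiv_ne_zero {f : ℂ → ℂ} {z : ℂ}
    (h : (fderiv ℝ f z).det ≠ 0) : DifferentiableAt ℝ f z := by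
  by_contra hf
  refine h ?_
  rw [fderiv_zero_of_not_differentiableAt hf,
    det_of_apply_eq (A := 0) (B := 0) fun v => by rw [zero_apply, zero_mul, zero_mul, add_zero],
    sub_self]

theorem IsOrientedAtlas.det_fderiv_comp_pos (horient : IsOrientedAtlas S)
    {e e' : OpenPartialHomeomorph S ℂ} (he : e ∈ atlas ℂ S) (he' : e' ∈ atlas ℂ S) {g : ℂ → ℂ}
    {z : ℂ} (hz : g z ∈ e.target) (hz' : e.symm (g z) ∈ e'.source)
    (hg : 0 < (fderiv ℝ g z).det) : 0 < (fderiv ℝ (e' ∘ e.symm ∘ g) z).det := by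
  have htrans : 0 < (fderiv ℝ (e.symm.trans e') (g z)).det :=
    horient e he e' he' (g z) (by rw [OpenPartialHomeomorph.trans_source]; exact ⟨hz, hz'⟩)
  change 0 < (fderiv ℝ (e.symm.trans e' ∘ g) z).det
  rw [fderiv_comp z (differentiableAt_of_det_fderiv_ne_zero htrans.ne')
    (differentiableAt_of_det_fderiv_ne_zero hg.ne'), det_comp_eq_mul]
  exact mul_pos htrans hg

theorem mfderiv_eq_fderiv_comp_chartAt_symm {E : Type*} [NormedAddCommGroup E] [NormedSpace ℝ E]
    {r : S → E} {p : S} (hr : MDifferentiableAt 𝓘(ℝ, ℂ) 𝓘(ℝ, E) r p) :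
    mfderiv 𝓘(ℝ, ℂ) 𝓘(ℝ, E) r p =
      fderiv ℝ (r ∘ (chartAt ℂ p).symm) (chartAt ℂ p p) := by
  refine hr.mfderiv.trans ?_
  simp only [writtenInExtChartAt, extChartAt, chartAt_self_eq, mfld_simps, fderivWithin_univ]
  rfl

theorem exists_isConformalParameter [IsManifold 𝓘(ℝ, ℂ) ∞ S] (horient : IsOrientedAtlas S)
    {r : S → EuclideanSpace ℝ (Fin 4)}
    (hr : ContMDiff 𝓘(ℝ, ℂ) 𝓘(ℝ, EuclideanSpace ℝ (Fin 4)) ∞ r) {p : S}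
    (himm : Function.Injective (mfderiv 𝓘(ℝ, ℂ) 𝓘(ℝ, EuclideanSpace ℝ (Fin 4)) r p)) :
    ∃ (W : Set ℂ) (σ : ℂ → S), IsConformalParameter r W σ ∧ IsSimplyConnected W ∧
      InjOn σ W ∧ IsOpen (σ '' W) ∧ p ∈ σ '' W := by
  obtain ⟨e, he_eq⟩ : ∃ e, e = chartAt ℂ p := ⟨_, rfl⟩
  have he : e ∈ atlas ℂ S := he_eq ▸ chart_mem_atlas ℂ p
  have hp : p ∈ e.source := he_eq ▸ mem_chart_source ℂ p
  have he_symm : ContMDiffOn 𝓘(ℝ, ℂ) 𝓘(ℝ, ℂ) ∞ e.symm e.target := he_eq ▸ contMDiffOn_chart_symm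
  have hX : ContDiffOn ℝ ∞ (r ∘ e.symm) e.target :=
    contMDiffOn_iff_contDiffOn.1 (hr.comp_contMDiffOn he_symm)
  rw [mfderiv_eq_fderiv_comp_chartAt_symm (hr.mdifferentiableAt (by simp)), ← he_eq] at himm
  obtain ⟨W, g, hW, hW_simply, hg, hg_maps, hg_inj, hg_open, hg_mem, hg_conf⟩ :=
    exists_conformal_reparametrization e.open_target (e.map_source hp) hX himm
  refine ⟨W, e.symm ∘ g, ⟨hW, he_symm.comp hg.contMDiffOn hg_maps, fun z hz e' he' hz' =>
    horient.det_fderiv_comp_pos he he' (hg_maps hz) hz' (hg_conf z hz).1,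
    fun z hz => (hg_conf z hz).2⟩, hW_simply, e.symm.injOn.comp hg_inj hg_maps, ?_, ?_⟩
  · rw [image_comp]
    exact e.symm.isOpen_image_of_subset_source hg_open hg_maps.image_subset
  · rw [image_comp]
    exact ⟨e p, hg_mem, e.left_inv hp⟩

end ConformalParameters

theorem mainTheorem2 {S : Type*} [TopologicalSpace S] [ChartedSpace ℂ S]
    [IsManifold 𝓘(ℝ, ℂ) ∞ S] (horient : IsOrientedAtlas S)
    (r : S → EuclideanSpace ℝ (Fin 4))
    (hr : ContMDiff 𝓘(ℝ, ℂ) 𝓘(ℝ, EuclideanSpace ℝ (Fin 4)) ∞ r)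
    (himm : ∀ p : S, Function.Injective
      (mfderiv 𝓘(ℝ, ℂ) 𝓘(ℝ, EuclideanSpace ℝ (Fin 4)) r p)) :
    (∀ p : S, ∃ (W : Set ℂ) (σ : ℂ → S), IsConformalParameter r W σ ∧ IsSimplyConnected W ∧
        InjOn σ W ∧ IsOpen (σ '' W) ∧ p ∈ σ '' W) ∧
    (∀ (W : Set ℂ) (σ : ℂ → S), IsConformalParameter r W σ →
      ∃ (ψ φ : ℂ → Fin 2 → ℂ) (U : ℂ → ℂ),
        IsWeierstrassRepresentation W (r ∘ σ) ψ φ U ∧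
        (∀ z ∈ W, conformalFactor (r ∘ σ) z =
          (‖ψ z 0‖ ^ 2 + ‖ψ z 1‖ ^ 2) * (‖φ z 0‖ ^ 2 + ‖φ z 1‖ ^ 2)) ∧
        (∀ z ∈ W, ‖U z‖ =
          ‖meanCurvatureVector (r ∘ σ) z‖ * Real.sqrt (conformalFactor (r ∘ σ) z) / 2)) := by
  refine ⟨fun p => exists_isConformalParameter horient hr (himm p), fun W σ hσ => ?_⟩
  exact exists_weierstrassRepresentation hσ.isOpen
    (contMDiffOn_iff_contDiffOn.1 (hr.comp_contMDiffOn hσ.smooth)) hσ.conformal
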